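/- **Setting.** Let $G$ be a hyperbolic group acting properly and cocompactly, by cubical automorphisms, on a CAT(0) cube complex $X$ (flag vertex links, simply connected) with its piecewise Euclidean metric $d$. Let $V(X),E(X)$ be the sets of vertices and of unoriented edges, and for an edge $e$ let $W(e)$ be the wall (hyperplane) dual to $e$. For a wall $W$ let $N(W)$ be the union of the cubes that meet $W$; the vertices of $N(W)$ fall into two classes ("sides"), two vertices being in the same class if they are joined by an edge path in $N(W)$ that never crosses $W$. Assume that the sides of all walls are labelled $W^+,W^-$ in such a way that $gW^\pm=(gW)^\pm$ for all $g\in G$. Let $K\triangleleft G$ be a normal subgroup that acts freely on $X$, let $\mathcal X=X/K$ with the quotient metric, and write $\overline W$ for the image in $\mathcal X$ of a wall $W$ of $X$. Let $R>1$ and let $\Gamma$ be the graph whose vertices are the walls of $\mathcal X$, distinct walls being adjacent if their distance is at most $R$. Suppose that all vertex degrees of $\Gamma$ are at most $k\in\mathbb N$. Let $C_{k+1}(\Gamma)$ be the set of proper colourings $c:V(\Gamma)\to\{1,\dots,k+1\}$, with the $G$-action $gc=c\circ g^{-1}$. For $e\in E(X)$ and $c\in C_{k+1}(\Gamma)$ put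 $c(e)=c(\overline{W(e)})$, let $[c]_e$ be the set of those $c'\in C_{k+1}(\Gamma)$ that agree with $c$ on the closed ball of radius $c(e)$ about $\overline{W(e)}$ in $\Gamma$, and put $[e,c]=\{e\}\times[c]_e$ and $g[e,c]=[ge,gc]$. Let $\mathcal{QVH}$ be the smallest class of hyperbolic groups that contains the trivial group and is closed under amalgamated products $A*_BC$ and HNN extensions $A*_B$ over a subgroup $B$ that is finitely generated and quasi-convex in the resulting group, and under passing from a finite-index subgroup to the whole group (all groups formed being required to be hyperbolic). **Statement.** There is a non-empty finite collection $\mathcal V_{k+1}$, in which repetitions are allowed, of triples $(Z,H,(c_x))$, where $Z\subset X$ is a non-empty intersection of closed half-spaces, $H<G$ is a subgroup that preserves $Z$ and acts on it freely and cocompactly, and $(c_x)$ is a family of colourings $c_x\in C_{k+1}(\Gamma)$, indexed by the vertices $x$ of $X$ in $Z$, with $c_{hx}=hc_x$ for $h\in H$, such that: 1. if $e\in E(X)$ joins vertices $x,y\in Z$ of a triple of $\mathcal V_{k+1}$, then $[e,c_x]=[e,c_y]$; 2. if $e\in E(X)$ joins $x,y$ and $x\in Z$, then $y\in Z$ if and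 only if $c_x(e)>k+1$; 3. (Gluing Equations) $|\mathcal V^+_{k+1}(f,c)|=|\mathcal V^-_{k+1}(f,c)|$ for all $f\in E(X)$ and $c\in C_{k+1}(\Gamma)$, where $\mathcal V^{\pm}_{k+1}(f,c)$ is the set of pairs $(H\cdot e,Z)$, with repeated triples counted separately, such that $(Z,H,(c_x))\in\mathcal V_{k+1}$, $e\in E(X)$ has an endpoint $x\in Z$, and there is $g\in G$ with $gZ\cap W(f)^\pm\neq\emptyset$ and $g[e,c_x]=[f,c]$; 4. $H\in\mathcal{QVH}$ for every triple. Moreover, the collection can be chosen so that in every triple $H$ is trivial and $Z$ is the intersection of all half-spaces that contain some vertex $x$ of $X$. -/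

import Mathlib

open scoped Pointwise ENNReal

noncomputable section

universe u v

/-! ### Cube complexes -/

/-- `A` is a face of the parametrised combinatorial cube `φ`: the image of the set of those
corners whose coordinates in some set `I` of directions are prescribed by `a`. -/
def IsCubeFace {V : Type u} {n : ℕ} (φ : (Fin n → Bool) → V) (A : Set V) : Prop :=
  ∃ (I : Set (Fin n)) (a : Fin n → Bool), A = φ '' {b | ∀ i ∈ I, b i = a i}

/-- `φ` parametrises a member of the family `cubes` as an `n`-cube: its corners are distinct and
the members of the family contained in it are exactly its faces. -/
def IsCubeChart {V : Type u} (cubes : Set (Set V)) {n : ℕ} (φ : (Fin n → Bool) → V) : Prop :=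
  Function.Injective φ ∧ Set.range φ ∈ cubes ∧
    ∀ A : Set V, A ⊆ Set.range φ → (A ∈ cubes ↔ IsCubeFace φ A)

/-- A cube complex with vertex set `V` in which cubes are embedded and any two cubes are disjoint
or meet in a common face, given by the vertex sets of its cubes. (Every CAT(0) cube complex
is of this kind.) -/
structure CubeComplex (V : Type u) where
  cubes : Set (Set V)
  singleton_mem : ∀ v : V, {v} ∈ cubes
  exists_chart : ∀ C ∈ cubes, ∃ (n : ℕ) (φ : (Fin n → Bool) → V),
    IsCubeChart cubes φ ∧ Set.range φ = C
  inter_mem : ∀ C ∈ cubes, ∀ D ∈ cubes, (C ∩ D).Nonempty → C ∩ D ∈ cubes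

/-- The point with coordinates `t` in the cube parametrised by `φ`, recorded by its weights at the
vertices: at the corner `φ b` the weight is the product over `i` of `t i` or `1 - t i` according
to `b i`; all other vertices have weight `0`. -/
def cubePoint {V : Type u} {n : ℕ} (φ : (Fin n → Bool) → V) (t : Fin n → ℝ) : V → ℝ :=
  Function.extend φ (fun b => ∏ i, if b i then t i else 1 - t i) 0

namespace CubeComplex

variable {V : Type u} (X : CubeComplex V)

abbrev IsChart {n : ℕ} (φ : (Fin n → Bool) → V) : Prop := IsCubeChart X.cubes φ

/-- Points of the geometric realisation of `X`. -/
def Point : Type u :=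
  {w : V → ℝ // ∃ (n : ℕ) (φ : (Fin n → Bool) → V) (t : Fin n → ℝ),
    X.IsChart φ ∧ (∀ i, t i ∈ Set.Icc (0 : ℝ) 1) ∧ w = cubePoint φ t}

/-- `p` is the point with coordinates `t ∈ [0,1]ⁿ` in the cube parametrised by `φ`. -/
def HasCoords (p : X.Point) {n : ℕ} (φ : (Fin n → Bool) → V) (t : Fin n → ℝ) : Prop :=
  X.IsChart φ ∧ (∀ i, t i ∈ Set.Icc (0 : ℝ) 1) ∧ p.1 = cubePoint φ t

theorem isChart_const (x : V) : X.IsChart (fun _ : Fin 0 → Bool => x) := by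
  refine ⟨fun a b _ => Subsingleton.elim a b, ?_, ?_⟩
  · rw [Set.range_const]; exact X.singleton_mem x
  · intro A hA
    rw [Set.range_const, Set.subset_singleton_iff_eq] at hA
    constructor
    · intro h
      rcases hA with rfl | rfl
      · obtain ⟨n, φ, -, h2⟩ := X.exists_chart _ h
        exact absurd (h2 ▸ Set.mem_range_self (fun _ => true)) (Set.notMem_empty _)
      · exact ⟨Set.univ, fun i => i.elim0, by ext y; simp [eq_comm]⟩
    · rintro ⟨I, a, rfl⟩
      have : (fun _ : Fin 0 → Bool => x) '' {b | ∀ i ∈ I, b i = a i} = {x} := by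
        ext y
        constructor
        · rintro ⟨b, -, rfl⟩; rfl
        · rintro rfl; exact ⟨a, fun i _ => rfl, rfl⟩
      rw [this]; exact X.singleton_mem x

/-- A vertex as a point of the realisation. -/
def vertexPt (x : V) : X.Point :=
  ⟨cubePoint (fun _ : Fin 0 → Bool => x) (fun i => i.elim0),
    0, _, _, X.isChart_const x, fun i => i.elim0, rfl⟩

/-! ### The metric -/

/-- `X.IsString p q ℓ`: there is a finite string of points from `p` to `q`, consecutive ones lying
in a common cube, of total length `ℓ`, lengths being Euclidean lengths in the unit cubes. -/
inductive IsString : X.Point → X.Point → ℝ → Prop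
  | nil (p : X.Point) : IsString p p 0
  | cons {p q r : X.Point} {ℓ : ℝ} {n : ℕ} (φ : (Fin n → Bool) → V) (s t : Fin n → ℝ)
      (hp : X.HasCoords p φ s) (hq : X.HasCoords q φ t) (h : IsString q r ℓ) :
      IsString p r (dist (WithLp.toLp 2 s : EuclideanSpace ℝ (Fin n)) (WithLp.toLp 2 t) + ℓ)

variable {X} in
theorem IsString.append {p q r : X.Point} {a b : ℝ} (h : X.IsString p q a)
    (h' : X.IsString q r b) : X.IsString p r (a + b) := by
  induction h with
  | nil p => simpa using h'
  | cons φ s t hp hq _ ih => rw [add_assoc]; exact .cons φ s t hp hq (ih h')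

variable {X} in
theorem IsString.symm {p q : X.Point} {a : ℝ} (h : X.IsString p q a) : X.IsString q p a := by
  induction h with
  | nil p => exact .nil p
  | cons φ s t hp hq _ ih =>
    have := ih.append (.cons φ t s hq hp (.nil _))
    rwa [add_zero, dist_comm, add_comm] at this

variable {X} in
theorem IsString.nonneg {p q : X.Point} {a : ℝ} (h : X.IsString p q a) : 0 ≤ a := by
  induction h with
  | nil p => exact le_rfl
  | cons φ s t hp hq _ ih => exact add_nonneg dist_nonneg ih

/-- The intrinsic metric: the infimum of the lengths of strings. -/
instance : PseudoEMetricSpace X.Point where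
  edist p q := ⨅ (ℓ : ℝ) (_ : X.IsString p q ℓ), ENNReal.ofReal ℓ
  edist_self p := by
    refine le_antisymm ?_ bot_le
    exact (iInf₂_le (0 : ℝ) (IsString.nil p)).trans (by simp)
  edist_comm p q := by
    refine le_antisymm ?_ ?_ <;>
    exact le_iInf₂ fun ℓ h => iInf₂_le ℓ h.symm
  edist_triangle p q r := by
    refine ENNReal.le_of_forall_pos_le_add fun ε hε hlt => ?_
    have h1 : (⨅ (ℓ : ℝ) (_ : X.IsString p q ℓ), ENNReal.ofReal ℓ) ≠ ⊤ :=
      (lt_of_le_of_lt le_self_add hlt).ne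
    have h2 : (⨅ (ℓ : ℝ) (_ : X.IsString q r ℓ), ENNReal.ofReal ℓ) ≠ ⊤ :=
      (lt_of_le_of_lt le_add_self hlt).ne
    have hε2 : ((ε / 2 : NNReal) : ℝ≥0∞) ≠ 0 := by
      simpa using hε.ne'
    have l1 := ENNReal.lt_add_right h1 hε2
    have l2 := ENNReal.lt_add_right h2 hε2
    obtain ⟨a, ha⟩ := iInf_lt_iff.1 l1
    obtain ⟨ha, ha'⟩ := iInf_lt_iff.1 ha
    obtain ⟨b, hb⟩ := iInf_lt_iff.1 l2
    obtain ⟨hb, hb'⟩ := iInf_lt_iff.1 hb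
    refine (iInf₂_le (a + b) (ha.append hb)).trans ?_
    rw [ENNReal.ofReal_add ha.nonneg hb.nonneg]
    refine (add_le_add ha'.le hb'.le).trans (le_of_eq ?_)
    have : ((ε / 2 : NNReal) : ℝ≥0∞) + (ε / 2 : NNReal) = ε := by
      rw [← ENNReal.coe_add, add_halves]
    rw [add_add_add_comm, this]

/-! ### CAT(0) cube complexes -/

/-- The 1-skeleton. -/
def skeleton : SimpleGraph V where
  Adj x y := x ≠ y ∧ {x, y} ∈ X.cubes
  symm := ⟨fun x y h => ⟨h.1.symm, by rw [Set.pair_comm]; exact h.2⟩⟩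
  loopless := ⟨fun _ h => h.1 rfl⟩

/-- Homotopy of edge paths: the congruence generated by removing backtracks and by pushing a pair
of consecutive edges across a square. -/
inductive PathHomotopic : ∀ {x y : V}, X.skeleton.Walk x y → X.skeleton.Walk x y → Prop
  | refl {x y : V} (p : X.skeleton.Walk x y) : PathHomotopic p p
  | symm {x y : V} {p q : X.skeleton.Walk x y} : PathHomotopic p q → PathHomotopic q p
  | trans {x y : V} {p q r : X.skeleton.Walk x y} :
      PathHomotopic p q → PathHomotopic q r → PathHomotopic p r
  | cons {x y z : V} (h : X.skeleton.Adj x y) {p q : X.skeleton.Walk y z} :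
      PathHomotopic p q → PathHomotopic (.cons h p) (.cons h q)
  | backtrack {x y z : V} (h : X.skeleton.Adj x y) (p : X.skeleton.Walk x z) :
      PathHomotopic (.cons h (.cons h.symm p)) p
  | square {x y y' z w : V} (h₁ : X.skeleton.Adj x y) (h₂ : X.skeleton.Adj y z)
      (h₁' : X.skeleton.Adj x y') (h₂' : X.skeleton.Adj y' z) (hxz : x ≠ z) (hyy : y ≠ y')
      (hS : {x, y, z, y'} ∈ X.cubes) (p : X.skeleton.Walk z w) :
      PathHomotopic (.cons h₁ (.cons h₂ p)) (.cons h₁' (.cons h₂' p))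

/-- The link of every vertex is a flag complex: if finitely many edges at `x` span squares
pairwise then they span a cube. -/
def FlagLinks : Prop :=
  ∀ (x : V) (N : Set V), N.Finite → (∀ y ∈ N, X.skeleton.Adj x y) →
    (∀ y ∈ N, ∀ z ∈ N, y ≠ z → ∃ C ∈ X.cubes, x ∈ C ∧ y ∈ C ∧ z ∈ C) →
    ∃ C ∈ X.cubes, x ∈ C ∧ N ⊆ C

/-- CAT(0): flag links and simply connected, that is, connected (in particular non-empty) and
every closed edge path is null-homotopic. -/
structure IsCAT0 : Prop where
  flag : X.FlagLinks
  connected : X.skeleton.Connected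
  null_homotopic : ∀ (x : V) (p : X.skeleton.Walk x x), X.PathHomotopic p .nil

/-! ### Walls and half-spaces -/

/-- (Unoriented) edges, as sets of two endpoints. -/
def Edge : Type u := {e : Set V // e ∈ X.cubes ∧ e.ncard = 2}

/-- Opposite edges of a square. -/
def Opposite (e e' : X.Edge) : Prop :=
  ∃ S ∈ X.cubes, S.ncard = 4 ∧ e.1 ⊆ S ∧ e'.1 ⊆ S ∧ Disjoint e.1 e'.1

/-- Walls, the connected components of the complex of midcubes. A midcube of an edge is a vertex
of that complex and a midcube of a square is an edge of it, so a wall corresponds to a class of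
edges for the equivalence relation generated by being opposite in a square. -/
def wallSetoid : Setoid X.Edge := Relation.EqvGen.setoid X.Opposite

def Wall : Type u := Quotient X.wallSetoid

/-- `W(e)`, the wall dual to the edge `e`. -/
def wall (e : X.Edge) : X.Wall := Quotient.mk X.wallSetoid e

/-- The midcube orthogonal to the direction `i` in the cube parametrised by `φ` belongs to `W`. -/
def MidcubeIn {n : ℕ} (φ : (Fin n → Bool) → V) (i : Fin n) (W : X.Wall) : Prop :=
  ∃ (e : X.Edge) (b : Fin n → Bool), e.1 = {φ b, φ (Function.update b i (!b i))} ∧ X.wall e = W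

/-- A wall as a subset of the realisation: the union of its midcubes. -/
def wallPoints (W : X.Wall) : Set X.Point :=
  {p | ∃ (n : ℕ) (φ : (Fin n → Bool) → V) (t : Fin n → ℝ) (i : Fin n),
    X.HasCoords p φ t ∧ X.MidcubeIn φ i W ∧ t i = 1 / 2}

/-- The vertices that can be joined to `x` by an edge path that never crosses `W`. -/
def sideOf (W : X.Wall) (x : V) : Set V :=
  {y | Relation.ReflTransGen (fun a b => ∃ e : X.Edge, e.1 = {a, b} ∧ X.wall e ≠ W) x y}

/-- The (closed) half-space of `W` on the side of the vertex `x`: the union of the cubes all of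
whose vertices are on that side and, for each cube with a midcube in `W`, the closed half of it
that contains a vertex on that side. -/
def halfSpace (W : X.Wall) (x : V) : Set X.Point :=
  {p | ∃ (n : ℕ) (φ : (Fin n → Bool) → V) (t : Fin n → ℝ), X.HasCoords p φ t ∧
    ((∀ b, φ b ∈ X.sideOf W x) ∨
      ∃ (i : Fin n) (b : Fin n → Bool), X.MidcubeIn φ i W ∧ φ b ∈ X.sideOf W x ∧
        |t i - (if b i then 1 else 0)| ≤ 1 / 2)}

def IsHalfSpace (S : Set X.Point) : Prop := ∃ (W : X.Wall) (x : V), S = X.halfSpace W x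

/-- The intersection of all half-spaces that contain the vertex `x`. -/
def vertexStar (x : V) : Set X.Point :=
  ⋂₀ {S | X.IsHalfSpace S ∧ X.vertexPt x ∈ S}

/-- The cube with vertex set `C` meets the wall `W`. -/
def CubeMeets (C : Set V) (W : X.Wall) : Prop :=
  C ∈ X.cubes ∧ ∃ e : X.Edge, e.1 ⊆ C ∧ X.wall e = W

/-- The vertices of `N(W)`, the union of the cubes that meet `W`. -/
def carrier (W : X.Wall) : Set V := {x | ∃ C, X.CubeMeets C W ∧ x ∈ C}

/-- The vertices that can be joined to `x` by an edge path in `N(W)` that never crosses `W`. -/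
def carrierSide (W : X.Wall) (x : V) : Set V :=
  {y | Relation.ReflTransGen (fun a b => ∃ e : X.Edge, e.1 = {a, b} ∧ X.wall e ≠ W ∧
    ∃ C, X.CubeMeets C W ∧ e.1 ⊆ C) x y}

/-! ### Group actions -/

/-- The action of `G` on the vertices is an action on the cube complex `X`. -/
class IsCubicalAction (G : Type v) [Group G] [MulAction G V] : Prop where
  smul_mem : ∀ (g : G) (C : Set V), C ∈ X.cubes → g • C ∈ X.cubes

section Action

variable {G : Type v} [Group G] [MulAction G V] [X.IsCubicalAction G]

theorem smul_mem_cubes_iff (g : G) (C : Set V) : g • C ∈ X.cubes ↔ C ∈ X.cubes :=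
  ⟨fun h => by simpa using IsCubicalAction.smul_mem (X := X) g⁻¹ _ h,
    fun h => IsCubicalAction.smul_mem g C h⟩

variable {X} in
theorem IsChart.smul {n : ℕ} {φ : (Fin n → Bool) → V} (h : X.IsChart φ) (g : G) :
    X.IsChart (fun b => g • φ b) := by
  have hr : Set.range (fun b => g • φ b) = g • Set.range φ := by
    ext y; simp [Set.mem_smul_set]
  refine ⟨fun a b hab => h.1 (MulAction.injective g hab), ?_, fun A hA => ?_⟩
  · rw [hr]; exact IsCubicalAction.smul_mem g _ h.2.1
  · rw [hr, Set.subset_smul_set_iff] at hA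
    rw [← X.smul_mem_cubes_iff g⁻¹ A, h.2.2 _ hA]
    refine exists_congr fun I => exists_congr fun a => ?_
    rw [inv_smul_eq_iff, ← Set.image_smul, Set.image_image]

theorem cubePoint_smul (g : G) {n : ℕ} {φ : (Fin n → Bool) → V} (hφ : Function.Injective φ)
    (t : Fin n → ℝ) (v : V) :
    cubePoint φ t (g⁻¹ • v) = cubePoint (fun b => g • φ b) t v := by
  have hφ' : Function.Injective (fun b => g • φ b) := (MulAction.injective g).comp hφ
  by_cases hv : ∃ b, g • φ b = v
  · obtain ⟨b, rfl⟩ := hv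
    rw [inv_smul_smul, cubePoint, cubePoint, hφ.extend_apply]
    exact (hφ'.extend_apply (fun b => ∏ i, if b i then t i else 1 - t i) 0 b).symm
  · rw [cubePoint, cubePoint, Function.extend_apply' _ _ _ hv, Function.extend_apply']
    · rfl
    · rintro ⟨b, hb⟩
      exact hv ⟨b, by rw [hb, smul_inv_smul]⟩

instance : MulAction G X.Point where
  smul g p := ⟨fun v => p.1 (g⁻¹ • v), by
    obtain ⟨n, φ, t, h, ht, hp⟩ := p.2
    refine ⟨n, fun b => g • φ b, t, h.smul g, ht, ?_⟩
    funext v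
    rw [hp]
    exact cubePoint_smul g h.1 t v⟩
  one_smul p := Subtype.ext (funext fun v => by
    change p.1 ((1 : G)⁻¹ • v) = p.1 v; simp)
  mul_smul g h p := Subtype.ext (funext fun v => by
    change p.1 ((g * h)⁻¹ • v) = p.1 (h⁻¹ • g⁻¹ • v)
    rw [mul_inv_rev, mul_smul])

instance : MulAction G X.Edge where
  smul g e := ⟨g • e.1, IsCubicalAction.smul_mem g _ e.2.1, by
    rw [← Set.image_smul, Set.ncard_image_of_injective _ (MulAction.injective g)]
    exact e.2.2⟩
  one_smul e := Subtype.ext (one_smul G e.1)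
  mul_smul g h e := Subtype.ext (mul_smul g h e.1)

theorem Opposite.smul {e e' : X.Edge} (h : X.Opposite e e') (g : G) :
    X.Opposite (g • e) (g • e') := by
  obtain ⟨S, hS, h4, h1, h2, hd⟩ := h
  refine ⟨g • S, IsCubicalAction.smul_mem g _ hS, ?_, Set.smul_set_mono h1, Set.smul_set_mono h2,
    ?_⟩
  · rw [← Set.image_smul, Set.ncard_image_of_injective _ (MulAction.injective g), h4]
  · change Disjoint (g • e.1) (g • e'.1)
    exact (Set.disjoint_image_iff (MulAction.injective g)).2 hd

theorem wallSetoid_smul {e e' : X.Edge} (h : X.wallSetoid e e') (g : G) :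
    X.wallSetoid (g • e) (g • e') := by
  change Relation.EqvGen X.Opposite e e' at h
  change Relation.EqvGen X.Opposite (g • e) (g • e')
  induction h with
  | rel _ _ h => exact .rel _ _ (Opposite.smul X h g)
  | refl _ => exact .refl _
  | symm _ _ _ ih => exact .symm _ _ ih
  | trans _ _ _ _ _ ih1 ih2 => exact .trans _ _ _ ih1 ih2

/-- The action on walls, `g W(e) = W(g e)`. -/
instance : MulAction G X.Wall where
  smul g := Quotient.map (g • ·) fun _ _ h => X.wallSetoid_smul h g
  one_smul := by rintro ⟨e⟩; exact congrArg X.wall (one_smul G e)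
  mul_smul g h := by rintro ⟨e⟩; exact congrArg X.wall (mul_smul g h e)

variable (G) in
/-- A proper action: every point has a ball `B` such that `g B` meets `B` for only finitely
many `g`. -/
def IsProperAction : Prop :=
  ∀ p : X.Point, ∃ r : ℝ≥0∞, 0 < r ∧
    {g : G | ((g • Metric.eball p r) ∩ Metric.eball p r).Nonempty}.Finite

/-- `H` preserves `Z`, and acts on it freely. -/
def ActsFreelyOn (H : Subgroup G) (Z : Set X.Point) : Prop :=
  (∀ h ∈ H, h • Z = Z) ∧ ∀ h ∈ H, ∀ p ∈ Z, h • p = p → h = 1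

/-- `H` preserves `Z`, and acts on it cocompactly. -/
def ActsCocompactlyOn (H : Subgroup G) (Z : Set X.Point) : Prop :=
  (∀ h ∈ H, h • Z = Z) ∧ ∃ C : Set X.Point, IsCompact C ∧ C ⊆ Z ∧ Z ⊆ ⋃ h ∈ H, h • C

variable (G) in
/-- A `G`-equivariant labelling of the two sides of every wall `W` of `X` (the classes of vertices
of `N(W)` joined by edge paths in `N(W)` that never cross `W`) as `W⁺` and `W⁻`. -/
structure SideLabelling where
  plus : X.Wall → Set V
  minus : X.Wall → Set V
  ne : ∀ W, plus W ≠ minus W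
  isSide_iff : ∀ (W : X.Wall) (S : Set V),
    (∃ x ∈ X.carrier W, S = X.carrierSide W x) ↔ S = plus W ∨ S = minus W
  smul_plus : ∀ (g : G) (W : X.Wall), plus (g • W) = g • plus W
  smul_minus : ∀ (g : G) (W : X.Wall), minus (g • W) = g • minus W

/-! ### The quotient by a normal subgroup and its walls -/

/-- The walls of the quotient `X / K`: `K`-orbits of walls of `X`. -/
def QWall (K : Subgroup G) : Type u := MulAction.orbitRel.Quotient K X.Wall

variable (K : Subgroup G)

/-- The image in `X / K` of a wall of `X`. -/
def toQWall (W : X.Wall) : X.QWall K := Quotient.mk (MulAction.orbitRel K X.Wall) W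

/-- The action of `G` on the walls of `X / K`. -/
instance [K.Normal] : MulAction G (X.QWall K) where
  smul g := Quotient.map (g • ·) (by
    rintro W W' ⟨k, rfl⟩
    refine ⟨⟨g * k * g⁻¹, ‹K.Normal›.conj_mem k k.2 g⟩, ?_⟩
    change (g * k * g⁻¹) • g • W' = g • (k : G) • W'
    simp [mul_smul])
  one_smul := by rintro ⟨W⟩; exact congrArg (X.toQWall K) (one_smul G W)
  mul_smul g h := by rintro ⟨W⟩; exact congrArg (X.toQWall K) (mul_smul g h W)

/-- The distance between two walls in `X / K`, for the quotient metric
`d(Kp, Kq) = inf {d(p', q') | p' ∈ Kp, q' ∈ Kq}`. -/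
def qwallDist (w w' : X.QWall K) : ℝ≥0∞ :=
  ⨅ (W : X.Wall) (_ : X.toQWall K W = w) (W' : X.Wall) (_ : X.toQWall K W' = w')
    (p ∈ X.wallPoints W) (q ∈ X.wallPoints W'), edist p q

theorem qwallDist_comm (w w' : X.QWall K) : X.qwallDist K w w' = X.qwallDist K w' w := by
  have key : ∀ a b : X.QWall K, X.qwallDist K a b ≤ X.qwallDist K b a := by
    intro a b
    refine le_iInf₂ fun W hW => le_iInf₂ fun W' hW' => le_iInf₂ fun p hp => le_iInf₂ fun q hq => ?_
    refine (iInf₂_le W' hW').trans ((iInf₂_le W hW).trans ((iInf₂_le q hq).trans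
      ((iInf₂_le p hp).trans ?_)))
    rw [edist_comm]
  exact le_antisymm (key w w') (key w' w)

/-- The graph `Γ`: its vertices are the walls of `X / K`, and distinct walls are adjacent if their
distance is at most `R`. -/
def wallGraph (R : ℝ) : SimpleGraph (X.QWall K) where
  Adj w w' := w ≠ w' ∧ X.qwallDist K w w' ≤ ENNReal.ofReal R
  symm := ⟨fun w w' h => ⟨h.1.symm, X.qwallDist_comm K w w' ▸ h.2⟩⟩
  loopless := ⟨fun _ h => h.1 rfl⟩

end Action

end CubeComplex

/-! ### Colourings -/

/-- The set `C_n(Γ)` of proper colourings of `Γ` with colours `1, …, n`. -/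
def colourings {α : Type u} (Γ : SimpleGraph α) (n : ℕ) : Set (α → ℕ) :=
  {c | (∀ w, 1 ≤ c w ∧ c w ≤ n) ∧ ∀ w w', Γ.Adj w w' → c w ≠ c w'}

/-- The class of colourings that agree with `c` on the ball of radius `c w` about `w`. -/
def colouringClass {α : Type u} (Γ : SimpleGraph α) (n : ℕ) (w : α) (c : α → ℕ) :
    Set (α → ℕ) :=
  {c' ∈ colourings Γ n | ∀ w', (∃ p : Γ.Walk w w', p.length ≤ c w) → c' w' = c w'}

/-- The action on colourings, `g c = c ∘ g⁻¹`. -/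
def colouringSMul {G : Type v} [Group G] {α : Type u} [MulAction G α] (g : G) (c : α → ℕ) :
    α → ℕ :=
  fun w => c (g⁻¹ • w)

/-! ### Hyperbolic groups and the class `𝒬𝒱ℋ` -/

section QVH

/-- Word length with respect to the generating set `S`. -/
def wordLength {G : Type v} [Group G] (S : Set G) (g : G) : ℕ :=
  sInf {n | ∃ l : List G, l.length = n ∧ (∀ s ∈ l, s ∈ S ∨ s⁻¹ ∈ S) ∧ l.prod = g}

def wordDist {G : Type v} [Group G] (S : Set G) (g h : G) : ℕ := wordLength S (g⁻¹ * h)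

/-- Word-hyperbolic groups: finitely generated, with a word metric that satisfies Gromov's
four-point condition. -/
def IsHyperbolicGroup (G : Type v) [Group G] : Prop :=
  ∃ S : Set G, S.Finite ∧ Subgroup.closure S = ⊤ ∧ ∃ δ : ℕ, ∀ x y z w : G,
    wordDist S x y + wordDist S z w ≤
      max (wordDist S x z + wordDist S y w) (wordDist S x w + wordDist S y z) + δ

/-- Quasi-convex subgroups: for a finite generating set, geodesics of the Cayley graph between
elements of `B` stay in a bounded neighbourhood of `B`. -/
def IsQuasiconvex {G : Type v} [Group G] (B : Subgroup G) : Prop :=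
  ∃ S : Set G, S.Finite ∧ Subgroup.closure S = ⊤ ∧ ∃ κ : ℕ, ∀ a ∈ B, ∀ b ∈ B, ∀ g : G,
    wordDist S a g + wordDist S g b = wordDist S a b → ∃ b' ∈ B, wordDist S g b' ≤ κ

/-- `G` is the amalgamated product of its subgroups `A true` and `A false` over their
intersection. -/
def IsAmalgam {G : Type v} [Group G] (A : Bool → Subgroup G) : Prop :=
  Function.Bijective (Monoid.PushoutI.lift
    (φ := fun i => Subgroup.inclusion (iInf_le A i))
    (fun i => (A i).subtype) (⨅ i, A i).subtype (fun _ => rfl))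

/-- `G` is the HNN extension of its subgroup `A` with stable letter `t` that conjugates the
subgroup `B` of `A` to the subgroup `B'` of `A` through `ψ`. -/
def IsHNN {G : Type v} [Group G] (A : Subgroup G) (B B' : Subgroup A) (ψ : B ≃* B') (t : G) :
    Prop :=
  ∃ h : ∀ b : B, t * A.subtype b = A.subtype (ψ b) * t,
    Function.Bijective (HNNExtension.lift (φ := ψ) A.subtype t h)

/-- The smallest class of hyperbolic groups that contains the trivial group and is closed under
amalgamated products and HNN extensions over finitely generated quasi-convex subgroups and under
passing to overgroups of finite index. -/
inductive QVH : (G : Type v) → [Group G] → Prop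
  | trivial (G : Type v) [Group G] : Subsingleton G → QVH G
  | amalgam (G : Type v) [Group G] (A : Bool → Subgroup G) :
      IsHyperbolicGroup G → IsAmalgam A → (⨅ i, A i).FG → IsQuasiconvex (⨅ i, A i) →
      (∀ i, QVH (A i)) → QVH G
  | hnn (G : Type v) [Group G] (A : Subgroup G) (B B' : Subgroup A) (ψ : B ≃* B') (t : G) :
      IsHyperbolicGroup G → IsHNN A B B' ψ t → (B.map A.subtype).FG →
      IsQuasiconvex (B.map A.subtype) → QVH A → QVH G
  | finiteIndex (G : Type v) [Group G] (H : Subgroup G) :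
      IsHyperbolicGroup G → H.FiniteIndex → QVH H → QVH G

end QVH

/-! ### The collections `𝒱_j` -/

namespace CubeComplex

variable {V : Type u} (X : CubeComplex V) {G : Type v} [Group G] [MulAction G V]
  [X.IsCubicalAction G] (K : Subgroup G)

/-- The data `(Z, H, (c_x))`. Only the values `c x` at vertices `x` of `Z` matter. -/
structure Triple where
  Z : Set X.Point
  H : Subgroup G
  c : V → X.QWall K → ℕ

/-- The class `[e, c] = {e} × [c]_e`. -/
def edgeClass (R : ℝ) (n : ℕ) (e : X.Edge) (c : X.QWall K → ℕ) :
    Set (X.Edge × (X.QWall K → ℕ)) :=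
  {e} ×ˢ colouringClass (X.wallGraph K R) n (X.toQWall K (X.wall e)) c

variable [K.Normal]

/-- `Z` is a non-empty intersection of half-spaces, `H` acts on it freely and cocompactly, and
`(c_x)` is an `H`-equivariant family of colourings with `n` colours, indexed by the vertices
of `Z`. -/
structure Triple.IsValid {X : CubeComplex V} [X.IsCubicalAction G] {K : Subgroup G} [K.Normal]
    (R : ℝ) (n : ℕ) (T : X.Triple K) : Prop where
  nonempty : T.Z.Nonempty
  isInter : ∃ 𝓢 : Set (Set X.Point), (∀ S ∈ 𝓢, X.IsHalfSpace S) ∧ T.Z = ⋂₀ 𝓢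
  free : X.ActsFreelyOn T.H T.Z
  cocompact : X.ActsCocompactlyOn T.H T.Z
  colouring : ∀ x, X.vertexPt x ∈ T.Z → T.c x ∈ colourings (X.wallGraph K R) n
  equivariant : ∀ h ∈ T.H, ∀ x, X.vertexPt x ∈ T.Z → T.c (h • x) = colouringSMul h (T.c x)

/-- For a family of triples (a collection in which repetitions are allowed and counted) and a
choice `side` of a side of every wall, the set of pairs `(H · e, Z)` such that, for some `g`, the
set `gZ` contains a vertex of the chosen side of `W(f)` and `g [e, c_e] = [f, c]`. Here `e` is an
edge with an endpoint `x` in `Z` and `[e, c_e] = [e, c_x]`. -/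
def gluingSet (R : ℝ) (n : ℕ) {m : ℕ} (T : Fin m → X.Triple K) (side : X.Wall → Set V)
    (f : X.Edge) (c : X.QWall K → ℕ) : Set (Fin m × Set X.Edge) :=
  {q | ∃ (e : X.Edge) (x : V), x ∈ e.1 ∧ X.vertexPt x ∈ (T q.1).Z ∧
    q.2 = MulAction.orbit (T q.1).H e ∧
    ∃ g : G, ((g • (T q.1).Z) ∩ X.vertexPt '' side (X.wall f)).Nonempty ∧
      X.edgeClass K R n (g • e) (colouringSMul g ((T q.1).c x)) = X.edgeClass K R n f c}

/-- The requirements on the collection `𝒱_j`, for colourings of `Γ` with `n` colours. -/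
structure IsGluingCollection (σ : X.SideLabelling G) (R : ℝ) (n j : ℕ) {m : ℕ}
    (T : Fin m → X.Triple K) : Prop where
  nonempty : 0 < m
  valid : ∀ i, (T i).IsValid R n
  edge_compatible : ∀ (i : Fin m) (e : X.Edge) (x y : V), e.1 = {x, y} →
    X.vertexPt x ∈ (T i).Z → X.vertexPt y ∈ (T i).Z →
    X.edgeClass K R n e ((T i).c x) = X.edgeClass K R n e ((T i).c y)
  boundary : ∀ (i : Fin m) (e : X.Edge) (x y : V), e.1 = {x, y} → X.vertexPt x ∈ (T i).Z →
    (X.vertexPt y ∈ (T i).Z ↔ j < (T i).c x (X.toQWall K (X.wall e)))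
  gluing_equations : ∀ (f : X.Edge), ∀ c ∈ colourings (X.wallGraph K R) n,
    (X.gluingSet K R n T σ.plus f c).encard = (X.gluingSet K R n T σ.minus f c).encard
  qvh : ∀ i, QVH (T i).H

end CubeComplex

end

-- Distinct vertices of a CAT(0) cube complex are separated by a wall, so `X.vertexStar x` contains
-- no vertex except `x`. Take triples that consist of a vertex star, the trivial group and one
-- colouring. Edge compatibility is then vacuous, and the boundary condition holds because no colour
-- exceeds `k + 1`. It remains to choose multiplicities that satisfy the gluing equations.
--
-- At an end `y` of `f`, a star at `x` coloured by `c` contributes the number of edges in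
-- `matchEdges`. This depends only on the restriction of `c` to a finite set of walls, and `x` may
-- run over orbit representatives, so there are finitely many unknowns. A `G`-invariant finitely
-- additive probability on colourings gives a real solution: weight the star at `x` with local
-- colouring `τ` by the probability of `τ` divided by the order of the stabiliser of `x`. By
-- invariance (`sum_m_mul_ncard_matchEdges`) and orbit counting (`sum_ncard_transporter`), the total
-- contribution at `y` times the order of the stabiliser of `f` is the probability of
-- `stabAgreeSet`, in which `y` does not occur. Hence both ends contribute equally. The equations
-- have integer coefficients, so there is a natural solution with the same support
-- (`exists_nat_solution`), and local colourings of positive probability extend to proper ones.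
--
-- The invariant probability (`nonempty_mean`) comes from independent uniform labels: colour
-- greedily in the order of the labels. Only equal labels at adjacent walls spoil properness, and
-- these become improbable as the number of labels grows; pass to an ultrafilter limit.
--
-- The geometry of walls rests on a normal form for edge paths. Edges act on reduced vertex lists up
-- to flips, compatibly with homotopy (`act_backtrack`, `act_square`), so reduced paths with common
-- ends are flip equivalent. Ladders of squares survive flips, which gives `IsCAT0.dual_unique`,
-- `IsCAT0.not_crosses` and `IsCAT0.exists_separating`. The weight of a point on one side of a wall
-- is 1-Lipschitz; this makes half-spaces closed and barycentres of distinct cubes uniformly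
-- separated, whence the finiteness statements.

universe u v

namespace CubeComplex

/-! ### Squares and cubes -/

section Squares

variable {V : Type u} (X : CubeComplex V)

/-- `x, y, w, y'` are the corners of a square, in cyclic order. -/
structure IsSquare (x y w y' : V) : Prop where
  ne : x ≠ w
  ne' : y ≠ y'
  adj₁ : X.skeleton.Adj x y
  adj₂ : X.skeleton.Adj y w
  adj₁' : X.skeleton.Adj x y'
  adj₂' : X.skeleton.Adj y' w
  mem : {x, y, w, y'} ∈ X.cubes

variable {X}

theorem IsSquare.swap {x y w y' : V} (h : X.IsSquare x y w y') : X.IsSquare x y' w y :=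
  ⟨h.ne, h.ne'.symm, h.adj₁', h.adj₂', h.adj₁, h.adj₂, by
    have := h.mem
    rwa [show ({x, y, w, y'} : Set V) = {x, y', w, y} by ext; simp; tauto] at this⟩

theorem IsSquare.rotate {x y w y' : V} (h : X.IsSquare x y w y') : X.IsSquare y w y' x :=
  ⟨h.ne', h.ne.symm, h.adj₂, h.adj₂'.symm, h.adj₁.symm, h.adj₁', by
    have := h.mem
    rwa [show ({x, y, w, y'} : Set V) = {y, w, y', x} by ext; simp; tauto] at this⟩

theorem IsSquare.reverse {x y w y' : V} (h : X.IsSquare x y w y') : X.IsSquare w y x y' :=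
  h.rotate.rotate.swap

/-- Flipping one coordinate of a corner. -/
abbrev flipAt {n : ℕ} (b : Fin n → Bool) (i : Fin n) : Fin n → Bool :=
  Function.update b i (!b i)

theorem flipAt_ne {n : ℕ} (b : Fin n → Bool) (i : Fin n) : flipAt b i ≠ b := by
  intro h
  have := congrFun h i
  simp at this

theorem flipAt_flipAt {n : ℕ} (b : Fin n → Bool) (i : Fin n) : flipAt (flipAt b i) i = b := by
  simp [flipAt]

theorem flipAt_comm {n : ℕ} (b : Fin n → Bool) (i j : Fin n) :
    flipAt (flipAt b i) j = flipAt (flipAt b j) i := by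
  rcases eq_or_ne i j with rfl | h
  · rfl
  · simp only [flipAt, Function.update_of_ne h, Function.update_of_ne h.symm]
    exact Function.update_comm h _ _ _

theorem flipAt_injective {n : ℕ} (b : Fin n → Bool) : Function.Injective (flipAt b) := by
  intro i j h
  by_contra hij
  have := congrFun h i
  simp [Function.update_of_ne hij] at this

theorem chart_pair_mem {n : ℕ} {φ : (Fin n → Bool) → V} (h : X.IsChart φ) (b : Fin n → Bool)
    (i : Fin n) : {φ b, φ (flipAt b i)} ∈ X.cubes := by
  refine (h.2.2 _ ?_).2 ⟨{i}ᶜ, b, ?_⟩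
  · rintro _ (rfl | rfl) <;> exact Set.mem_range_self _
  · rw [← Set.image_pair]
    congr 1
    ext c
    constructor
    · rintro (rfl | rfl)
      · exact fun _ _ => rfl
      · intro j hj
        exact Function.update_of_ne hj _ _
    · intro hc
      by_cases hi : c i = b i
      · left
        ext j
        by_cases hj : j = i
        · rw [hj, hi]
        · rw [hc j hj]
      · right
        ext j
        by_cases hj : j = i
        · subst hj; simpa [Bool.eq_not] using hi
        · rw [hc j hj, flipAt, Function.update_of_ne hj]

theorem chart_adj {n : ℕ} {φ : (Fin n → Bool) → V} (h : X.IsChart φ) (b : Fin n → Bool)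
    (i : Fin n) : X.skeleton.Adj (φ b) (φ (flipAt b i)) :=
  ⟨fun e => flipAt_ne b i (h.1 e).symm, chart_pair_mem h b i⟩

theorem chart_square {n : ℕ} {φ : (Fin n → Bool) → V} (h : X.IsChart φ) (b : Fin n → Bool)
    {i j : Fin n} (hij : i ≠ j) :
    X.IsSquare (φ b) (φ (flipAt b i)) (φ (flipAt (flipAt b i) j)) (φ (flipAt b j)) := by
  refine ⟨fun e => ?_, fun e => hij (flipAt_injective b (h.1 e)), chart_adj h _ _,
    chart_adj h _ _, chart_adj h _ _, ?_, ?_⟩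
  · have := congrFun (h.1 e) i
    simp [flipAt, Function.update_of_ne hij] at this
  · rw [flipAt_comm]; exact chart_adj h _ _
  · refine (h.2.2 _ ?_).2 ⟨{i, j}ᶜ, b, ?_⟩
    · rintro _ (rfl | rfl | rfl | rfl) <;> exact Set.mem_range_self _
    · rw [show ({φ b, φ (flipAt b i), φ (flipAt (flipAt b i) j), φ (flipAt b j)} : Set V) =
        φ '' {b, flipAt b i, flipAt (flipAt b i) j, flipAt b j} by simp [Set.image_insert_eq]]
      congr 1
      ext c
      constructor
      · rintro (rfl | rfl | rfl | rfl) <;> intro l hl <;>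
          simp only [Set.mem_compl_iff, Set.mem_insert_iff, Set.mem_singleton_iff, not_or] at hl <;>
          simp [flipAt, Function.update_of_ne hl.1, Function.update_of_ne hl.2]
      · intro hc
        have key : ∀ d : Fin n → Bool, d i = c i → d j = c j →
            (∀ l, l ≠ i → l ≠ j → d l = b l) → c = d := by
          intro d hi hj hl
          ext l
          by_cases h1 : l = i
          · rw [h1, hi]
          by_cases h2 : l = j
          · rw [h2, hj]
          rw [hl l h1 h2, hc l (by simp [h1, h2])]
        by_cases h1 : c i = b i <;> by_cases h2 : c j = b j
        · exact Or.inl (key _ h1.symm h2.symm fun _ _ _ => rfl)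
        · refine Or.inr (Or.inr (Or.inr (key _ ?_ ?_ ?_)))
          · rw [flipAt, Function.update_of_ne hij, h1]
          · rw [flipAt, Function.update_self]; cases hb : b j <;> cases hc' : c j <;> simp_all
          · intro l _ l2; rw [flipAt, Function.update_of_ne l2]
        · refine Or.inr (Or.inl (key _ ?_ ?_ ?_))
          · rw [flipAt, Function.update_self]; cases hb : b i <;> cases hc' : c i <;> simp_all
          · rw [flipAt, Function.update_of_ne hij.symm, h2]
          · intro l l1 _; rw [flipAt, Function.update_of_ne l1]
        · refine Or.inr (Or.inr (Or.inl (key _ ?_ ?_ ?_)))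
          · rw [flipAt, Function.update_of_ne hij, flipAt, Function.update_self]
            cases hb : b i <;> cases hc' : c i <;> simp_all
          · rw [flipAt, Function.update_self, flipAt, Function.update_of_ne hij.symm]
            cases hb : b j <;> cases hc' : c j <;> simp_all
          · intro l l1 l2
            rw [flipAt, Function.update_of_ne l2, flipAt, Function.update_of_ne l1]

/-- Corners of a cube that span an edge differ in exactly one coordinate. -/
theorem exists_flipAt_of_pair_mem {n : ℕ} {φ : (Fin n → Bool) → V} (h : X.IsChart φ)
    {b b' : Fin n → Bool} (hne : b ≠ b') (hmem : {φ b, φ b'} ∈ X.cubes) :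
    ∃ i, b' = flipAt b i := by
  obtain ⟨I, a, hI⟩ := (h.2.2 {φ b, φ b'} (by
    rintro _ (rfl | rfl) <;> exact Set.mem_range_self _)).1 hmem
  rw [← Set.image_pair, h.1.image_injective.eq_iff] at hI
  obtain ⟨i, hi⟩ := Function.ne_iff.1 hne
  have hb : ∀ j ∈ I, b j = a j := by
    have : b ∈ ({b, b'} : Set _) := Or.inl rfl
    rwa [hI] at this
  have hb' : ∀ j ∈ I, b' j = a j := by
    have : b' ∈ ({b, b'} : Set _) := Or.inr rfl
    rwa [hI] at this
  have hiI : i ∉ I := fun hi' => hi ((hb i hi').trans (hb' i hi').symm)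
  have : flipAt b i ∈ ({b, b'} : Set (Fin n → Bool)) := by
    rw [hI]
    intro j hj
    rw [flipAt, Function.update_of_ne (by rintro rfl; exact hiI hj), hb j hj]
  rcases this with h1 | h1
  · exact absurd h1 (flipAt_ne b i)
  · exact ⟨i, (Set.mem_singleton_iff.1 h1).symm⟩

theorem exists_flipAt_of_adj {n : ℕ} {φ : (Fin n → Bool) → V} (h : X.IsChart φ)
    {b : Fin n → Bool} {y : V} (hy : y ∈ Set.range φ) (ha : X.skeleton.Adj (φ b) y) :
    ∃ i, y = φ (flipAt b i) := by
  obtain ⟨b', rfl⟩ := hy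
  obtain ⟨i, rfl⟩ := exists_flipAt_of_pair_mem h (fun e => ha.1 (congrArg φ e)) ha.2
  exact ⟨i, rfl⟩

theorem exists_ncard_cube {C : Set V} (hC : C ∈ X.cubes) : ∃ n : ℕ, C.ncard = 2 ^ n := by
  obtain ⟨n, φ, h, rfl⟩ := X.exists_chart C hC
  refine ⟨n, ?_⟩
  rw [← Set.image_univ, Set.ncard_image_of_injective _ h.1, Set.ncard_univ]
  simp

/-- The fourth corner of a square is determined by the other three. -/
theorem IsSquare.unique {x y w y' y'' : V} (h : X.IsSquare x y w y')
    (h' : X.IsSquare x y w y'') : y' = y'' := by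
  by_contra hne
  have hi : ({x, y, w, y'} ∩ {x, y, w, y''} : Set V) = {x, y, w} := by
    ext z
    simp only [Set.mem_inter_iff, Set.mem_insert_iff, Set.mem_singleton_iff]
    constructor
    · rintro ⟨h1, h2⟩
      by_contra h3
      push Not at h3
      simp only [h3.1, h3.2.1, h3.2.2, false_or] at h1 h2
      exact hne (h1.symm.trans h2)
    · tauto
  -- Two different fourth corners would make `{x, y, w}` an intersection of two cubes, hence a cube;
  -- but the number of vertices of a cube is a power of two.
  have hm := X.inter_mem _ h.mem _ h'.mem ⟨x, by simp⟩
  rw [hi] at hm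
  obtain ⟨n, hn⟩ := exists_ncard_cube hm
  rw [Set.ncard_eq_three.2 ⟨x, y, w, h.adj₁.1, h.ne, h.adj₂.1, rfl⟩] at hn
  rcases n with _ | _ | n
  · simp at hn
  · simp at hn
  · rw [pow_succ] at hn; omega

/-- Three squares that pairwise share an edge at `y₁` complete to a cube. -/
theorem IsSquare.cube (hX : X.FlagLinks) {x y₀ y₁ y₂ w w' s : V} (h₀ : X.IsSquare x y₀ w y₁)
    (h₂ : X.IsSquare x y₁ w' y₂) (h₁ : X.IsSquare y₁ w s w') :
    ∃ t, X.IsSquare x y₀ t y₂ ∧ X.IsSquare y₀ w s t ∧ X.IsSquare y₂ w' s t := by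
  -- The three squares meet at `y₁` and show that its neighbours `x`, `w`, `w'` pairwise span cubes,
  -- so flagness puts all of them into one cube. Uniqueness of fourth corners then places `y₀`, `y₂`
  -- and `s` in it.
  obtain ⟨C, hC, hy, hN⟩ := hX y₁ {x, w, w'} (by simp)
    (by
      rintro y (rfl | rfl | rfl)
      · exact h₂.adj₁.symm
      · exact h₁.adj₁
      · exact h₁.adj₁')
    (by
      have m0 := h₀.mem
      have m1 := h₁.mem
      have m2 := h₂.mem
      rintro y (rfl | rfl | rfl) z (rfl | rfl | rfl) hyz
      · exact absurd rfl hyz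
      · exact ⟨_, m0, by simp, by simp, by simp⟩
      · exact ⟨_, m2, by simp, by simp, by simp⟩
      · exact ⟨_, m0, by simp, by simp, by simp⟩
      · exact absurd rfl hyz
      · exact ⟨_, m1, by simp, by simp, by simp⟩
      · exact ⟨_, m2, by simp, by simp, by simp⟩
      · exact ⟨_, m1, by simp, by simp, by simp⟩
      · exact absurd rfl hyz)
  obtain ⟨n, φ, hφ, rfl⟩ := X.exists_chart C hC
  obtain ⟨b, rfl⟩ := hy
  obtain ⟨i, rfl⟩ := exists_flipAt_of_adj hφ (hN (by simp : x ∈ _)) h₂.adj₁.symm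
  obtain ⟨j, rfl⟩ := exists_flipAt_of_adj hφ (hN (by simp : w ∈ _)) h₁.adj₁
  obtain ⟨l, rfl⟩ := exists_flipAt_of_adj hφ (hN (by simp : w' ∈ _)) h₁.adj₁'
  have hij : i ≠ j := by rintro rfl; exact h₀.ne rfl
  have hil : i ≠ l := by rintro rfl; exact h₂.ne rfl
  have hjl : j ≠ l := by rintro rfl; exact h₁.ne' rfl
  obtain rfl : y₀ = φ (flipAt (flipAt b i) j) :=
    h₀.swap.unique (chart_square hφ b hij).swap.rotate.rotate.rotate
  obtain rfl : y₂ = φ (flipAt (flipAt b i) l) :=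
    h₂.unique (chart_square hφ b hil).swap.rotate.rotate.rotate
  obtain rfl : s = φ (flipAt (flipAt b j) l) :=
    h₁.rotate.rotate.rotate.unique (chart_square hφ b hjl).rotate.rotate.rotate
  refine ⟨φ (flipAt (flipAt (flipAt b i) j) l), chart_square hφ (flipAt b i) hjl, ?_, ?_⟩
  · have := (chart_square hφ (flipAt b j) hil).swap.rotate.rotate.rotate
    rwa [flipAt_comm b j i] at this
  · have := (chart_square hφ (flipAt b l) hij).swap.rotate.rotate.rotate
    rwa [flipAt_comm b l i, flipAt_comm b l j, flipAt_comm (flipAt b i) l j] at this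

end Squares

/-! ### Flip equivalence of vertex lists and reduced lists -/

section Flips

variable {V : Type u} (X : CubeComplex V)

/-- The equivalence of vertex lists generated by pushing two consecutive edges across a square. -/
inductive Flip : List V → List V → Prop
  | refl (l : List V) : Flip l l
  | cons (x : V) {l l' : List V} : Flip l l' → Flip (x :: l) (x :: l')
  | push {x y w y' : V} (h : X.IsSquare x y w y') (r : List V) :
      Flip (x :: y :: w :: r) (x :: y' :: w :: r)
  | trans {l₁ l₂ l₃ : List V} : Flip l₁ l₂ → Flip l₂ l₃ → Flip l₁ l₃

variable {X}

theorem Flip.symm {l l' : List V} (h : X.Flip l l') : X.Flip l' l := by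
  induction h with
  | refl l => exact .refl l
  | cons x _ ih => exact .cons x ih
  | push h r => exact .push h.swap r
  | trans _ _ ih₁ ih₂ => exact .trans ih₂ ih₁

theorem Flip.length_eq {l l' : List V} (h : X.Flip l l') : l.length = l'.length := by
  induction h with
  | refl l => rfl
  | cons x _ ih => simp [ih]
  | push h r => rfl
  | trans _ _ ih₁ ih₂ => exact ih₁.trans ih₂

theorem Flip.head?_eq {l l' : List V} (h : X.Flip l l') : l.head? = l'.head? := by
  induction h with
  | refl l => rfl
  | cons x _ ih => rfl
  | push h r => rfl
  | trans _ _ ih₁ ih₂ => exact ih₁.trans ih₂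

theorem Flip.append {l l' : List V} (h : X.Flip l l') (r : List V) :
    X.Flip (l ++ r) (l' ++ r) := by
  induction h with
  | refl l => exact .refl _
  | cons x _ ih => exact .cons x ih
  | push h s => exact .push h _
  | trans _ _ ih₁ ih₂ => exact .trans ih₁ ih₂

theorem Flip.exists_cons {x : V} {l m : List V} (h : X.Flip (x :: l) m) :
    ∃ l', m = x :: l' ∧ l.length = l'.length := by
  have h1 := h.head?_eq
  have h2 := h.length_eq
  cases m with
  | nil => simp at h1
  | cons a m => exact ⟨m, by simp_all, by simpa using h2⟩

theorem Flip.eq_singleton {x : V} {l : List V} (h : X.Flip l [x]) : l = [x] := by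
  obtain ⟨l', rfl, h'⟩ := h.symm.exists_cons
  rw [List.eq_nil_of_length_eq_zero h'.symm]

/-- Flip equivalent lists start with the same edge or with two edges of a square. -/
theorem Flip.exchange (hX : X.FlagLinks) : ∀ (n : ℕ) {l l' : List V}, X.Flip l l' → l.length = n →
    ∀ (x y : V) (u : List V) (x' y' : V) (v : List V), l = x :: y :: u → l' = x' :: y' :: v →
      x = x' ∧ ((y = y' ∧ X.Flip (y :: u) (y' :: v)) ∨ ∃ w r, X.IsSquare x y w y' ∧
        X.Flip (y :: u) (y :: w :: r) ∧ X.Flip (y' :: v) (y' :: w :: r)) := by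
  intro n
  induction n with
  | zero => rintro l l' _ h x y u x' y' v rfl; simp at h
  | succ n IH =>
  intro l l' h
  induction h with
  | refl l =>
    rintro - x y u x' y' v rfl h
    simp only [List.cons.injEq] at h
    obtain ⟨rfl, rfl, rfl⟩ := h
    exact ⟨rfl, Or.inl ⟨rfl, .refl _⟩⟩
  | cons z h _ =>
    rintro - x y u x' y' v h1 h2
    simp only [List.cons.injEq] at h1 h2
    obtain ⟨rfl, rfl⟩ := h1
    obtain ⟨rfl, rfl⟩ := h2
    have := h.head?_eq
    simp only [List.head?_cons, Option.some.injEq] at this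
    exact ⟨rfl, Or.inl ⟨this, h⟩⟩
  | push h r =>
    rintro - x y u x' y' v h1 h2
    simp only [List.cons.injEq] at h1 h2
    obtain ⟨rfl, rfl, rfl⟩ := h1
    obtain ⟨rfl, rfl, rfl⟩ := h2
    exact ⟨rfl, Or.inr ⟨_, _, h, .refl _, .refl _⟩⟩
  | @trans l₁ l₂ l₃ h₁ h₂ ih₁ ih₂ =>
    rintro hl x y₀ u₀ x' y₂ u₂ rfl rfl
    obtain ⟨l', rfl, hl'⟩ := h₁.exists_cons
    obtain ⟨y₁, u₁, rfl⟩ : ∃ y₁ u₁, l' = y₁ :: u₁ := by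
      cases l' with
      | nil => simp at hl'
      | cons a m => exact ⟨_, _, rfl⟩
    obtain ⟨-, k₁⟩ := ih₁ hl _ _ _ _ _ _ rfl rfl
    obtain ⟨rfl, k₂⟩ := ih₂ (by rw [← hl]; simp [hl']) _ _ _ _ _ _ rfl rfl
    refine ⟨rfl, ?_⟩
    clear ih₁ ih₂ h₁ h₂
    rcases k₁ with ⟨rfl, h₁⟩ | ⟨w, r, s₁, h₁, h₁'⟩
    · rcases k₂ with ⟨rfl, h₂⟩ | ⟨w', r', s₂, h₂, h₂'⟩
      · exact Or.inl ⟨rfl, h₁.trans h₂⟩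
      · exact Or.inr ⟨w', r', s₂, h₁.trans h₂, h₂'⟩
    · rcases k₂ with ⟨rfl, h₂⟩ | ⟨w', r', s₂, h₂, h₂'⟩
      · exact Or.inr ⟨w, r, s₁, h₁, h₂.symm.trans h₁'⟩
      -- Both exchanges pass through `y₁`, so the induction on length applies to the lists that
      -- start with `y₁, w` and `y₁, w'`. If `w = w'`, uniqueness of squares gives `y₀ = y₂`;
      -- otherwise three squares around `y₁` complete to a cube, one of whose faces joins `y₀` to
      -- `y₂`.
      · have hlen : (y₁ :: w :: r).length = n := by
          rw [← h₁'.length_eq]; simp at hl hl' ⊢; omega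
        obtain ⟨-, ⟨rfl, h⟩ | ⟨s, q, s₃, h, h'⟩⟩ :=
          IH (h₁'.symm.trans h₂) hlen _ _ _ _ _ _ rfl rfl
        · obtain rfl : y₀ = y₂ := s₁.swap.unique s₂
          exact Or.inl ⟨rfl, h₁.trans ((Flip.cons _ h).trans h₂'.symm)⟩
        · obtain ⟨t, t₁, t₂, t₃⟩ := IsSquare.cube hX s₁ s₂ s₃
          refine Or.inr ⟨t, s :: q, t₁, ?_, ?_⟩
          · exact h₁.trans ((Flip.cons _ h).trans (.push t₂ _))
          · exact h₂'.trans ((Flip.cons _ h').trans (.push t₃ _))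

/-- Left cancellation: the other outcome of the exchange would be a square with two equal opposite
corners. -/
theorem Flip.of_cons (hX : X.FlagLinks) {x y : V} {u v : List V}
    (h : X.Flip (x :: y :: u) (x :: y :: v)) : X.Flip (y :: u) (y :: v) := by
  obtain ⟨-, ⟨-, h⟩ | ⟨w, r, s, -, -⟩⟩ := Flip.exchange hX _ h rfl _ _ _ _ _ _ rfl rfl
  · exact h
  · exact absurd rfl s.ne'

theorem Flip.exists_square (hX : X.FlagLinks) {x y y' : V} {u v : List V}
    (h : X.Flip (x :: y :: u) (x :: y' :: v)) (hne : y ≠ y') :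
    ∃ w r, X.IsSquare x y w y' ∧ X.Flip (y :: u) (y :: w :: r) ∧
      X.Flip (y' :: v) (y' :: w :: r) := by
  obtain ⟨-, ⟨h, -⟩ | h⟩ := Flip.exchange hX _ h rfl _ _ _ _ _ _ rfl rfl
  · exact absurd h hne
  · exact h

variable (X) in
/-- A list is reduced if no backtrack can be produced by flips. -/
def Reduced : List V → Prop
  | [] => True
  | [_] => True
  | x :: y :: u => Reduced (y :: u) ∧ ∀ r, ¬ X.Flip (y :: u) (y :: x :: r)

theorem Reduced.tail {x : V} {l : List V} (h : X.Reduced (x :: l)) : X.Reduced l := by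
  cases l with
  | nil => trivial
  | cons y u => exact h.1

theorem Reduced.of_append_right {l r : List V} (h : X.Reduced (l ++ r)) : X.Reduced r := by
  induction l with
  | nil => exact h
  | cons x l ih => exact ih h.tail

theorem Reduced.of_append_left {l r : List V} (h : X.Reduced (l ++ r)) : X.Reduced l := by
  induction l with
  | nil => trivial
  | cons x l ih =>
    cases l with
    | nil => trivial
    | cons y u => exact ⟨ih h.1, fun s hs => h.2 (s ++ r) (hs.append r)⟩

theorem reduced_pair (x y : V) : X.Reduced [x, y] :=
  ⟨trivial, fun _ h => by simpa using h.length_eq⟩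

theorem Reduced.flip (hX : X.FlagLinks) {l l' : List V} (h : X.Flip l l') (hl : X.Reduced l) :
    X.Reduced l' := by
  induction hn : l.length generalizing l l' with
  | zero =>
    rw [List.eq_nil_of_length_eq_zero (h.length_eq.symm.trans hn)]
    trivial
  | succ n IH =>
    match l, l', h, hl with
    | [], _, _, _ => simp at hn
    | [x], _, h, _ => rw [h.symm.eq_singleton]; trivial
    | x :: y :: u, [], h, _ => simpa using h.length_eq
    | x :: y :: u, [_], h, _ => trivial
    | x :: y :: u, x' :: y' :: v, h, hl =>
      have hn' : (y :: u).length = n := by simpa using hn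
      obtain ⟨rfl, ⟨rfl, h⟩ | ⟨w, r, s, h₁, h₂⟩⟩ :=
        Flip.exchange hX _ h rfl _ _ _ _ _ _ rfl rfl
      · exact ⟨IH h hl.1 hn', fun q hq => hl.2 q (h.trans hq)⟩
      · have h₃ : X.Reduced (y :: w :: r) := IH h₁ hl.1 hn'
        -- A return to `y'` after `w` could be pushed across the square into a return to `x` after
        -- `y`.
        have h₄ : X.Reduced (y' :: w :: r) := ⟨h₃.1, fun q hq =>
          hl.2 (y' :: q) (h₁.trans ((Flip.cons y hq).trans (.push s.rotate q)))⟩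
        refine ⟨IH h₂.symm h₄ ?_, fun q hq => ?_⟩
        · rw [← hn', h₁.length_eq]; rfl
        -- A return to `x` after `y'` produces a square at `y'` on the edges to `w` and `x`. Its
        -- fourth corner is `y`, so the list `y :: w :: r` would contain a hidden backtrack.
        · obtain ⟨t, q', s', h₅, -⟩ := (h₂.symm.trans hq).exists_square hX s.ne.symm
          obtain rfl : t = y := s'.rotate.rotate.rotate.unique s.swap
          exact h₃.2 q' h₅

/-! ### The action of edges on reduced lists and the normal form of a walk. -/

open Classical in
variable (X) in
/-- Multiplication of a list by an edge that leads from `x` to its first vertex: cancel or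
prepend. -/
noncomputable def act (x : V) (l : List V) : List V :=
  if h : ∃ q : V × List V, X.Flip l (q.1 :: x :: q.2) then x :: h.choose.2 else x :: l

/-- The remainder chosen in `act` is arbitrary, but left cancellation determines it up to flips. -/
theorem act_of_flip (hX : X.FlagLinks) {x y : V} {l r : List V} (h : X.Flip l (y :: x :: r)) :
    X.Flip (X.act x l) (x :: r) := by
  have h' : ∃ q : V × List V, X.Flip l (q.1 :: x :: q.2) := ⟨(y, r), h⟩
  rw [act, dif_pos h']
  have h2 := h'.choose_spec.symm.trans h
  have := h2.head?_eq
  simp only [List.head?_cons, Option.some.injEq] at this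
  rw [this] at h2
  exact h2.of_cons hX

theorem act_of_not {x y : V} {u : List V} (h : ∀ r, ¬ X.Flip (y :: u) (y :: x :: r)) :
    X.act x (y :: u) = x :: y :: u := by
  rw [act, dif_neg]
  rintro ⟨⟨z, r⟩, hr⟩
  have := hr.head?_eq
  simp only [List.head?_cons, Option.some.injEq] at this
  subst this
  exact h r hr

theorem Flip.act (hX : X.FlagLinks) (x : V) {l l' : List V} (h : X.Flip l l') :
    X.Flip (X.act x l) (X.act x l') := by
  by_cases h' : ∃ q : V × List V, X.Flip l (q.1 :: x :: q.2)
  · obtain ⟨q, hq⟩ := h'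
    exact (act_of_flip hX hq).trans (act_of_flip hX (h.symm.trans hq)).symm
  · have h'' : ¬ ∃ q : V × List V, X.Flip l' (q.1 :: x :: q.2) :=
      fun ⟨q, hq⟩ => h' ⟨q, h.trans hq⟩
    rw [CubeComplex.act, dif_neg h', CubeComplex.act, dif_neg h'']
    exact .cons x h

theorem Reduced.act (hX : X.FlagLinks) (x : V) {y : V} {u : List V} (h : X.Reduced (y :: u)) :
    X.Reduced (X.act x (y :: u)) := by
  by_cases h' : ∃ r, X.Flip (y :: u) (y :: x :: r)
  · obtain ⟨r, hr⟩ := h'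
    exact Reduced.flip hX (act_of_flip hX hr).symm (Reduced.flip hX hr h).tail
  · push Not at h'
    rw [act_of_not h']
    exact ⟨h, h'⟩

theorem act_eq_cons (x : V) (l : List V) : ∃ u, X.act x l = x :: u := by
  rw [act]
  split_ifs
  · exact ⟨_, rfl⟩
  · exact ⟨_, rfl⟩

/-- If the first step cancels, reducedness prevents the second from cancelling as well, so it
restores the removed edge; if the first step prepends, the second removes what was added. -/
theorem act_backtrack (hX : X.FlagLinks) {x : V} (y : V) {u : List V} (h : X.Reduced (x :: u)) :
    X.Flip (X.act x (X.act y (x :: u))) (x :: u) := by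
  by_cases h' : ∃ r, X.Flip (x :: u) (x :: y :: r)
  · obtain ⟨r, hr⟩ := h'
    refine ((act_of_flip hX hr).act hX x).trans ?_
    rw [act_of_not (Reduced.flip hX hr h).2]
    exact hr.symm
  · push Not at h'
    rw [act_of_not h']
    exact act_of_flip hX (.refl _)

/-- The mixed case: one way round cancels and then prepends, the other prepends and then, after a
push across the square, cancels. -/
theorem act_square_of_cancel (hX : X.FlagLinks) {x y z y' : V} {u r : List V}
    (s : X.IsSquare x y z y') (h₁ : X.Flip (z :: u) (z :: y :: r))
    (h₂ : ∀ r, ¬ X.Flip (z :: u) (z :: y' :: r)) :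
    X.Flip (X.act x (X.act y (z :: u))) (X.act x (X.act y' (z :: u))) := by
  have h₃ : ∀ q, ¬ X.Flip (y :: r) (y :: x :: q) := fun q hq =>
    h₂ (x :: q) (h₁.trans ((Flip.cons z hq).trans (.push s.reverse q)))
  refine ((act_of_flip hX h₁).act hX x).trans ?_
  rw [act_of_not h₃, act_of_not h₂]
  exact (act_of_flip hX ((Flip.cons y' h₁).trans (.push s.swap.rotate r))).symm

/-- If both first steps cancel, the exchange at `z` yields this same square and both ways cancel
twice. If neither does, no second step cancels and the results differ by one push. -/
theorem act_square (hX : X.FlagLinks) {x y z y' : V} {u : List V} (s : X.IsSquare x y z y') :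
    X.Flip (X.act x (X.act y (z :: u))) (X.act x (X.act y' (z :: u))) := by
  by_cases h₁ : ∃ r, X.Flip (z :: u) (z :: y :: r) <;>
    by_cases h₂ : ∃ r, X.Flip (z :: u) (z :: y' :: r)
  · obtain ⟨r, h₁⟩ := h₁
    obtain ⟨r', h₂⟩ := h₂
    obtain ⟨w, q, s', h₃, h₄⟩ := (h₁.symm.trans h₂).exists_square hX s.ne'
    obtain rfl : w = x :=
      s'.rotate.rotate.rotate.unique s.reverse.rotate.rotate.rotate
    refine ((act_of_flip hX h₁).act hX w).trans ((act_of_flip hX h₃).trans ?_)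
    exact (((act_of_flip hX h₂).act hX w).trans (act_of_flip hX h₄)).symm
  · push Not at h₂
    obtain ⟨r, h₁⟩ := h₁
    exact act_square_of_cancel hX s h₁ h₂
  · push Not at h₁
    obtain ⟨r, h₂⟩ := h₂
    exact (act_square_of_cancel hX s.swap h₂ h₁).symm
  · push Not at h₁ h₂
    have key : ∀ {y y' : V}, X.IsSquare x y z y' → (∀ r, ¬ X.Flip (z :: u) (z :: y' :: r)) →
        ∀ r, ¬ X.Flip (y :: z :: u) (y :: x :: r) := by
      intro y y' s h r hr
      obtain ⟨t, q, s', h₃, -⟩ := hr.exists_square hX s.ne.symm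
      obtain rfl : t = y' := s'.rotate.rotate.rotate.unique s
      exact h q h₃
    rw [act_of_not h₁, act_of_not h₂, act_of_not (key s h₂), act_of_not (key s.swap h₁)]
    exact .push s u

/-- The reduced form of a walk. -/
noncomputable def reducedForm {z : V} : ∀ {x : V}, X.skeleton.Walk x z → List V
  | _, .nil => [z]
  | x, .cons _ p => X.act x (reducedForm p)

theorem reducedForm_eq_cons {x z : V} (p : X.skeleton.Walk x z) :
    ∃ u, reducedForm p = x :: u := by
  cases p with
  | nil => exact ⟨[], rfl⟩
  | cons h p => exact act_eq_cons _ _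

theorem reduced_reducedForm (hX : X.FlagLinks) {x z : V} (p : X.skeleton.Walk x z) :
    X.Reduced (reducedForm p) := by
  induction p with
  | nil => trivial
  | cons h p ih =>
    obtain ⟨u, hu⟩ := reducedForm_eq_cons p
    rw [reducedForm, hu]
    rw [hu] at ih
    exact ih.act hX _

/-- `act` respects the generating moves of homotopy, so the reduced form is a homotopy invariant. -/
theorem PathHomotopic.flip (hX : X.FlagLinks) {x z : V} {p q : X.skeleton.Walk x z}
    (h : X.PathHomotopic p q) : X.Flip (reducedForm p) (reducedForm q) := by
  induction h with
  | refl p => exact .refl _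
  | symm _ ih => exact ih.symm
  | trans _ _ ih₁ ih₂ => exact ih₁.trans ih₂
  | cons h _ ih => exact ih.act hX _
  | backtrack h p =>
    obtain ⟨u, hu⟩ := reducedForm_eq_cons p
    have := reduced_reducedForm hX p
    simp only [reducedForm]
    rw [hu] at this ⊢
    exact act_backtrack hX _ this
  | square h₁ h₂ h₁' h₂' hxz hyy hS p =>
    obtain ⟨u, hu⟩ := reducedForm_eq_cons p
    simp only [reducedForm]
    rw [hu]
    exact act_square hX ⟨hxz, hyy, h₁, h₂, h₁', h₂', hS⟩

theorem PathHomotopic.append {x y z : V} {p p' : X.skeleton.Walk x y}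
    (h : X.PathHomotopic p p') (q : X.skeleton.Walk y z) :
    X.PathHomotopic (p.append q) (p'.append q) := by
  induction h with
  | refl p => exact .refl _
  | symm _ ih => exact .symm (ih q)
  | trans _ _ ih₁ ih₂ => exact .trans (ih₁ q) (ih₂ q)
  | cons h _ ih => exact .cons h (ih q)
  | backtrack h p => exact .backtrack h _
  | square h₁ h₂ h₁' h₂' hxz hyy hS p => exact .square h₁ h₂ h₁' h₂' hxz hyy hS _

theorem PathHomotopic.append_left {x y z : V} (p : X.skeleton.Walk x y)
    {q q' : X.skeleton.Walk y z} (h : X.PathHomotopic q q') :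
    X.PathHomotopic (p.append q) (p.append q') := by
  induction p with
  | nil => exact h
  | cons h' _ ih => exact .cons h' (ih h)

/-- In a simply connected complex any two walks with the same ends are homotopic. -/
theorem IsCAT0.homotopic (hX : X.IsCAT0) {x y : V} (p q : X.skeleton.Walk x y) :
    X.PathHomotopic p q := by
  have h1 := (hX.null_homotopic x (p.append q.reverse)).append q
  have h2 := PathHomotopic.append_left p (hX.null_homotopic y (q.reverse.append q))
  rw [SimpleGraph.Walk.append_nil, SimpleGraph.Walk.append_assoc] at h2
  exact h2.symm.trans h1

theorem reducedForm_eq_support {x z : V} {p : X.skeleton.Walk x z} (h : X.Reduced p.support) :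
    reducedForm p = p.support := by
  induction p with
  | nil => rfl
  | @cons x y z h' p ih =>
    rw [SimpleGraph.Walk.support_cons] at h
    rw [reducedForm, ih h.tail, SimpleGraph.Walk.support_cons]
    rw [← SimpleGraph.Walk.cons_tail_support] at h ⊢
    exact act_of_not h.2

/-- Simple connectedness enters here: every walk reduces, up to flips, to any given reduced walk
with the same ends. -/
theorem IsCAT0.flip_reducedForm (hX : X.IsCAT0) {x z : V} {p q : X.skeleton.Walk x z}
    (hq : X.Reduced q.support) : X.Flip (reducedForm p) q.support := by
  rw [← reducedForm_eq_support hq]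
  exact PathHomotopic.flip hX.flag (hX.homotopic p q)

end Flips

/-! ### Walls: ladders, carriers and separation -/

section Walls

variable {V : Type u} {X : CubeComplex V}

theorem exists_walk_of_isChain : ∀ {x z : V} {l : List V}, (x :: l).IsChain X.skeleton.Adj →
    (x :: l).getLast? = some z → ∃ p : X.skeleton.Walk x z, p.support = x :: l
  | x, z, [], _, hz => by
    obtain rfl : x = z := by simpa using hz
    exact ⟨.nil, rfl⟩
  | x, z, y :: l, h, hz => by
    obtain ⟨p, hp⟩ := exists_walk_of_isChain (x := y) (z := z) (l := l) h.of_cons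
      (by simpa using hz)
    exact ⟨.cons h.rel p, by rw [SimpleGraph.Walk.support_cons, hp]⟩

theorem Flip.isChain {l l' : List V} (h : X.Flip l l') (hl : l.IsChain X.skeleton.Adj) :
    l'.IsChain X.skeleton.Adj := by
  induction h with
  | refl l => exact hl
  | cons x h ih =>
    rw [List.isChain_cons] at hl ⊢
    rw [← h.head?_eq]
    exact ⟨hl.1, ih hl.2⟩
  | push s r =>
    simp only [List.isChain_cons_cons] at hl ⊢
    exact ⟨s.adj₁', s.adj₂', hl.2.2⟩
  | trans _ _ ih₁ ih₂ => exact ih₂ (ih₁ hl)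

theorem Flip.getLast?_eq {l l' : List V} (h : X.Flip l l') : l.getLast? = l'.getLast? := by
  induction h with
  | refl l => rfl
  | cons x _ ih => simp [List.getLast?_cons, ih]
  | push s r => simp [List.getLast?_cons]
  | trans _ _ ih₁ ih₂ => exact ih₁.trans ih₂

theorem exists_walk_reducedForm (hX : X.FlagLinks) {x z : V} (p : X.skeleton.Walk x z) :
    ∃ q : X.skeleton.Walk x z, q.support = reducedForm p := by
  suffices h : (reducedForm p).IsChain X.skeleton.Adj ∧ (reducedForm p).getLast? = some z by
    obtain ⟨u, hu⟩ := reducedForm_eq_cons p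
    rw [hu] at h ⊢
    exact exists_walk_of_isChain h.1 h.2
  induction p with
  | nil => exact ⟨.singleton _, rfl⟩
  | @cons x y z h p ih =>
    obtain ⟨u, hu⟩ := reducedForm_eq_cons p
    rw [reducedForm]
    rw [hu] at ih ⊢
    by_cases h' : ∃ r, X.Flip (y :: u) (y :: x :: r)
    · obtain ⟨r, hr⟩ := h'
      have h1 := hr.isChain ih.1
      have h2 := hr.getLast?_eq.symm.trans ih.2
      have h3 := (act_of_flip hX hr).symm
      exact ⟨h3.isChain h1.of_cons, h3.getLast?_eq.symm.trans (by simpa using h2)⟩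
    · push Not at h'
      rw [act_of_not h']
      exact ⟨List.isChain_cons_cons.2 ⟨h, ih.1⟩, by simpa using ih.2⟩

theorem IsCAT0.exists_reduced_walk (hX : X.IsCAT0) (x z : V) :
    ∃ p : X.skeleton.Walk x z, X.Reduced p.support := by
  obtain ⟨p⟩ := hX.connected.preconnected x z
  obtain ⟨q, hq⟩ := exists_walk_reducedForm hX.flag p
  exact ⟨q, hq ▸ reduced_reducedForm hX.flag p⟩

variable (X) in
/-- `X.Ladder a l b`: a strip of squares along `l` carries the edge from the first vertex of `l`
to `a` to the edge from the last vertex of `l` to `b`. -/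
inductive Ladder : V → List V → V → Prop
  | single {x a : V} : Ladder a [x] a
  | cons {x y a a' b : V} {l : List V} : X.IsSquare x a a' y → Ladder a' (y :: l) b →
      Ladder a (x :: y :: l) b

/-- For a push, the two ladder squares and the square pushed across meet pairwise in edges at `y`;
the opposite faces of the cube they span form the new ladder. -/
theorem Ladder.flip (hX : X.FlagLinks) {l l' : List V} (h : X.Flip l l') :
    ∀ {a b : V}, X.Ladder a l b → X.Ladder a l' b := by
  induction h with
  | refl l => exact id
  | @cons x l l' h ih =>
    intro a b hl
    cases hl with
    | single =>
      rw [List.eq_nil_of_length_eq_zero h.length_eq.symm]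
      exact .single
    | cons s hl =>
      obtain ⟨m, rfl, -⟩ := h.exists_cons
      exact .cons s (ih hl)
  | @push x y w y' s r =>
    intro a b hl
    cases hl with
    | @cons _ _ _ a₁ _ _ s₁ hl =>
      cases hl with
      | @cons _ _ _ a₂ _ _ s₂ hl =>
        obtain ⟨t, t₁, -, t₃⟩ := IsSquare.cube hX (x := x) (y₀ := a) (w := a₁) (y₁ := y) (w' := w)
          (y₂ := y') (s := a₂) s₁ s s₂
        exact .cons t₁ (.cons t₃.swap hl)
  | trans _ _ ih₁ ih₂ => exact fun hl => ih₂ (ih₁ hl)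

/-- When a step cancels, the ladder goes across an edge and back; the two squares coincide by
uniqueness of the fourth corner and can be dropped. -/
theorem Ladder.reducedForm (hX : X.FlagLinks) {x z : V} {p : X.skeleton.Walk x z} {a b : V}
    (h : X.Ladder a p.support b) : X.Ladder a (reducedForm p) b := by
  induction p generalizing a with
  | nil => exact h
  | @cons x y z h' p ih =>
    rw [SimpleGraph.Walk.support_cons, ← SimpleGraph.Walk.cons_tail_support] at h
    rw [CubeComplex.reducedForm]
    cases h with
    | @cons _ _ _ a' _ _ s h =>
      rw [SimpleGraph.Walk.cons_tail_support] at h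
      have := ih h
      obtain ⟨u, hu⟩ := reducedForm_eq_cons p
      rw [hu] at this ⊢
      by_cases h' : ∃ r, X.Flip (y :: u) (y :: x :: r)
      · obtain ⟨r, hr⟩ := h'
        refine Ladder.flip hX (act_of_flip hX hr).symm ?_
        have h2 := this.flip hX hr
        cases h2 with
        | cons s' h2 =>
          rwa [s.rotate.rotate.unique s'.reverse.rotate]
      · push Not at h'
        rw [act_of_not h']
        exact .cons s this

theorem IsCAT0.ladder_of_reduced (hX : X.IsCAT0) {x z : V} {p q : X.skeleton.Walk x z} {a b : V}
    (h : X.Ladder a p.support b) (hq : X.Reduced q.support) : X.Ladder a q.support b :=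
  (h.reducedForm hX.flag).flip hX.flag (hX.flip_reducedForm hq)

variable (X) in
/-- The edge joining two adjacent vertices. -/
def mkEdge {x y : V} (h : X.skeleton.Adj x y) : X.Edge := ⟨{x, y}, h.2, Set.ncard_pair h.1⟩

theorem Edge.adj {e : X.Edge} {x y : V} (h : e.1 = {x, y}) : X.skeleton.Adj x y := by
  have h2 := e.2.2
  refine ⟨?_, h ▸ e.2.1⟩
  rintro rfl
  rw [h] at h2
  simp at h2

theorem Edge.exists_eq (e : X.Edge) : ∃ x y, e.1 = {x, y} := by
  obtain ⟨x, y, -, h⟩ := Set.ncard_eq_two.1 e.2.2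
  exact ⟨x, y, h⟩

variable (X) in
/-- `x` and `y` are joined by an edge dual to `W`. -/
def Dual (W : X.Wall) (x y : V) : Prop := ∃ e : X.Edge, e.1 = {x, y} ∧ X.wall e = W

theorem Dual.symm {W : X.Wall} {x y : V} (h : X.Dual W x y) : X.Dual W y x := by
  obtain ⟨e, he, h⟩ := h
  exact ⟨e, he.trans (Set.pair_comm _ _), h⟩

theorem Dual.adj {W : X.Wall} {x y : V} (h : X.Dual W x y) : X.skeleton.Adj x y :=
  Edge.adj h.choose_spec.1

theorem dual_wall_mkEdge {x y : V} (h : X.skeleton.Adj x y) : X.Dual (X.wall (X.mkEdge h)) x y :=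
  ⟨_, rfl, rfl⟩

theorem IsSquare.opposite {x y w y' : V} (s : X.IsSquare x y w y') {e e' : X.Edge}
    (he : e.1 = {x, y}) (he' : e'.1 = {y', w}) : X.Opposite e e' := by
  refine ⟨_, s.mem, ?_, ?_, ?_, ?_⟩
  · rw [Set.ncard_insert_of_notMem (by simp [s.adj₁.1, s.ne, s.adj₁'.1]),
      Set.ncard_insert_of_notMem (by simp [s.adj₂.1, s.ne']), Set.ncard_pair s.adj₂'.1.symm]
  · rw [he]; rintro _ (rfl | rfl) <;> simp
  · rw [he']; rintro _ (rfl | rfl) <;> simp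
  · rw [he, he', Set.disjoint_left]
    rintro _ (rfl | rfl) (h | h)
    · exact s.adj₁'.1 h
    · exact s.ne h
    · exact s.ne' h
    · exact s.adj₂.1 h

theorem IsSquare.dual {x y w y' : V} (s : X.IsSquare x y w y') {W : X.Wall} (h : X.Dual W x y) :
    X.Dual W y' w := by
  obtain ⟨e, he, rfl⟩ := h
  refine ⟨X.mkEdge s.adj₂', rfl, ?_⟩
  exact (Quotient.sound (Relation.EqvGen.rel _ _ (s.opposite he rfl))).symm

theorem Opposite.exists_square {e e' : X.Edge} (h : X.Opposite e e') {x a : V}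
    (he : e.1 = {x, a}) : ∃ y b, e'.1 = {y, b} ∧ X.IsSquare x a b y := by
  obtain ⟨S, hS, h4, h1, h2, hd⟩ := h
  obtain ⟨n, φ, hφ, rfl⟩ := X.exists_chart S hS
  have hn : n = 2 := by
    rw [← Set.image_univ, Set.ncard_image_of_injective _ hφ.1, Set.ncard_univ] at h4
    simp only [Nat.card_eq_fintype_card, Fintype.card_pi, Fintype.card_bool, Finset.prod_const,
      Finset.card_univ, Fintype.card_fin] at h4
    exact Nat.pow_right_injective le_rfl (h4.trans (by norm_num : 4 = 2 ^ 2))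
  subst hn
  obtain ⟨b, rfl⟩ : x ∈ Set.range φ := h1 (by rw [he]; simp)
  obtain ⟨i, rfl⟩ := exists_flipAt_of_adj hφ (h1 (by rw [he]; simp) : a ∈ _) (Edge.adj he)
  obtain ⟨j, hj⟩ := exists_ne i
  have s := chart_square hφ b hj.symm
  refine ⟨_, _, ?_, s⟩
  have hfin : (Set.range φ).Finite := Set.finite_range φ
  have hcard : ({φ b, φ (flipAt b i), φ (flipAt (flipAt b i) j), φ (flipAt b j)} : Set V).ncard
      = 4 := by
    rw [Set.ncard_insert_of_notMem (by
        simp only [Set.mem_insert_iff, Set.mem_singleton_iff, s.adj₁.1, s.ne, s.adj₁'.1, or_self,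
          not_false_eq_true]),
      Set.ncard_insert_of_notMem (by
        simp only [Set.mem_insert_iff, Set.mem_singleton_iff, s.adj₂.1, s.ne', or_self,
          not_false_eq_true]), Set.ncard_pair s.adj₂'.1.symm]
  have hr : ({φ b, φ (flipAt b i), φ (flipAt (flipAt b i) j), φ (flipAt b j)} : Set V) =
      Set.range φ := by
    refine Set.eq_of_subset_of_ncard_le ?_ (by rw [hcard, h4]) hfin
    rintro _ (rfl | rfl | rfl | rfl) <;> exact Set.mem_range_self _
  refine Set.eq_of_subset_of_ncard_le ?_ ?_ (Set.toFinite _)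
  · intro z hz
    have hz' := h2 hz
    rw [← hr] at hz'
    have hz2 : z ∉ e.1 := fun h => Set.disjoint_left.1 hd h hz
    rw [he] at hz2
    simp only [Set.mem_insert_iff, Set.mem_singleton_iff] at hz' hz2 ⊢
    tauto
  · rw [e'.2.2, Set.ncard_pair s.adj₂'.1]

/-- Edges dual to one wall are linked by a chain of opposite edges, and the squares in between are
the ladder. The orientation of `f` at the far end is not under control, so later arguments treat
both. -/
theorem exists_ladder {e f : X.Edge} (h : X.wall e = X.wall f) {x a : V} (he : e.1 = {x, a}) :
    ∃ (y b : V) (p : X.skeleton.Walk x y), f.1 = {y, b} ∧ X.Ladder a p.support b := by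
  have : Std.Symm X.Opposite := ⟨fun e e' ⟨S, h1, h2, h3, h4, h5⟩ => ⟨S, h1, h2, h4, h3, h5.symm⟩⟩
  have h' : Relation.EqvGen X.Opposite e f := Quotient.exact h
  rw [Relation.EqvGen.eqvGen_eq_reflTransGen] at h'
  clear h
  induction h' using Relation.ReflTransGen.head_induction_on generalizing x a with
  | refl => exact ⟨x, a, .nil, he, .single⟩
  | head h _ ih =>
    obtain ⟨y, b, he', s⟩ := h.exists_square he
    obtain ⟨z, c, p, hf, hp⟩ := ih he'
    refine ⟨z, c, .cons s.adj₁' p, hf, ?_⟩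
    rw [SimpleGraph.Walk.support_cons, ← SimpleGraph.Walk.cons_tail_support]
    rw [← SimpleGraph.Walk.cons_tail_support] at hp
    exact .cons s hp

/-- Two edges at a vertex that are dual to the same wall coincide. -/
theorem IsCAT0.dual_unique (hX : X.IsCAT0) {W : X.Wall} {v a b : V} (ha : X.Dual W v a)
    (hb : X.Dual W v b) : a = b := by
  obtain ⟨e, he, rfl⟩ := ha
  obtain ⟨f, hf, hW⟩ := hb
  obtain ⟨y, c, p, hf', hp⟩ := exists_ladder hW.symm he
  -- Transport the ladder to a reduced path: the constant one at `v`, where it is trivial and `a =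
  -- b`, or the edge from `v` to `b`, where its only square would have equal opposite corners.
  rcases Set.pair_eq_pair_iff.1 (hf.symm.trans hf') with ⟨rfl, rfl⟩ | ⟨rfl, rfl⟩
  · have := hX.ladder_of_reduced (q := .nil) hp trivial
    cases this
    rfl
  · have := hX.ladder_of_reduced (q := .cons (Edge.adj hf) .nil) hp (reduced_pair _ _)
    cases this with
    | cons s h =>
      cases h
      exact absurd rfl s.ne

variable (X) in
/-- Some edge of the list is dual to `W`. -/
def Crosses (W : X.Wall) : List V → Prop
  | x :: y :: l => X.Dual W x y ∨ Crosses W (y :: l)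
  | _ => False

theorem Crosses.cons {W : X.Wall} {l : List V} (h : X.Crosses W l) (x : V) :
    X.Crosses W (x :: l) := by
  cases l with
  | nil => exact h
  | cons y l => exact Or.inr h

theorem Crosses.exists_split {W : X.Wall} {l : List V} (h : X.Crosses W l) :
    ∃ (l₁ : List V) (c d : V) (r : List V), l = l₁ ++ c :: d :: r ∧ X.Dual W c d := by
  induction l with
  | nil => exact h.elim
  | cons x l ih =>
    cases l with
    | nil => exact h.elim
    | cons y l =>
      rcases h with h | h
      · exact ⟨[], x, y, l, rfl, h⟩
      · obtain ⟨l₁, c, d, r, h1, h2⟩ := ih h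
        exact ⟨x :: l₁, c, d, r, by rw [h1]; rfl, h2⟩

theorem Crosses.flip {W : X.Wall} {l l' : List V} (h : X.Flip l l') (hl : X.Crosses W l) :
    X.Crosses W l' := by
  induction h with
  | refl l => exact hl
  | @cons x l l' h ih =>
    cases l with
    | nil => exact hl.elim
    | cons y l =>
      obtain ⟨m, rfl, -⟩ := h.exists_cons
      exact hl.imp_right ih
  | push s r =>
    rcases hl with h | h | h
    · exact Or.inr (Or.inl (s.dual h))
    · exact Or.inl (s.rotate.dual h)
    · exact Or.inr (Or.inr h)
  | trans _ _ ih₁ ih₂ => exact ih₂ (ih₁ hl)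

/-- Reduction consists of flips, which preserve the walls crossed, and cancellations, which only
lose crossings. -/
theorem Crosses.of_reducedForm (hX : X.FlagLinks) {W : X.Wall} {x z : V} {p : X.skeleton.Walk x z}
    (h : X.Crosses W (reducedForm p)) : X.Crosses W p.support := by
  induction p with
  | nil => exact h.elim
  | @cons x y z h' p ih =>
    rw [SimpleGraph.Walk.support_cons]
    rw [reducedForm] at h
    obtain ⟨u, hu⟩ := reducedForm_eq_cons p
    rw [hu] at h ih
    by_cases h' : ∃ r, X.Flip (y :: u) (y :: x :: r)
    · obtain ⟨r, hr⟩ := h'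
      exact (ih (((h.flip (act_of_flip hX hr)).cons y).flip hr.symm)).cons x
    · push Not at h'
      rw [act_of_not h'] at h
      rcases h with h | h
      · rw [← SimpleGraph.Walk.cons_tail_support]
        exact Or.inl h
      · exact (ih h).cons x

/-- Each square of the ladder pushes the initial rung one step further along the list. -/
theorem Ladder.slide {a b : V} {l : List V} (h : X.Ladder a l b) :
    ∃ (m l₀ : List V) (c : V), l = l₀ ++ [c] ∧ X.Flip (a :: l) (m ++ [b, c]) := by
  induction h with
  | single => exact ⟨[], [], _, rfl, .refl _⟩
  | @cons x y a a' b l s h ih =>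
    obtain ⟨m, l₀, c, h1, h2⟩ := ih
    exact ⟨a :: m, x :: l₀, c, by rw [h1]; rfl,
      (Flip.push s.rotate.swap l).trans (.cons a h2)⟩

theorem Ladder.last_ne {a b c d : V} {l : List V} (h : X.Ladder a (l ++ [c, d]) b) : b ≠ c := by
  induction l generalizing a with
  | nil =>
    cases h with
    | cons s h => cases h; exact s.ne.symm
  | cons x l ih =>
    cases l with
    | nil => cases h with | cons _ h => exact ih h
    | cons y l => cases h with | cons _ h => exact ih h

/-- A reduced path does not cross again the wall dual to its first edge. -/
theorem IsCAT0.not_crosses (hX : X.IsCAT0) {W : X.Wall} {x y : V} {u : List V}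
    (hr : X.Reduced (x :: y :: u)) (hc : (x :: y :: u).IsChain X.skeleton.Adj)
    (hW : X.Dual W x y) : ¬ X.Crosses W (y :: u) := by
  intro h
  obtain ⟨l, c, d, r, h1, h2⟩ := h.exists_split
  obtain ⟨e, he, rfl⟩ := hW.symm
  obtain ⟨f, hf, hfW⟩ := h2
  have hwalk : ∀ (l₁ l₂ : List V) (c : V), y :: u = (l₁ ++ [c]) ++ l₂ →
      ∃ q : X.skeleton.Walk y c, q.support = l₁ ++ [c] := by
    intro l₁ l₂ c h
    have hch := hc.of_cons
    rw [h] at hch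
    obtain ⟨m, hm⟩ : ∃ m, l₁ ++ [c] = y :: m := by
      cases l₁ with
      | nil =>
        simp only [List.nil_append, List.cons_append, List.cons.injEq] at h
        exact ⟨[], by rw [h.1]; rfl⟩
      | cons z l₁ =>
        simp only [List.cons_append, List.cons.injEq] at h
        exact ⟨_, by rw [h.1]; rfl⟩
    have h3 := hch.left_of_append
    rw [hm] at h3
    rw [hm]
    exact exists_walk_of_isChain h3 (by rw [← hm]; simp)
  obtain ⟨z, b, p, hf', hp⟩ := exists_ladder hfW.symm he
  -- If the ladder ends at `c` with rung to `d`, sliding the edge from `x` to `y` along it creates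
  -- the backtrack `d, c, d`. If it ends at `d` with rung to `c`, its last square has `c` at two
  -- opposite corners.
  rcases Set.pair_eq_pair_iff.1 (hf.symm.trans hf') with ⟨rfl, rfl⟩ | ⟨rfl, rfl⟩
  · obtain ⟨q, hq⟩ := hwalk l (d :: r) c (by rw [h1]; simp)
    have hred : X.Reduced q.support := by
      have := hr.tail
      rw [h1, show l ++ c :: d :: r = (l ++ [c]) ++ d :: r by simp, ← hq] at this
      exact this.of_append_left
    have hL := hX.ladder_of_reduced hp hred
    obtain ⟨m, l₀, c', h3, h4⟩ := hL.slide
    rw [hq] at h3 h4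
    obtain ⟨rfl, h5⟩ := List.append_inj' h3 rfl
    obtain rfl : c = c' := by simpa using h5
    have h6 := h4.append (d :: r)
    rw [h1, show x :: (l ++ c :: d :: r) = x :: (l ++ [c]) ++ d :: r by simp] at hr
    have h7 := Reduced.flip hX.flag h6 hr
    rw [List.append_assoc] at h7
    exact h7.of_append_right.2 r (.refl _)
  · obtain ⟨q, hq⟩ := hwalk (l ++ [c]) r d (by rw [h1]; simp)
    have hred : X.Reduced q.support := by
      have := hr.tail
      rw [h1, show l ++ c :: d :: r = ((l ++ [c]) ++ [d]) ++ r by simp, ← hq] at this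
      exact this.of_append_left
    have hL := hX.ladder_of_reduced hp hred
    rw [hq, List.append_assoc] at hL
    exact hL.last_ne rfl

end Walls

/-! ### Sides of walls -/

section Sides

variable {V : Type u} {X : CubeComplex V}

theorem mem_sideOf_self (W : X.Wall) (x : V) : x ∈ X.sideOf W x := Relation.ReflTransGen.refl

theorem mem_sideOf_trans {W : X.Wall} {x y z : V} (h : y ∈ X.sideOf W x) (h' : z ∈ X.sideOf W y) :
    z ∈ X.sideOf W x :=
  Relation.ReflTransGen.trans h h'

theorem mem_sideOf_symm {W : X.Wall} {x y : V} (h : y ∈ X.sideOf W x) : x ∈ X.sideOf W y := by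
  induction h with
  | refl => exact mem_sideOf_self W x
  | tail _ h ih =>
    obtain ⟨e, he, hW⟩ := h
    exact Relation.ReflTransGen.head ⟨e, he.trans (Set.pair_comm _ _), hW⟩ ih

theorem mem_sideOf_of_adj {W : X.Wall} {x y : V} (h : X.skeleton.Adj x y) (hW : ¬ X.Dual W x y) :
    y ∈ X.sideOf W x :=
  Relation.ReflTransGen.single ⟨X.mkEdge h, rfl, fun h' => hW ⟨_, rfl, h'⟩⟩

theorem exists_walk_of_mem_sideOf {W : X.Wall} {x y : V} (h : y ∈ X.sideOf W x) :
    ∃ p : X.skeleton.Walk x y, ¬ X.Crosses W p.support := by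
  induction h using Relation.ReflTransGen.head_induction_on with
  | refl => exact ⟨.nil, id⟩
  | head h _ ih =>
    obtain ⟨e, he, hW⟩ := h
    obtain ⟨p, hp⟩ := ih
    refine ⟨.cons (Edge.adj he) p, ?_⟩
    rw [SimpleGraph.Walk.support_cons]
    rw [← SimpleGraph.Walk.cons_tail_support] at hp ⊢
    rintro (h | h)
    · obtain ⟨e', he', hW'⟩ := h
      obtain rfl : e = e' := Subtype.ext (he.trans he'.symm)
      exact hW hW'
    · exact hp h

theorem mem_sideOf_of_walk {W : X.Wall} {x y : V} (p : X.skeleton.Walk x y)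
    (hp : ¬ X.Crosses W p.support) : y ∈ X.sideOf W x := by
  induction p with
  | nil => exact mem_sideOf_self W _
  | cons h p ih =>
    rw [SimpleGraph.Walk.support_cons] at hp
    rw [← SimpleGraph.Walk.cons_tail_support] at hp ih
    exact mem_sideOf_trans (mem_sideOf_of_adj h fun h => hp (Or.inl h))
      (ih fun h => hp (Or.inr h))

/-- The endpoints of an edge are separated by the wall dual to it. -/
theorem IsCAT0.notMem_sideOf (hX : X.IsCAT0) {W : X.Wall} {x y : V} (h : X.Dual W x y) :
    y ∉ X.sideOf W x := by
  intro hy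
  obtain ⟨p, hp⟩ := exists_walk_of_mem_sideOf hy
  -- The edge itself is a reduced path that crosses `W`, so every walk between its ends crosses `W`.
  refine hp (Crosses.of_reducedForm hX.flag (Crosses.flip
    (hX.flip_reducedForm (q := .cons h.adj .nil) (reduced_pair _ _)).symm ?_))
  exact Or.inl h

theorem carrierSide_subset_sideOf (W : X.Wall) (x : V) : X.carrierSide W x ⊆ X.sideOf W x :=
  fun _ h => Relation.ReflTransGen.mono (fun _ _ ⟨e, he, hW, _⟩ => ⟨e, he, hW⟩) _ _ h

/-- Applied with all directions to reach the whole cube, and with all but one to reach one of the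
halves cut out by a midcube. -/
theorem flipAt_induction {n : ℕ} (S : Set (Fin n)) {P : (Fin n → Bool) → Prop} {b : Fin n → Bool}
    (hb : P b) (h : ∀ c, ∀ j ∈ S, P c → P (flipAt c j)) {b' : Fin n → Bool}
    (hb' : ∀ j ∉ S, b' j = b j) : P b' := by
  classical
  suffices key : ∀ (T : Finset (Fin n)), ↑T ⊆ S → ∀ b' : Fin n → Bool, (∀ j ∉ T, b' j = b j) → P b'
    from key S.toFinite.toFinset (by simp) b' (by simpa using hb')
  intro T
  induction T using Finset.induction_on with
  | empty =>
    intro _ b' h'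
    rwa [show b' = b from funext fun j => h' j (by simp)]
  | insert a T ha ih =>
    intro hT b' h'
    have h1 : P (Function.update b' a (b a)) := by
      refine ih (fun j hj => hT (by simp [Finset.mem_coe.1 hj])) _ fun j hj => ?_
      by_cases hja : j = a
      · subst hja; simp
      · rw [Function.update_of_ne hja]; exact h' j (by simp [hja, hj])
    by_cases h2 : b' a = b a
    · rwa [← h2, Function.update_eq_self] at h1
    · have := h _ a (hT (by simp)) h1
      rwa [flipAt, Function.update_idem, Function.update_self, ← Bool.eq_not_of_ne h2,
        Function.update_eq_self] at this

theorem chart_dual {n : ℕ} {φ : (Fin n → Bool) → V} (h : X.IsChart φ) {W : X.Wall}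
    {b : Fin n → Bool} {i : Fin n} (hb : X.Dual W (φ b) (φ (flipAt b i))) (b' : Fin n → Bool) :
    X.Dual W (φ b') (φ (flipAt b' i)) := by
  refine flipAt_induction (P := fun c => X.Dual W (φ c) (φ (flipAt c i))) Set.univ hb ?_
    (fun j hj => absurd trivial hj)
  intro c j _ hc
  rcases eq_or_ne i j with rfl | hij
  · rw [flipAt_flipAt]; exact hc.symm
  · rw [flipAt_comm]; exact (chart_square h c hij).dual hc

theorem midcubeIn_iff {n : ℕ} {φ : (Fin n → Bool) → V} (h : X.IsChart φ) {W : X.Wall} {i : Fin n}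
    (b : Fin n → Bool) : X.MidcubeIn φ i W ↔ X.Dual W (φ b) (φ (flipAt b i)) :=
  ⟨fun ⟨e, _, he, hW⟩ => chart_dual h ⟨e, he, hW⟩ b, fun ⟨e, he, hW⟩ => ⟨e, b, he, hW⟩⟩

theorem chart_mem_sideOf {n : ℕ} {φ : (Fin n → Bool) → V} (h : X.IsChart φ) {W : X.Wall}
    (hW : ∀ i, ¬ X.MidcubeIn φ i W) {x : V} {b : Fin n → Bool} (hb : φ b ∈ X.sideOf W x)
    (b' : Fin n → Bool) : φ b' ∈ X.sideOf W x :=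
  flipAt_induction (P := fun c => φ c ∈ X.sideOf W x) Set.univ hb
    (fun c j _ hc => mem_sideOf_trans hc (mem_sideOf_of_adj (chart_adj h c j)
      fun hd => hW j ((midcubeIn_iff h c).2 hd))) (fun _ hj => absurd trivial hj)

theorem IsCAT0.midcubeIn_unique (hX : X.IsCAT0) {n : ℕ} {φ : (Fin n → Bool) → V}
    (h : X.IsChart φ) {W : X.Wall} {i j : Fin n} (hi : X.MidcubeIn φ i W)
    (hj : X.MidcubeIn φ j W) : i = j := by
  let b : Fin n → Bool := fun _ => true
  exact flipAt_injective b (h.1 (hX.dual_unique ((midcubeIn_iff h b).1 hi)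
    ((midcubeIn_iff h b).1 hj)))

/-- Only edges in direction `i` cross `W`: flipping another coordinate keeps the side, and flipping
`i` changes it. -/
theorem IsCAT0.chart_mem_sideOf_iff (hX : X.IsCAT0) {n : ℕ} {φ : (Fin n → Bool) → V}
    (h : X.IsChart φ) {W : X.Wall} {i : Fin n} (hi : X.MidcubeIn φ i W) {x : V}
    {b : Fin n → Bool} (hb : φ b ∈ X.sideOf W x) (b' : Fin n → Bool) :
    φ b' ∈ X.sideOf W x ↔ b' i = b i := by
  have key : ∀ b' : Fin n → Bool, b' i = b i → φ b' ∈ X.sideOf W x := by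
    intro b' hb'
    refine flipAt_induction (P := fun c => φ c ∈ X.sideOf W x) {i}ᶜ hb
      (fun c j hj hc => mem_sideOf_trans hc (mem_sideOf_of_adj (chart_adj h c j)
        fun hd => hj (hX.midcubeIn_unique h ((midcubeIn_iff h c).2 hd) hi))) ?_
    intro j hj
    rw [show j = i by simpa using hj, hb']
  refine ⟨fun h1 => ?_, key b'⟩
  by_contra h2
  have h3 : φ (flipAt b' i) ∈ X.sideOf W x := key _ (by
    rw [flipAt, Function.update_self, Bool.eq_not_of_ne h2, Bool.not_not])
  exact hX.notMem_sideOf ((midcubeIn_iff h b').1 hi) (mem_sideOf_trans (mem_sideOf_symm h1) h3)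

/-- A cube and a vertex not in it are separated by a wall. -/
theorem IsCAT0.exists_separating (hX : X.IsCAT0) {C : Set V} (hC : C ∈ X.cubes) {x : V}
    (hx : x ∉ C) : ∃ W : X.Wall, ∀ v ∈ C, v ∉ X.sideOf W x := by
  classical
  obtain ⟨n, φ, hφ, rfl⟩ := X.exists_chart C hC
  -- Take a shortest reduced path from a corner to `x`; the wall of its first edge separates. It
  -- does not cut the cube, since `dual_unique` would put that edge into the cube and allow a
  -- shorter path, and the rest of the path does not cross it again.
  have hex : ∃ N : ℕ, ∃ b, ∃ p : X.skeleton.Walk (φ b) x, X.Reduced p.support ∧ p.length = N := by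
    obtain ⟨p, hp⟩ := hX.exists_reduced_walk (φ fun _ => true) x
    exact ⟨_, _, p, hp, rfl⟩
  obtain ⟨b, p, hp, hN⟩ := Nat.find_spec hex
  have hmin := fun m => Nat.find_min hex (m := m)
  rw [← hN] at hmin
  clear hN
  generalize hv : φ b = v at p
  cases p with
  | nil => exact absurd ⟨b, hv⟩ hx
  | @cons _ y _ h p =>
    subst hv
    set W := X.wall (X.mkEdge h) with hWdef
    have hW : X.Dual W (φ b) y := dual_wall_mkEdge h
    have hy : y ∉ Set.range φ := by
      rintro ⟨b', rfl⟩
      exact hmin p.length (by simp) ⟨b', p, hp.tail, rfl⟩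
    have h1 : ∀ i, ¬ X.MidcubeIn φ i W := fun i hi =>
      hy (hX.dual_unique hW ((midcubeIn_iff hφ b).1 hi) ▸ Set.mem_range_self _)
    have h2 : y ∈ X.sideOf W x := by
      refine mem_sideOf_symm (mem_sideOf_of_walk p ?_)
      have hc := (SimpleGraph.Walk.cons h p).isChain_adj_support
      rw [SimpleGraph.Walk.support_cons, ← SimpleGraph.Walk.cons_tail_support] at hp hc
      rw [← SimpleGraph.Walk.cons_tail_support]
      exact hX.not_crosses hp hc hW
    refine ⟨W, ?_⟩
    rintro _ ⟨b', rfl⟩ hb'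
    exact hX.notMem_sideOf hW (mem_sideOf_trans
      (mem_sideOf_symm (chart_mem_sideOf hφ h1 hb' b)) h2)

theorem IsCAT0.exists_separating_vertex (hX : X.IsCAT0) {x y : V} (h : x ≠ y) :
    ∃ W : X.Wall, y ∉ X.sideOf W x := by
  obtain ⟨W, hW⟩ := hX.exists_separating (X.singleton_mem y) (x := x) (by simpa using h)
  exact ⟨W, hW y rfl⟩

end Sides

/-! ### Half-spaces and the metric -/

section Metric

variable {V : Type u} {X : CubeComplex V}

theorem sum_prod_bool {n : ℕ} (f : Fin n → Bool → ℝ) :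
    ∑ b : Fin n → Bool, ∏ i, f i (b i) = ∏ i, (f i true + f i false) := by
  rw [Finset.prod_congr rfl fun i _ => (Fintype.sum_bool (f i)).symm, Finset.prod_univ_sum,
    Fintype.piFinset_univ]

theorem sum_cubeWeight {n : ℕ} (t : Fin n → ℝ) :
    ∑ b : Fin n → Bool, ∏ i, (if b i then t i else 1 - t i) = 1 := by
  rw [sum_prod_bool fun i c => if c then t i else 1 - t i]
  simp

theorem sum_cubeWeight_of_eq {n : ℕ} (t : Fin n → ℝ) (i : Fin n) (c : Bool) :
    ∑ b : Fin n → Bool, (if b i = c then ∏ j, (if b j then t j else 1 - t j) else 0) =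
      if c then t i else 1 - t i := by
  have h := sum_prod_bool fun j d =>
    if j = i then (if d = c then (if d then t j else 1 - t j) else 0) else
      (if d then t j else 1 - t j)
  have h2 : ∀ b : Fin n → Bool, (if b i = c then ∏ j, (if b j then t j else 1 - t j) else 0) =
      ∏ j, if j = i then (if b j = c then (if b j then t j else 1 - t j) else 0) else
        (if b j then t j else 1 - t j) := by
    intro b
    split_ifs with hb
    · refine Finset.prod_congr rfl fun j _ => ?_
      by_cases hj : j = i
      · subst hj; simp [hb]
      · simp [hj]
    · exact (Finset.prod_eq_zero (Finset.mem_univ i) (by simp [hb])).symm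
  rw [Finset.sum_congr rfl fun b _ => h2 b, h, Finset.prod_eq_single i]
  · cases c <;> simp
  · intro j _ hj; simp [hj]
  · simp

open Classical in
variable (X) in
/-- The total weight of a point at the vertices on the side of `x` of the wall `W`. -/
noncomputable def sideWeight (W : X.Wall) (x : V) (p : X.Point) : ℝ :=
  ∑ᶠ y, if y ∈ X.sideOf W x then p.1 y else 0

open Classical in
theorem HasCoords.sideWeight_eq {p : X.Point} {n : ℕ} {φ : (Fin n → Bool) → V} {t : Fin n → ℝ}
    (h : X.HasCoords p φ t) (W : X.Wall) (x : V) :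
    X.sideWeight W x p = ∑ b, if φ b ∈ X.sideOf W x then
      ∏ i, (if b i then t i else 1 - t i) else 0 := by
  obtain ⟨hφ, -, hp⟩ := h
  rw [sideWeight, finsum_eq_sum_of_support_subset (s := Finset.univ.image φ)]
  · rw [Finset.sum_image fun a _ b _ hab => hφ.1 hab]
    refine Finset.sum_congr rfl fun b _ => ?_
    rw [hp, cubePoint, hφ.1.extend_apply]
  · intro y hy
    by_contra h'
    refine hy ?_
    simp only [hp, cubePoint]
    rw [Function.extend_apply' _ _ _ (by simpa using h')]
    simp

theorem HasCoords.sideWeight_eq_one {p : X.Point} {n : ℕ} {φ : (Fin n → Bool) → V}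
    {t : Fin n → ℝ} (h : X.HasCoords p φ t) {W : X.Wall} {x : V}
    (hb : ∀ b, φ b ∈ X.sideOf W x) : X.sideWeight W x p = 1 := by
  rw [h.sideWeight_eq]
  simp only [hb, if_true]
  exact sum_cubeWeight t

theorem HasCoords.sideWeight_eq_zero {p : X.Point} {n : ℕ} {φ : (Fin n → Bool) → V}
    {t : Fin n → ℝ} (h : X.HasCoords p φ t) {W : X.Wall} {x : V}
    (hb : ∀ b, φ b ∉ X.sideOf W x) : X.sideWeight W x p = 0 := by
  rw [h.sideWeight_eq]
  simp only [hb, if_false, Finset.sum_const_zero]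

theorem HasCoords.sideWeight_of_midcubeIn (hX : X.IsCAT0) {p : X.Point} {n : ℕ}
    {φ : (Fin n → Bool) → V} {t : Fin n → ℝ} (h : X.HasCoords p φ t) {W : X.Wall} {x : V}
    {i : Fin n} (hi : X.MidcubeIn φ i W) {b : Fin n → Bool} (hb : φ b ∈ X.sideOf W x) :
    X.sideWeight W x p = if b i then t i else 1 - t i := by
  rw [h.sideWeight_eq]
  simp only [hX.chart_mem_sideOf_iff h.1 hi hb]
  exact sum_cubeWeight_of_eq t i (b i)

theorem chart_side_trichotomy {n : ℕ} {φ : (Fin n → Bool) → V}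
    (h : X.IsChart φ) (W : X.Wall) (x : V) :
    (∀ b, φ b ∈ X.sideOf W x) ∨ (∀ b, φ b ∉ X.sideOf W x) ∨
      ∃ i b, X.MidcubeIn φ i W ∧ φ b ∈ X.sideOf W x := by
  by_cases h0 : ∃ b, φ b ∈ X.sideOf W x
  · obtain ⟨b, hb⟩ := h0
    by_cases h1 : ∃ i, X.MidcubeIn φ i W
    · obtain ⟨i, hi⟩ := h1
      exact Or.inr (Or.inr ⟨i, b, hi, hb⟩)
    · push Not at h1
      exact Or.inl (chart_mem_sideOf h h1 hb)
  · push Not at h0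
    exact Or.inr (Or.inl h0)

/-- On a single cube the weight is constantly `0` or `1`, or it is a coordinate or one minus a
coordinate; each is 1-Lipschitz. -/
theorem IsCAT0.abs_sideWeight_sub_le (hX : X.IsCAT0) (W : X.Wall) (x : V) {p q : X.Point} {ℓ : ℝ}
    (h : X.IsString p q ℓ) : |X.sideWeight W x p - X.sideWeight W x q| ≤ ℓ := by
  induction h with
  | nil p => simp
  | @cons p q r ℓ n φ s t hp hq _ ih =>
    refine (abs_sub_le _ (X.sideWeight W x q) _).trans (add_le_add ?_ ih)
    rcases chart_side_trichotomy hp.1 W x with h | h | ⟨i, b, hi, hb⟩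
    · rw [hp.sideWeight_eq_one h, hq.sideWeight_eq_one h]; simp
    · rw [hp.sideWeight_eq_zero h, hq.sideWeight_eq_zero h]; simp
    · rw [hp.sideWeight_of_midcubeIn hX hi hb, hq.sideWeight_of_midcubeIn hX hi hb]
      have h1 : |s i - t i| ≤ dist (WithLp.toLp 2 s : EuclideanSpace ℝ (Fin n))
          (WithLp.toLp 2 t) := by
        rw [dist_eq_norm]
        exact PiLp.norm_apply_le (WithLp.toLp 2 s - WithLp.toLp 2 t : EuclideanSpace ℝ (Fin n)) i
      refine le_trans (le_of_eq ?_) h1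
      split_ifs
      · rfl
      · rw [abs_sub_comm]; congr 1; ring

theorem IsCAT0.ofReal_le_edist (hX : X.IsCAT0) (W : X.Wall) (x : V) (p q : X.Point) :
    ENNReal.ofReal |X.sideWeight W x p - X.sideWeight W x q| ≤ edist p q :=
  le_iInf₂ fun _ h => ENNReal.ofReal_le_ofReal (hX.abs_sideWeight_sub_le W x h)

theorem IsCAT0.continuous_sideWeight (hX : X.IsCAT0) (W : X.Wall) (x : V) :
    Continuous (X.sideWeight W x) := by
  refine (LipschitzWith.of_edist_le fun p q => ?_).continuous
  rw [edist_dist, Real.dist_eq]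
  exact hX.ofReal_le_edist W x p q

/-- This description is free of charts and continuous in `p`, so half-spaces are closed and
membership can be tested in any cube containing `p`. -/
theorem IsCAT0.mem_halfSpace_iff (hX : X.IsCAT0) {W : X.Wall} {x : V} {p : X.Point} :
    p ∈ X.halfSpace W x ↔ 1 / 2 ≤ X.sideWeight W x p := by
  constructor
  · rintro ⟨n, φ, t, h, hb | ⟨i, b, hi, hb, ht⟩⟩
    · rw [h.sideWeight_eq_one hb]; norm_num
    · rw [h.sideWeight_of_midcubeIn hX hi hb]
      rw [abs_le] at ht
      split_ifs at ht ⊢ <;> linarith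
  · intro h
    obtain ⟨n, φ, t, hφ, ht, hp⟩ := p.2
    have hc : X.HasCoords p φ t := ⟨hφ, ht, hp⟩
    refine ⟨n, φ, t, hc, ?_⟩
    rcases chart_side_trichotomy hφ W x with h' | h' | ⟨i, b, hi, hb⟩
    · exact Or.inl h'
    · rw [hc.sideWeight_eq_zero h'] at h; norm_num at h
    · refine Or.inr ⟨i, b, hi, hb, ?_⟩
      rw [hc.sideWeight_of_midcubeIn hX hi hb] at h
      have := ht i
      rw [Set.mem_Icc] at this
      rw [abs_le]
      split_ifs at h ⊢ <;> constructor <;> linarith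

theorem hasCoords_vertexPt (x : V) :
    X.HasCoords (X.vertexPt x) (fun _ : Fin 0 → Bool => x) (fun i => i.elim0) :=
  ⟨X.isChart_const x, fun i => i.elim0, rfl⟩

theorem IsCAT0.vertexPt_mem_halfSpace (hX : X.IsCAT0) {W : X.Wall} {x y : V} :
    X.vertexPt y ∈ X.halfSpace W x ↔ y ∈ X.sideOf W x := by
  rw [hX.mem_halfSpace_iff]
  by_cases h : y ∈ X.sideOf W x
  · rw [(hasCoords_vertexPt y).sideWeight_eq_one fun _ => h]
    norm_num [h]
  · rw [(hasCoords_vertexPt y).sideWeight_eq_zero fun _ => h]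
    norm_num [h]

theorem vertexPt_mem_vertexStar (x : V) : X.vertexPt x ∈ X.vertexStar x := fun _ h => h.2

theorem IsCAT0.vertexStar_subset_halfSpace (hX : X.IsCAT0) (W : X.Wall) (x : V) :
    X.vertexStar x ⊆ X.halfSpace W x :=
  fun _ hp => hp _ ⟨⟨W, x, rfl⟩, hX.vertexPt_mem_halfSpace.2 (mem_sideOf_self W x)⟩

theorem IsCAT0.vertexPt_mem_vertexStar_iff (hX : X.IsCAT0) {x y : V} :
    X.vertexPt y ∈ X.vertexStar x ↔ y = x := by
  constructor
  · intro h
    by_contra hne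
    obtain ⟨W, hW⟩ := hX.exists_separating_vertex (Ne.symm hne)
    exact hW (hX.vertexPt_mem_halfSpace.1 (hX.vertexStar_subset_halfSpace W x h))
  · rintro rfl
    exact vertexPt_mem_vertexStar y

theorem IsCAT0.isClosed_halfSpace (hX : X.IsCAT0) (W : X.Wall) (x : V) :
    IsClosed (X.halfSpace W x) := by
  have : X.halfSpace W x = X.sideWeight W x ⁻¹' Set.Ici (1 / 2) := by
    ext p; exact hX.mem_halfSpace_iff
  rw [this]
  exact isClosed_Ici.preimage (hX.continuous_sideWeight W x)

theorem IsCAT0.isClosed_vertexStar (hX : X.IsCAT0) (x : V) : IsClosed (X.vertexStar x) := by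
  refine isClosed_sInter ?_
  rintro _ ⟨⟨W, y, rfl⟩, -⟩
  exact hX.isClosed_halfSpace W y

/-- A point of `vertexStar x` lies only in cubes that contain `x`. -/
theorem IsCAT0.mem_range_of_mem_vertexStar (hX : X.IsCAT0) {x : V} {p : X.Point}
    (hp : p ∈ X.vertexStar x) {n : ℕ} {φ : (Fin n → Bool) → V} {t : Fin n → ℝ}
    (h : X.HasCoords p φ t) : x ∈ Set.range φ := by
  by_contra hx
  obtain ⟨W, hW⟩ := hX.exists_separating h.1.2.1 hx
  have := hX.mem_halfSpace_iff.1 (hX.vertexStar_subset_halfSpace W x hp)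
  rw [h.sideWeight_eq_zero fun b => hW _ (Set.mem_range_self b)] at this
  norm_num at this

theorem isCompact_chart {n : ℕ} {φ : (Fin n → Bool) → V} (h : X.IsChart φ) :
    IsCompact {p : X.Point | ∃ t, X.HasCoords p φ t} := by
  let S : Set (EuclideanSpace ℝ (Fin n)) :=
    WithLp.toLp 2 '' Set.Icc (0 : Fin n → ℝ) (1 : Fin n → ℝ)
  have hS : IsCompact S := isCompact_Icc.image (PiLp.continuous_toLp 2 _)
  have hS' : ∀ s : S, ∀ i, s.1 i ∈ Set.Icc (0 : ℝ) 1 := by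
    rintro ⟨_, t, ht, rfl⟩ i
    exact ⟨ht.1 i, ht.2 i⟩
  have : CompactSpace S := isCompact_iff_compactSpace.1 hS
  let F : S → X.Point := fun s => ⟨cubePoint φ s.1, n, φ, s.1, h, hS' s, rfl⟩
  have hF : Continuous F := by
    refine (LipschitzWith.of_edist_le fun s t => ?_).continuous
    refine (iInf₂_le _ (IsString.cons (p := F s) (q := F t) φ s.1 t.1 ⟨h, hS' s, rfl⟩
      ⟨h, hS' t, rfl⟩ (.nil _))).trans ?_
    rw [add_zero]
    exact (edist_dist s.1 t.1).ge
  convert isCompact_range hF using 1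
  ext p
  constructor
  · rintro ⟨t, ht⟩
    exact ⟨⟨WithLp.toLp 2 t, t, ⟨fun i => (ht.2.1 i).1, fun i => (ht.2.1 i).2⟩, rfl⟩,
      Subtype.ext ht.2.2.symm⟩
  · rintro ⟨s, rfl⟩
    exact ⟨s.1, h, hS' s, rfl⟩

theorem finite_cube {C : Set V} (hC : C ∈ X.cubes) : C.Finite := by
  obtain ⟨n, φ, -, rfl⟩ := X.exists_chart C hC
  exact Set.finite_range φ

theorem isCompact_cube {C : Set V} (hC : C ∈ X.cubes) :
    IsCompact {p : X.Point | ∃ (n : ℕ) (φ : (Fin n → Bool) → V) (t : Fin n → ℝ),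
      X.HasCoords p φ t ∧ Set.range φ = C} := by
  obtain ⟨n, hn⟩ := exists_ncard_cube hC
  have hfin : {φ : (Fin n → Bool) → V | ∀ b, φ b ∈ C}.Finite :=
    Set.Finite.pi' fun _ => finite_cube hC
  have hfin' : {φ : (Fin n → Bool) → V | X.IsChart φ ∧ Set.range φ = C}.Finite :=
    hfin.subset fun φ hφ b => hφ.2 ▸ Set.mem_range_self b
  convert hfin'.isCompact_biUnion fun φ hφ => isCompact_chart hφ.1 using 1
  ext p
  simp only [Set.mem_ofPred_eq, Set.mem_iUnion, exists_prop]
  constructor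
  · rintro ⟨m, φ, t, h, rfl⟩
    obtain rfl : m = n := by
      rw [← Set.image_univ, Set.ncard_image_of_injective _ h.1.1, Set.ncard_univ] at hn
      simp only [Nat.card_eq_fintype_card, Fintype.card_pi, Fintype.card_bool, Finset.prod_const,
        Finset.card_univ, Fintype.card_fin] at hn
      exact Nat.pow_right_injective le_rfl hn
    exact ⟨φ, ⟨h.1, rfl⟩, t, h⟩
  · rintro ⟨φ, ⟨-, h1⟩, t, h2⟩
    exact ⟨n, φ, t, h2, h1⟩

theorem IsCAT0.isCompact_vertexStar (hX : X.IsCAT0) {x : V}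
    (hfin : {C ∈ X.cubes | x ∈ C}.Finite) : IsCompact (X.vertexStar x) := by
  refine (hfin.isCompact_biUnion fun C hC => isCompact_cube hC.1).of_isClosed_subset
    (hX.isClosed_vertexStar x) fun p hp => ?_
  obtain ⟨n, φ, t, hφ, ht, h⟩ := p.2
  have hc : X.HasCoords p φ t := ⟨hφ, ht, h⟩
  exact Set.mem_biUnion (x := Set.range φ) ⟨hφ.2.1, hX.mem_range_of_mem_vertexStar hp hc⟩
    ⟨n, φ, t, hc, rfl⟩

variable (X) in
/-- `p` is the barycentre of the cube `C`. -/
def IsBarycentre (p : X.Point) (C : Set V) : Prop :=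
  ∃ (n : ℕ) (φ : (Fin n → Bool) → V), X.HasCoords p φ (fun _ => 1 / 2) ∧ Set.range φ = C

theorem exists_isBarycentre {C : Set V} (hC : C ∈ X.cubes) : ∃ p, X.IsBarycentre p C := by
  obtain ⟨n, φ, hφ, rfl⟩ := X.exists_chart C hC
  have h : ∀ i : Fin n, (fun _ : Fin n => (1 / 2 : ℝ)) i ∈ Set.Icc (0 : ℝ) 1 := by
    intro i; norm_num
  exact ⟨⟨cubePoint φ fun _ => 1 / 2, n, φ, _, hφ, h, rfl⟩, n, φ, ⟨hφ, h, rfl⟩, rfl⟩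

/-- Choose a wall between `D` and a vertex `x` of `C` outside `D`. On the side of `x` the barycentre
of `C` has weight `1/2` or `1`, that of `D` has weight `0`. -/
theorem IsCAT0.half_le_edist_of_not_subset (hX : X.IsCAT0) {p q : X.Point} {C D : Set V}
    (hp : X.IsBarycentre p C) (hq : X.IsBarycentre q D) (h : ¬ C ⊆ D) :
    ENNReal.ofReal (1 / 2) ≤ edist p q := by
  obtain ⟨m, φ, hp, rfl⟩ := hp
  obtain ⟨n, ψ, hq, rfl⟩ := hq
  obtain ⟨x, ⟨b, hx⟩, hx'⟩ := Set.not_subset.1 h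
  obtain ⟨W, hW⟩ := hX.exists_separating hq.1.2.1 hx'
  refine le_trans (ENNReal.ofReal_le_ofReal ?_) (hX.ofReal_le_edist W x p q)
  rw [hq.sideWeight_eq_zero fun b => hW _ (Set.mem_range_self b), sub_zero]
  refine le_trans ?_ (le_abs_self _)
  have hxW : φ b ∈ X.sideOf W x := hx ▸ mem_sideOf_self W x
  by_cases h1 : ∃ i, X.MidcubeIn φ i W
  · obtain ⟨i, hi⟩ := h1
    rw [hp.sideWeight_of_midcubeIn hX hi hxW]
    split_ifs <;> norm_num
  · push Not at h1
    rw [hp.sideWeight_eq_one (chart_mem_sideOf hp.1 h1 hxW)]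
    norm_num

theorem IsCAT0.half_le_edist (hX : X.IsCAT0) {p q : X.Point} {C D : Set V}
    (hp : X.IsBarycentre p C) (hq : X.IsBarycentre q D) (h : C ≠ D) :
    ENNReal.ofReal (1 / 2) ≤ edist p q := by
  by_cases h' : C ⊆ D
  · rw [edist_comm]
    exact hX.half_le_edist_of_not_subset hq hp fun h2 => h (h'.antisymm h2)
  · exact hX.half_le_edist_of_not_subset hp hq h'

theorem finite_of_separated {α ι : Type*} [PseudoEMetricSpace α] {K : Set α} (hK : IsCompact K)
    {S : Set ι} (f : ι → α) (hf : ∀ i ∈ S, f i ∈ K) {ε : ℝ≥0∞} (hε : 0 < ε)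
    (hsep : ∀ i ∈ S, ∀ j ∈ S, i ≠ j → ε ≤ edist (f i) (f j)) : S.Finite := by
  obtain ⟨t, -, ht⟩ := hK.elim_nhds_subcover (fun x => Metric.eball x (ε / 2))
    fun x _ => Metric.eball_mem_nhds x (ENNReal.half_pos hε.ne')
  have hc : ∀ i ∈ S, ∃ x ∈ t, f i ∈ Metric.eball x (ε / 2) := fun i hi => by
    simpa using ht (hf i hi)
  rcases S.eq_empty_or_nonempty with rfl | ⟨i₀, -⟩
  · exact Set.finite_empty
  have : Nonempty α := ⟨f i₀⟩
  choose! c hct hc using hc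
  refine Set.Finite.of_finite_image (t.finite_toSet.subset (Set.image_subset_iff.2 hct)) ?_
  intro i hi j hj hij
  by_contra hne
  have h1 := hc i hi
  have h2 := hc j hj
  rw [← hij] at h2
  have h3 : edist (f i) (f j) < ε := by
    refine (edist_triangle_right _ _ (c i)).trans_lt ?_
    calc _ < ε / 2 + ε / 2 := ENNReal.add_lt_add h1 h2
      _ = ε := ENNReal.add_halves ε
  exact absurd (hsep i hi j hj hne) (not_le.2 h3)

end Metric

/-! ### Proper cocompact actions -/

section Actions

variable {V : Type u} {X : CubeComplex V} {G : Type v} [Group G] [MulAction G V]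
  [X.IsCubicalAction G]

theorem HasCoords.smul {p : X.Point} {n : ℕ} {φ : (Fin n → Bool) → V} {t : Fin n → ℝ}
    (h : X.HasCoords p φ t) (g : G) : X.HasCoords (g • p) (fun b => g • φ b) t := by
  refine ⟨h.1.smul g, h.2.1, ?_⟩
  funext v
  change p.1 (g⁻¹ • v) = _
  rw [h.2.2]
  exact cubePoint_smul g h.1.1 t v

theorem smul_vertexPt (g : G) (x : V) : g • X.vertexPt x = X.vertexPt (g • x) :=
  Subtype.ext ((hasCoords_vertexPt x).smul g).2.2

theorem IsBarycentre.smul {p : X.Point} {C : Set V} (h : X.IsBarycentre p C) (g : G) :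
    X.IsBarycentre (g • p) (g • C) := by
  obtain ⟨n, φ, h, rfl⟩ := h
  refine ⟨n, _, h.smul g, ?_⟩
  ext y; simp [Set.mem_smul_set]

theorem IsString.smul {p q : X.Point} {ℓ : ℝ} (h : X.IsString p q ℓ) (g : G) :
    X.IsString (g • p) (g • q) ℓ := by
  induction h with
  | nil p => exact .nil _
  | cons φ s t hp hq _ ih => exact .cons _ s t (hp.smul g) (hq.smul g) ih

theorem edist_smul_le (g : G) (p q : X.Point) : edist (g • p) (g • q) ≤ edist p q :=
  le_iInf₂ fun ℓ h => iInf₂_le ℓ (h.smul g)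

theorem smul_mem_wallPoints {W : X.Wall} {p : X.Point} (h : p ∈ X.wallPoints W) (g : G) :
    g • p ∈ X.wallPoints (g • W) := by
  obtain ⟨n, φ, t, i, h, ⟨e, b, he, rfl⟩, ht⟩ := h
  refine ⟨n, _, t, i, h.smul g, ⟨g • e, b, ?_, rfl⟩, ht⟩
  change g • e.1 = _
  rw [he, ← Set.image_smul, Set.image_pair]

theorem qwallDist_smul_le (K : Subgroup G) [K.Normal] (g : G) (w w' : X.QWall K) :
    X.qwallDist K (g • w) (g • w') ≤ X.qwallDist K w w' := by
  refine le_iInf₂ fun W hW => le_iInf₂ fun W' hW' => le_iInf₂ fun p hp => le_iInf₂ fun q hq => ?_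
  refine (iInf₂_le (g • W) (by rw [← hW]; rfl)).trans
    ((iInf₂_le (g • W') (by rw [← hW']; rfl)).trans
    ((iInf₂_le _ (smul_mem_wallPoints hp g)).trans ((iInf₂_le _ (smul_mem_wallPoints hq g)).trans
      (edist_smul_le g p q))))

theorem wallGraph_adj_smul (K : Subgroup G) [K.Normal] {R : ℝ} (g : G) {w w' : X.QWall K}
    (h : (X.wallGraph K R).Adj w w') : (X.wallGraph K R).Adj (g • w) (g • w') :=
  ⟨fun h' => h.1 (MulAction.injective g h'), (qwallDist_smul_le K g w w').trans h.2⟩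

/-- If not empty, this is a coset of the stabiliser of `x`, whose elements make every ball about
that vertex meet its translate. -/
theorem finite_transporter (hproper : X.IsProperAction G) (x y : V) :
    {g : G | g • x = y}.Finite := by
  rcases Set.eq_empty_or_nonempty {g : G | g • x = y} with h | ⟨g₀, h₀⟩
  · rw [h]; exact Set.finite_empty
  · obtain ⟨r, hr, hfin⟩ := hproper (X.vertexPt x)
    refine (hfin.image (g₀ * ·)).subset ?_
    intro g hg
    refine ⟨g₀⁻¹ * g, ⟨X.vertexPt x, ?_, Metric.mem_eball_self hr⟩, by simp⟩
    refine ⟨X.vertexPt x, Metric.mem_eball_self hr, ?_⟩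
    change (g₀⁻¹ * g) • X.vertexPt x = _
    rw [smul_vertexPt, mul_smul, show g • x = y from hg, inv_smul_eq_iff.2 (show y = g₀ • x from
      Eq.symm h₀)]

/-- Barycentres are uniformly separated, so only finitely many lie in the compact set whose
translates cover. -/
theorem exists_finite_cubes (hX : X.IsCAT0)
    (hcocompact : X.ActsCocompactlyOn (⊤ : Subgroup G) Set.univ) :
    ∃ 𝓓 : Set (Set V), 𝓓.Finite ∧ 𝓓 ⊆ X.cubes ∧ ∀ C ∈ X.cubes, ∃ g : G, ∃ D ∈ 𝓓, C = g • D := by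
  obtain ⟨K, hK, -, hcov⟩ := hcocompact.2
  have : Nonempty X.Point := hX.connected.nonempty.map X.vertexPt
  choose! f hf using fun C (hC : C ∈ X.cubes ∧ ∃ p ∈ K, X.IsBarycentre p C) => hC.2
  refine ⟨{C | C ∈ X.cubes ∧ ∃ p ∈ K, X.IsBarycentre p C}, ?_, fun C hC => hC.1, ?_⟩
  · exact finite_of_separated hK f (fun C hC => (hf C hC).1) (ε := ENNReal.ofReal (1 / 2))
      (by simp) fun C hC D hD hne => hX.half_le_edist (hf C hC).2 (hf D hD).2 hne
  · intro C hC
    obtain ⟨p, hp⟩ := exists_isBarycentre hC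
    obtain ⟨g, -, q, hq, rfl⟩ : ∃ g ∈ (⊤ : Subgroup G), p ∈ g • K := by
      simpa using hcov (Set.mem_univ p)
    refine ⟨g, g⁻¹ • C, ⟨(X.smul_mem_cubes_iff _ _).2 hC, q, hq, ?_⟩, (smul_inv_smul g C).symm⟩
    simpa using hp.smul g⁻¹

theorem finite_cubes_at (hX : X.IsCAT0) (hproper : X.IsProperAction G)
    (hcocompact : X.ActsCocompactlyOn (⊤ : Subgroup G) Set.univ) (x : V) :
    {C ∈ X.cubes | x ∈ C}.Finite := by
  obtain ⟨𝓓, hfin, h𝓓, hcov⟩ := exists_finite_cubes (G := G) hX hcocompact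
  refine (hfin.biUnion fun D hD => (finite_cube (h𝓓 hD)).biUnion fun d _ =>
    (finite_transporter hproper d x).image fun g : G => g • D).subset ?_
  rintro C ⟨hC, hx⟩
  obtain ⟨g, D, hD, rfl⟩ := hcov C hC
  obtain ⟨d, hd, hdx⟩ := hx
  simp only [Set.mem_iUnion]
  exact ⟨D, hD, d, hd, g, hdx, rfl⟩

theorem finite_edges_at (hX : X.IsCAT0) (hproper : X.IsProperAction G)
    (hcocompact : X.ActsCocompactlyOn (⊤ : Subgroup G) Set.univ) (x : V) :
    {e : X.Edge | x ∈ e.1}.Finite :=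
  Set.Finite.of_finite_image ((finite_cubes_at hX hproper hcocompact x).subset (by
    rintro _ ⟨e, he, rfl⟩; exact ⟨e.2.1, he⟩)) Subtype.val_injective.injOn

theorem finite_vertex_orbits (hX : X.IsCAT0)
    (hcocompact : X.ActsCocompactlyOn (⊤ : Subgroup G) Set.univ) :
    Finite (MulAction.orbitRel.Quotient G V) := by
  obtain ⟨𝓓, hfin, h𝓓, hcov⟩ := exists_finite_cubes (G := G) hX hcocompact
  have hfin' : (⋃ D ∈ 𝓓, D).Finite := hfin.biUnion fun D hD => finite_cube (h𝓓 hD)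
  have : Finite (⋃ D ∈ 𝓓, D : Set V) := hfin'
  refine Finite.of_surjective
    (fun d : (⋃ D ∈ 𝓓, D : Set V) => (Quotient.mk (MulAction.orbitRel G V) d.1)) ?_
  rintro ⟨x⟩
  obtain ⟨g, D, hD, h⟩ := hcov _ (X.singleton_mem x)
  obtain ⟨d, hd, hdx⟩ : x ∈ g • D := h ▸ rfl
  refine ⟨⟨d, Set.mem_biUnion hD hd⟩, Quotient.sound ⟨g⁻¹, ?_⟩⟩
  change g⁻¹ • x = d
  rw [← hdx]
  exact inv_smul_smul g d

end Actions
end CubeComplex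

/-! ### Invariant means on colourings -/

namespace RandomColouring

open MeasureTheory Filter Topology

variable {Q : Type u}

/-! ### Greedy colourings determined by labels. -/

section Greedy

variable (Γ : SimpleGraph Q) (k : ℕ)

open Classical in
/-- A colour outside `S`, if there is one. -/
noncomputable def pick {k : ℕ} (S : Set (Fin (k + 1))) : Fin (k + 1) :=
  if h : ∃ c, c ∉ S then h.choose else 0

theorem pick_notMem {k : ℕ} {S : Set (Fin (k + 1))} (hS : S.encard ≤ k) : pick S ∉ S := by
  have h : ∃ c, c ∉ S := by
    by_contra! h
    rw [Set.eq_univ_of_forall h, Set.encard_univ, ENat.card_eq_coe_fintype_card,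
      Fintype.card_fin] at hS
    have : k + 1 ≤ k := by exact_mod_cast hS
    omega
  rw [pick, dif_pos h]
  exact h.choose_spec

/-- The greedy colouring for a labelling `ℓ`, after the vertices with label less than `i` have
been coloured. -/
noncomputable def greedy {N : ℕ} (ℓ : Q → Fin N) : ℕ → Q → Fin (k + 1)
  | 0, _ => 0
  | i + 1, w => if (ℓ w : ℕ) = i then
      pick {c | ∃ w', Γ.Adj w w' ∧ (ℓ w' : ℕ) < i ∧ greedy ℓ i w' = c} else greedy ℓ i w

variable {Γ k} {N : ℕ}

theorem greedy_of_lt {ℓ : Q → Fin N} {i : ℕ} {w : Q} (h : (ℓ w : ℕ) < i) :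
    greedy Γ k ℓ i w = greedy Γ k ℓ (ℓ w + 1) w := by
  induction i with
  | zero => omega
  | succ i ih =>
    rcases Nat.lt_succ_iff_lt_or_eq.1 h with h' | h'
    · rw [greedy, if_neg h'.ne, ih h']
    · rw [h']

/-- When `w` is coloured, `w'` already has its final colour and at most `k` colours are forbidden.
Labels must differ, since vertices with equal labels are coloured simultaneously. -/
theorem greedy_ne (hk : ∀ w, (Γ.neighborSet w).encard ≤ k) {ℓ : Q → Fin N} {w w' : Q}
    (h : Γ.Adj w w') (hℓ : ℓ w' < ℓ w) : greedy Γ k ℓ N w ≠ greedy Γ k ℓ N w' := by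
  rw [greedy_of_lt (ℓ w).2, greedy, if_pos rfl]
  set S := {c | ∃ v, Γ.Adj w v ∧ (ℓ v : ℕ) < ℓ w ∧ greedy Γ k ℓ (ℓ w) v = c}
  have hS : S.encard ≤ k := by
    refine le_trans (Set.encard_le_encard (t := greedy Γ k ℓ (ℓ w) '' Γ.neighborSet w) ?_)
      ((Set.encard_image_le _ _).trans (hk w))
    rintro c ⟨v, hv, -, rfl⟩
    exact ⟨v, hv, rfl⟩
  intro he
  refine pick_notMem hS (he ▸ ⟨w', h, hℓ, ?_⟩)
  rw [greedy_of_lt hℓ, greedy_of_lt (ℓ w').2]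

theorem greedy_smul {G : Type v} [Group G] [MulAction G Q]
    (hG : ∀ (g : G) {w w' : Q}, Γ.Adj w w' → Γ.Adj (g • w) (g • w')) (g : G) (ℓ : Q → Fin N)
    (i : ℕ) (w : Q) : greedy Γ k (fun v => ℓ (g • v)) i w = greedy Γ k ℓ i (g • w) := by
  induction i generalizing w with
  | zero => rfl
  | succ i ih =>
    rw [greedy, greedy, ih w]
    congr 2
    ext c
    constructor
    · rintro ⟨v, hv, h1, h2⟩
      exact ⟨g • v, hG g hv, h1, by rw [← ih, h2]⟩
    · rintro ⟨v, hv, h1, h2⟩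
      refine ⟨g⁻¹ • v, ?_, by simpa using h1, by rw [ih, smul_inv_smul, h2]⟩
      simpa using hG g⁻¹ hv

/-- Each stage consults only the labels and the previous stage at `w` and its finitely many
neighbours. -/
theorem exists_finset_greedy (hk : ∀ w, (Γ.neighborSet w).encard ≤ k) (i : ℕ) (w : Q) :
    ∃ F : Finset Q, ∀ ℓ ℓ' : Q → Fin N, (∀ v ∈ F, ℓ v = ℓ' v) →
      greedy Γ k ℓ i w = greedy Γ k ℓ' i w := by
  classical
  induction i generalizing w with
  | zero => exact ⟨∅, fun _ _ _ => rfl⟩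
  | succ i ih =>
    choose F hF using ih
    have hfin : (Γ.neighborSet w).Finite :=
      Set.finite_of_encard_le_coe (hk w)
    refine ⟨insert w (F w) ∪ (hfin.toFinset ∪ hfin.toFinset.biUnion F), fun ℓ ℓ' h => ?_⟩
    have h1 : ℓ w = ℓ' w := h w (by simp)
    have h2 : greedy Γ k ℓ i w = greedy Γ k ℓ' i w :=
      hF w ℓ ℓ' fun v hv => h v (by simp [hv])
    have h3 : ∀ v, Γ.Adj w v → ℓ v = ℓ' v ∧ greedy Γ k ℓ i v = greedy Γ k ℓ' i v := by
      intro v hv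
      refine ⟨h v (by simp [hv]), hF v ℓ ℓ' fun u hu => h u ?_⟩
      simp only [Finset.mem_union, Finset.mem_biUnion, Set.Finite.mem_toFinset]
      exact Or.inr (Or.inr ⟨v, hv, hu⟩)
    rw [greedy, greedy, h1, h2]
    congr 2
    ext c
    constructor
    · rintro ⟨v, hv, h4, h5⟩
      exact ⟨v, hv, (h3 v hv).1 ▸ h4, (h3 v hv).2 ▸ h5⟩
    · rintro ⟨v, hv, h4, h5⟩
      exact ⟨v, hv, (h3 v hv).1 ▸ h4, (h3 v hv).2 ▸ h5⟩

end Greedy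

/-- A set of functions that depends on finitely many values only. -/
def Finitary {A : Type*} (E : Set (Q → A)) : Prop :=
  ∃ F : Finset Q, ∀ c c' : Q → A, (∀ w ∈ F, c w = c' w) → c ∈ E → c' ∈ E

theorem Finitary.measurableSet {A : Type*} [Finite A] [MeasurableSpace A]
    [MeasurableSingletonClass A] {E : Set (Q → A)} (h : Finitary E) : MeasurableSet E := by
  obtain ⟨F, hF⟩ := h
  have h1 : E = F.restrict ⁻¹' (F.restrict '' E) := by
    refine (Set.subset_preimage_image _ _).antisymm ?_
    rintro c ⟨c', hc', hcc⟩
    exact hF c' c (fun w hw => congrFun hcc ⟨w, hw⟩) hc'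
  rw [h1]
  exact (Set.toFinite _).measurableSet.preimage (Finset.measurable_restrict F)

/-! ### An invariant mean as a limit of random greedy colourings. -/

section Mean

/-- A finitely additive probability on the finitary sets of colourings with colours in `Fin n`
that is invariant under `G` and vanishes where a given edge of `Γ` is not properly coloured. -/
structure Mean (G : Type v) [Group G] [MulAction G Q] (Γ : SimpleGraph Q) (n : ℕ) where
  m : Set (Q → Fin n) → ℝ
  nonneg : ∀ E, 0 ≤ m E
  univ : m Set.univ = 1
  union : ∀ {E E'}, Finitary E → Finitary E' → Disjoint E E' → m (E ∪ E') = m E + m E'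
  smul : ∀ (g : G) {E}, Finitary E → m {c | (fun w => c (g • w)) ∈ E} = m E
  adj : ∀ {w w'}, Γ.Adj w w' → m {c | c w = c w'} = 0

/-- Independent uniform labels in `Fin (N + 1)`. -/
noncomputable def labelMeasure (Q : Type u) (N : ℕ) : Measure (Q → Fin (N + 1)) :=
  Measure.infinitePi fun _ => (PMF.uniformOfFintype (Fin (N + 1))).toMeasure

instance (N : ℕ) : IsProbabilityMeasure (labelMeasure Q N) := by
  unfold labelMeasure; infer_instance

theorem labelMeasure_smul {G : Type v} [Group G] [MulAction G Q] (N : ℕ) (g : G)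
    {E : Set (Q → Fin (N + 1))} (hE : MeasurableSet E) :
    labelMeasure Q N {ℓ | (fun w => ℓ (g • w)) ∈ E} = labelMeasure Q N E := by
  have h := Measure.infinitePi_map_piCongrLeft (X := fun _ : Q => Fin (N + 1))
    (fun _ => (PMF.uniformOfFintype (Fin (N + 1))).toMeasure) (MulAction.toPerm g⁻¹)
  have h2 : (fun ℓ : Q → Fin (N + 1) => fun w => ℓ (g • w)) =
      MeasurableEquiv.piCongrLeft (fun _ : Q => Fin (N + 1))
        (MulAction.toPerm g⁻¹ : Equiv.Perm Q) := by
    funext ℓ w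
    obtain ⟨v, rfl⟩ := (MulAction.toPerm g⁻¹ : Equiv.Perm Q).surjective w
    rw [MeasurableEquiv.coe_piCongrLeft, Equiv.piCongrLeft_apply_apply]
    simp
  change labelMeasure Q N ((fun ℓ : Q → Fin (N + 1) => fun w => ℓ (g • w)) ⁻¹' E) = _
  conv_rhs => rw [labelMeasure, ← h]
  rw [Measure.map_apply (MeasurableEquiv.measurable _) hE, h2]
  rfl

theorem labelMeasure_eq_le (N : ℕ) {w w' : Q} (h : w ≠ w') :
    (labelMeasure Q N).real {ℓ | ℓ w = ℓ w'} ≤ 1 / ((N : ℝ) + 1) := by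
  classical
  have h1 : {ℓ : Q → Fin (N + 1) | ℓ w = ℓ w'} ⊆
      ⋃ a : Fin (N + 1), Set.pi ({w, w'} : Finset Q) fun _ => {a} := by
    intro ℓ hℓ
    refine Set.mem_iUnion.2 ⟨ℓ w, ?_⟩
    intro v hv
    simp only [Finset.coe_insert, Finset.coe_singleton, Set.mem_insert_iff,
      Set.mem_singleton_iff] at hv
    rcases hv with rfl | rfl
    · rfl
    · exact hℓ.symm
  have h2 : ∀ a : Fin (N + 1), (labelMeasure Q N).real
      (Set.pi ({w, w'} : Finset Q) fun _ => {a}) = (1 / ((N : ℝ) + 1)) ^ 2 := by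
    intro a
    rw [Measure.real, labelMeasure, Measure.infinitePi_pi _ fun _ _ => measurableSet_singleton a,
      Finset.prod_const, Finset.card_pair h, PMF.toMeasure_apply_singleton _ _
      (measurableSet_singleton a), PMF.uniformOfFintype_apply,
      Fintype.card_fin, ENNReal.toReal_pow, ENNReal.toReal_inv, ENNReal.toReal_natCast]
    push_cast
    rw [one_div]
  calc (labelMeasure Q N).real {ℓ | ℓ w = ℓ w'}
      ≤ (labelMeasure Q N).real (⋃ a : Fin (N + 1), Set.pi ({w, w'} : Finset Q) fun _ => {a}) :=
        measureReal_mono h1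
    _ ≤ ∑ a : Fin (N + 1), (labelMeasure Q N).real
          (Set.pi ({w, w'} : Finset Q) fun _ => {a}) := measureReal_iUnion_fintype_le _
    _ = 1 / ((N : ℝ) + 1) := by
        simp only [h2, Finset.sum_const, Finset.card_univ, Fintype.card_fin, nsmul_eq_mul]
        have : (N : ℝ) + 1 ≠ 0 := by positivity
        push_cast
        field_simp

theorem finitary_greedy_preimage {Γ : SimpleGraph Q} {k : ℕ}
    (hk : ∀ w, (Γ.neighborSet w).encard ≤ k) {N : ℕ} {E : Set (Q → Fin (k + 1))}
    (hE : Finitary E) : Finitary {ℓ : Q → Fin N | greedy Γ k ℓ N ∈ E} := by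
  classical
  obtain ⟨F, hF⟩ := hE
  choose B hB using fun w => exists_finset_greedy (N := N) hk N w
  refine ⟨F.biUnion B, fun ℓ ℓ' h => hF _ _ fun w hw => hB w ℓ ℓ' fun v hv => h v ?_⟩
  exact Finset.mem_biUnion.2 ⟨w, hw, hv⟩

/-- With `N + 1` labels the law of the greedy colouring is invariant, and a given edge is improperly
coloured with probability at most `1 / (N + 1)`. An ultrafilter limit makes this probability zero;
finite additivity on finitary sets survives. -/
theorem nonempty_mean {G : Type v} [Group G] [MulAction G Q] {Γ : SimpleGraph Q} {k : ℕ}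
    (hG : ∀ (g : G) {w w' : Q}, Γ.Adj w w' → Γ.Adj (g • w) (g • w'))
    (hk : ∀ w, (Γ.neighborSet w).encard ≤ k) : Nonempty (Mean G Γ (k + 1)) := by
  let P : ℕ → Set (Q → Fin (k + 1)) → ℝ := fun N E =>
    (labelMeasure Q N).real {ℓ | greedy Γ k ℓ (N + 1) ∈ E}
  have hlim : ∀ E, ∃ x, 0 ≤ x ∧ Tendsto (fun N => P N E) (hyperfilter ℕ : Filter ℕ) (𝓝 x) := by
    intro E
    obtain ⟨x, hx, h⟩ := (isCompact_Icc (a := (0 : ℝ)) (b := 1)).ultrafilter_le_nhds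
      ((hyperfilter ℕ).map fun N : ℕ => P N E)
      (le_principal_iff.2 (Ultrafilter.mem_map.2 <| univ_mem' fun N : ℕ =>
        (⟨measureReal_nonneg, measureReal_le_one⟩ : P N E ∈ Set.Icc (0 : ℝ) 1)))
    exact ⟨x, hx.1, h⟩
  choose m hm0 hm using hlim
  refine ⟨⟨m, hm0, ?_, ?_, ?_, ?_⟩⟩
  · refine tendsto_nhds_unique (hm _) ?_
    have : (fun N => P N Set.univ) = fun _ => 1 := by
      funext N; simp [P]
    rw [this]
    exact tendsto_const_nhds
  · intro E E' hE hE' hd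
    refine tendsto_nhds_unique (hm _) (((hm E).add (hm E')).congr fun N => ?_)
    refine (measureReal_union (μ := labelMeasure Q N)
      (s₁ := {ℓ | greedy Γ k ℓ (N + 1) ∈ E}) (s₂ := {ℓ | greedy Γ k ℓ (N + 1) ∈ E'})
      (Set.disjoint_left.2 fun ℓ h h' => Set.disjoint_left.1 hd h h')
      (finitary_greedy_preimage hk hE').measurableSet).symm
  · intro g E hE
    refine tendsto_nhds_unique (hm _) ((hm E).congr fun N => ?_)
    have h := labelMeasure_smul N g (finitary_greedy_preimage (N := N + 1) hk hE).measurableSet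
    simp only [P, Measure.real]
    rw [← h]
    congr 2
    ext ℓ
    change greedy Γ k (fun v => ℓ (g • v)) (N + 1) ∈ E ↔
      (fun w => greedy Γ k ℓ (N + 1) (g • w)) ∈ E
    rw [show greedy Γ k (fun v => ℓ (g • v)) (N + 1) = fun w => greedy Γ k ℓ (N + 1) (g • w) from
      funext fun w => greedy_smul hG g ℓ (N + 1) w]
  · intro w w' h
    refine le_antisymm ?_ (hm0 _)
    have hlim : Tendsto (fun N : ℕ => 1 / ((N : ℝ) + 1)) (hyperfilter ℕ : Filter ℕ) (𝓝 0) :=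
      tendsto_one_div_add_atTop_nhds_zero_nat.mono_left Nat.hyperfilter_le_atTop
    refine le_of_tendsto_of_tendsto' (hm _) hlim fun N => ?_
    refine (measureReal_mono ?_).trans (labelMeasure_eq_le N h.ne)
    intro ℓ hℓ
    by_contra hne
    rcases lt_or_gt_of_ne hne with h' | h'
    · exact greedy_ne hk h.symm h' hℓ.symm
    · exact greedy_ne hk h h' hℓ

namespace Mean

variable {G : Type v} [Group G] [MulAction G Q] {Γ : SimpleGraph Q} {n : ℕ} (M : Mean G Γ n)

theorem m_empty : M.m ∅ = 0 := by
  have h : Finitary (∅ : Set (Q → Fin n)) := ⟨∅, fun _ _ _ h => h⟩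
  have := M.union h h (by simp)
  rw [Set.union_empty] at this
  linarith

theorem m_mono {E E' : Set (Q → Fin n)} (hE : Finitary E) (hE' : Finitary (E' \ E))
    (h : E ⊆ E') : M.m E ≤ M.m E' := by
  rw [← Set.union_sdiff_cancel h, M.union hE hE' Set.disjoint_sdiff_right]
  linarith [M.nonneg (E' \ E)]

/-- A finitary set is the disjoint union of the cylinders contained in it. -/
theorem m_eq_sum [DecidableEq Q] (F : Finset Q) {E : Set (Q → Fin n)}
    (hE : ∀ c c' : Q → Fin n, (∀ w ∈ F, c w = c' w) → c ∈ E → c' ∈ E)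
    (ext : (F → Fin n) → Q → Fin n) (hext : ∀ τ, F.restrict (ext τ) = τ) [DecidablePred (· ∈ E)] :
    M.m E = ∑ τ : F → Fin n, if ext τ ∈ E then M.m {c | F.restrict c = τ} else 0 := by
  have key : ∀ T : Finset (F → Fin n), M.m {c | F.restrict c ∈ T ∧ c ∈ E} =
      ∑ τ ∈ T, if ext τ ∈ E then M.m {c | F.restrict c = τ} else 0 := by
    intro T
    induction T using Finset.induction_on with
    | empty => simp [M.m_empty]
    | insert τ T hτ ih =>
      have hfin : ∀ S : Set (F → Fin n), Finitary {c : Q → Fin n | F.restrict c ∈ S ∧ c ∈ E} := by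
        intro S
        refine ⟨F, fun c c' h hc => ⟨?_, hE c c' h hc.2⟩⟩
        rw [show F.restrict c' = F.restrict c from funext fun w => (h w.1 w.2).symm]
        exact hc.1
      have h1 : {c : Q → Fin n | F.restrict c ∈ insert τ T ∧ c ∈ E} =
          {c : Q → Fin n | F.restrict c ∈ ({τ} : Set (F → Fin n)) ∧ c ∈ E} ∪
            {c : Q → Fin n | F.restrict c ∈ (T : Set (F → Fin n)) ∧ c ∈ E} := by
        ext c
        simp only [Finset.mem_insert, Set.mem_ofPred_eq, Set.mem_union, Set.mem_singleton_iff,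
          Finset.mem_coe]
        tauto
      rw [h1, M.union (hfin _) (hfin _), Finset.sum_insert hτ]
      · congr 1
        split_ifs with h
        · congr 1
          ext c
          refine ⟨fun hc => hc.1, fun hc => ⟨hc, hE _ c (fun w hw => ?_) h⟩⟩
          exact congrFun ((hext τ).trans (Eq.symm hc)) ⟨w, hw⟩
        · convert M.m_empty
          rw [Set.eq_empty_iff_forall_notMem]
          rintro c ⟨hc, hcE⟩
          exact h (hE c _ (fun w hw => congrFun (Eq.trans hc (hext τ).symm) ⟨w, hw⟩) hcE)
      · rw [Set.disjoint_left]
        rintro c ⟨h1, -⟩ ⟨h2, -⟩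
        exact hτ (by rw [← show F.restrict c = τ from h1]; exact h2)
  simpa using key Finset.univ

end Mean

end Mean

/-- A partial proper colouring extends to a proper colouring. -/
theorem exists_extension {Γ : SimpleGraph Q} {k : ℕ} (hk : ∀ w, (Γ.neighborSet w).encard ≤ k)
    (S : Set Q) (c₀ : Q → Fin (k + 1))
    (h₀ : ∀ w ∈ S, ∀ w' ∈ S, Γ.Adj w w' → c₀ w ≠ c₀ w') :
    ∃ c : Q → Fin (k + 1), (∀ w ∈ S, c w = c₀ w) ∧ ∀ w w', Γ.Adj w w' → c w ≠ c w' := by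
  classical
  -- Transfinite greedy colouring outside `S`: avoid the colours of the neighbours in `S`, treated
  -- as coloured beforehand, and of the earlier neighbours outside `S`.
  let step : ∀ w : Q, (∀ v, WellOrderingRel v w → Fin (k + 1)) → Fin (k + 1) := fun w r =>
    if w ∈ S then c₀ w else
      pick {a | ∃ v, Γ.Adj w v ∧ ((v ∈ S ∧ c₀ v = a) ∨
        ∃ h : WellOrderingRel v w, v ∉ S ∧ r v h = a)}
  let c : Q → Fin (k + 1) := IsWellFounded.fix WellOrderingRel step
  have hc : ∀ w, c w = if w ∈ S then c₀ w else
      pick {a | ∃ v, Γ.Adj w v ∧ ((v ∈ S ∧ c₀ v = a) ∨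
        ∃ _ : WellOrderingRel v w, v ∉ S ∧ c v = a)} :=
    fun w => IsWellFounded.fix_eq WellOrderingRel step w
  have hS : ∀ w ∈ S, c w = c₀ w := fun w hw => by rw [hc, if_pos hw]
  have key : ∀ w v, Γ.Adj w v → w ∉ S → (v ∈ S ∨ WellOrderingRel v w) → c w ≠ c v := by
    intro w v hwv hw hv
    rw [hc w, if_neg hw]
    set A := {a | ∃ v, Γ.Adj w v ∧ ((v ∈ S ∧ c₀ v = a) ∨
      ∃ _ : WellOrderingRel v w, v ∉ S ∧ c v = a)}
    have hA : A.encard ≤ k := by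
      refine le_trans (Set.encard_le_encard (t := c '' Γ.neighborSet w) ?_)
        ((Set.encard_image_le _ _).trans (hk w))
      rintro a ⟨v, hv, ⟨h1, rfl⟩ | ⟨_, -, rfl⟩⟩
      · exact ⟨v, hv, hS v h1⟩
      · exact ⟨v, hv, rfl⟩
    intro he
    refine pick_notMem hA (he ▸ ⟨v, hwv, ?_⟩)
    by_cases hvS : v ∈ S
    · exact Or.inl ⟨hvS, (hS v hvS).symm⟩
    · exact Or.inr ⟨hv.resolve_left hvS, hvS, rfl⟩
  refine ⟨c, hS, fun w v h => ?_⟩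
  by_cases hw : w ∈ S
  · by_cases hv : v ∈ S
    · rw [hS w hw, hS v hv]; exact h₀ w hw v hv h
    · exact (key v w h.symm hv (Or.inl hw)).symm
  · by_cases hv : v ∈ S
    · exact key w v h hw (Or.inl hv)
    · rcases trichotomous_of WellOrderingRel w v with h' | h' | h'
      · exact (key v w h.symm hv (Or.inr h')).symm
      · exact absurd h' h.ne
      · exact key w v h hw (Or.inr h')

end RandomColouring

/-! ### Integer solutions of integer linear equations -/

/-- Finitely many positive reals are mapped to positive rationals by some `ℚ`-linear functional
on their span. -/
theorem exists_linearMap_pos {ι : Type*} [Finite ι] (a : ι → ℝ) :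
    ∃ ρ : Submodule.span ℚ (Set.range a) →ₗ[ℚ] ℚ,
      ∀ i, 0 < a i → 0 < ρ ⟨a i, Submodule.subset_span ⟨i, rfl⟩⟩ := by
  classical
  let U := Submodule.span ℚ (Set.range a)
  have : FiniteDimensional ℚ U := FiniteDimensional.span_of_finite ℚ (Set.finite_range a)
  let b := Module.finBasis ℚ U
  let x : ι → U := fun i => ⟨a i, Submodule.subset_span ⟨i, rfl⟩⟩
  -- Values on the basis `b` that make a functional positive where required: finitely many open
  -- conditions. The inclusion of `U` into `ℝ` satisfies them, and rational vectors are dense.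
  let O : Set (Fin (Module.finrank ℚ U) → ℝ) :=
    {r | ∀ i, 0 < a i → 0 < ∑ l, (b.repr (x i) l : ℝ) * r l}
  have hO : IsOpen O := by
    have : O = ⋂ i, ⋂ _ : 0 < a i, {r | 0 < ∑ l, (b.repr (x i) l : ℝ) * r l} := by
      ext r; simp [O]
    rw [this]
    refine isOpen_iInter_of_finite fun i => isOpen_iInter_of_finite fun _ => ?_
    exact isOpen_lt continuous_const (by fun_prop)
  have hne : O.Nonempty := by
    refine ⟨fun l => (b l : ℝ), fun i hi => ?_⟩
    have h := congrArg (Subtype.val : U → ℝ) (b.sum_repr (x i))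
    rw [AddSubmonoidClass.coe_finsetSum] at h
    simp only [Submodule.coe_smul, Rat.smul_def] at h
    rw [h]
    exact hi
  obtain ⟨r, hr⟩ := (DenseRange.piMap fun _ : Fin (Module.finrank ℚ U) =>
    Rat.denseRange_cast (𝕜 := ℝ)).exists_mem_open hO hne
  refine ⟨b.constr ℚ r, fun i hi => ?_⟩
  have h := hr i hi
  rw [Module.Basis.constr_apply_fintype]
  simp only [Pi.map_apply] at h
  have h2 : (0 : ℝ) < ((∑ l, b.equivFun (x i) l • r l : ℚ) : ℝ) := by
    push_cast [smul_eq_mul]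
    exact h
  exact_mod_cast h2

/-- A non-negative real solution of homogeneous linear equations with integer coefficients gives
rise to a natural solution with the same support. -/
theorem exists_nat_solution {ι L : Type*} [Fintype ι] (a : ι → ℝ) (ha : ∀ i, 0 ≤ a i)
    (v : L → ι → ℤ) (h : ∀ l, ∑ i, a i * v l i = 0) :
    ∃ n : ι → ℕ, (∀ i, n i ≠ 0 ↔ a i ≠ 0) ∧ ∀ l, ∑ i, (n i : ℤ) * v l i = 0 := by
  classical
  obtain ⟨ρ, hρ⟩ := exists_linearMap_pos a
  let U := Submodule.span ℚ (Set.range a)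
  let x : ι → U := fun i => ⟨a i, Submodule.subset_span ⟨i, rfl⟩⟩
  -- Being `ℚ`-linear, `ρ` carries the real relations to relations among the `q i`, and positivity
  -- keeps the support. The product of the denominators then clears them all.
  let q : ι → ℚ := fun i => ρ (x i)
  have hq0 : ∀ i, a i = 0 → q i = 0 := by
    intro i hi
    have : x i = 0 := Subtype.ext hi
    simp only [q, this, map_zero]
  have hq1 : ∀ i, a i ≠ 0 → 0 < q i := fun i hi => hρ i (lt_of_le_of_ne (ha i) hi.symm)
  have hq2 : ∀ i, 0 ≤ q i := fun i => by
    by_cases hi : a i = 0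
    · rw [hq0 i hi]
    · exact (hq1 i hi).le
  have hq : ∀ l, ∑ i, q i * v l i = 0 := by
    intro l
    have h1 : ∑ i, (v l i : ℚ) • x i = 0 := by
      apply Subtype.ext
      rw [AddSubmonoidClass.coe_finsetSum]
      simp only [Submodule.coe_smul, Rat.smul_def]
      refine Eq.trans ?_ (h l)
      refine Finset.sum_congr rfl fun i _ => ?_
      rw [mul_comm]
      push_cast
      rfl
    have h2 := congrArg ρ h1
    rw [map_sum, map_zero] at h2
    rw [← h2]
    refine Finset.sum_congr rfl fun i _ => ?_
    rw [map_smul, smul_eq_mul, mul_comm]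
  let D : ℕ := ∏ i, (q i).den
  have hD : D ≠ 0 := Finset.prod_ne_zero_iff.2 fun i _ => (q i).den_nz
  have hint : ∀ i, ∃ n : ℕ, (n : ℚ) = D * q i := by
    intro i
    obtain ⟨d, hd⟩ : (q i).den ∣ D := Finset.dvd_prod_of_mem _ (Finset.mem_univ i)
    refine ⟨d * (q i).num.toNat, ?_⟩
    have h1 : ((q i).num.toNat : ℚ) = (q i).num := by
      exact_mod_cast Int.toNat_of_nonneg (Rat.num_nonneg.2 (hq2 i))
    have h2 : ((q i).den : ℚ) * q i = (q i).num := Rat.den_mul_eq_num (q i)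
    rw [hd]
    push_cast
    rw [h1, ← h2]
    ring
  choose n hn using hint
  have hDQ : (D : ℚ) ≠ 0 := by exact_mod_cast hD
  refine ⟨n, fun i => ?_, fun l => ?_⟩
  · have : n i ≠ 0 ↔ q i ≠ 0 := by
      rw [← Nat.cast_ne_zero (R := ℚ), hn]
      simp [hD]
    rw [this]
    exact ⟨fun h h' => h (hq0 i h'), fun h => (hq1 i h).ne'⟩
  · have : ((∑ i, (n i : ℤ) * v l i : ℤ) : ℚ) = 0 := by
      push_cast
      simp only [hn, mul_assoc]
      rw [← Finset.mul_sum, hq, mul_zero]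
    exact_mod_cast this

/-! ### Counting edges with a given local colouring -/

section Nearby

variable {Q : Type u} (Γ : SimpleGraph Q)

/-- The closed ball of radius `r` about `w`. -/
def nearby (r : ℕ) (w : Q) : Set Q := {w' | ∃ p : Γ.Walk w w', p.length ≤ r}

variable {Γ}

theorem self_mem_nearby (r : ℕ) (w : Q) : w ∈ nearby Γ r w := ⟨.nil, by simp⟩

theorem nearby_mono {r s : ℕ} (h : r ≤ s) (w : Q) : nearby Γ r w ⊆ nearby Γ s w :=
  fun _ ⟨p, hp⟩ => ⟨p, hp.trans h⟩

theorem finite_nearby (hfin : ∀ w, (Γ.neighborSet w).Finite) (r : ℕ) (w : Q) :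
    (nearby Γ r w).Finite := by
  induction r generalizing w with
  | zero =>
    refine (Set.finite_singleton w).subset ?_
    rintro w' ⟨p, hp⟩
    exact (SimpleGraph.Walk.eq_of_length_eq_zero (Nat.le_zero.1 hp)).symm
  | succ r ih =>
    refine ((Set.finite_singleton w).union ((hfin w).biUnion fun v _ => ih v)).subset ?_
    rintro w' ⟨p, hp⟩
    cases p with
    | nil => exact Or.inl rfl
    | cons h p =>
      exact Or.inr (Set.mem_biUnion h ⟨p, by simpa using hp⟩)

theorem smul_mem_nearby {G : Type v} [Group G] [MulAction G Q]
    (hG : ∀ (g : G) {w w' : Q}, Γ.Adj w w' → Γ.Adj (g • w) (g • w')) {r : ℕ} {w w' : Q}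
    (h : w' ∈ nearby Γ r w) (g : G) : g • w' ∈ nearby Γ r (g • w) := by
  obtain ⟨p, hp⟩ := h
  exact ⟨p.map ⟨fun w => g • w, fun h => hG g h⟩, by simpa using hp⟩

end Nearby

namespace CubeComplex

open RandomColouring

/-! ### Matching edges and their expected number. -/

section Gluing

variable {V : Type u} {X : CubeComplex V} {G : Type v} [Group G] [MulAction G V]
  [X.IsCubicalAction G] {K : Subgroup G} {R : ℝ} {k : ℕ}

variable (X K) in
/-- The wall of the quotient dual to an edge. -/
abbrev qwall (e : X.Edge) : X.QWall K := X.toQWall K (X.wall e)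

/-- The class of `c` contains `c`, which gives agreement on the ball about the wall of `f`.
Conversely the centre lies in the ball, so both colourings prescribe the same radius. -/
theorem edgeClass_eq_iff {n : ℕ} {e f : X.Edge} {c c₀ : X.QWall K → ℕ}
    (hc : c ∈ colourings (X.wallGraph K R) n) :
    X.edgeClass K R n e c = X.edgeClass K R n f c₀ ↔
      e = f ∧ ∀ w ∈ nearby (X.wallGraph K R) (c₀ (X.qwall K f)) (X.qwall K f), c w = c₀ w := by
  constructor
  · intro h
    have h1 : (e, c) ∈ X.edgeClass K R n f c₀ := by
      rw [← h]
      exact ⟨rfl, hc, fun _ _ => rfl⟩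
    exact ⟨h1.1, h1.2.2⟩
  · rintro ⟨rfl, h⟩
    have h0 : c (X.qwall K e) = c₀ (X.qwall K e) := h _ (self_mem_nearby _ _)
    ext ⟨e', c'⟩
    constructor
    · rintro ⟨h1, h2, h3⟩
      refine ⟨h1, h2, fun w hw => (h3 w ?_).trans (h w hw)⟩
      change ∃ p : (X.wallGraph K R).Walk _ w, p.length ≤ c (X.qwall K e)
      rw [h0]
      exact hw
    · rintro ⟨h1, h2, h3⟩
      refine ⟨h1, h2, fun w hw => ?_⟩
      change ∃ p : (X.wallGraph K R).Walk _ w, p.length ≤ c (X.qwall K e) at hw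
      rw [h0] at hw
      exact (h3 w hw).trans (h w hw).symm

variable [K.Normal]

theorem smul_qwall (g : G) (e : X.Edge) : g • X.qwall K e = X.qwall K (g • e) := rfl

theorem smul_mem_edge {g : G} {x : V} {e : X.Edge} : g • x ∈ (g • e).1 ↔ x ∈ e.1 :=
  Set.smul_mem_smul_set_iff

/-- A function with values in `Fin n`, with colours renamed to `1, …, n`. -/
def toColouring {Q : Type*} {n : ℕ} (c : Q → Fin n) : Q → ℕ := fun w => c w + 1

theorem toColouring_mem {Q : Type*} {n : ℕ} {Γ : SimpleGraph Q} {c : Q → Fin n}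
    (h : ∀ w w', Γ.Adj w w' → c w ≠ c w') : toColouring c ∈ colourings Γ n :=
  ⟨fun w => ⟨Nat.le_add_left 1 _, (c w).2⟩, fun w w' hw he =>
    h w w' hw (Fin.ext (Nat.succ_injective he))⟩

theorem colouringSMul_mem {n : ℕ} {c : X.QWall K → ℕ}
    (h : c ∈ colourings (X.wallGraph K R) n) (g : G) :
    colouringSMul g c ∈ colourings (X.wallGraph K R) n :=
  ⟨fun _ => h.1 _, fun _ _ hw => h.2 _ _ (wallGraph_adj_smul K g⁻¹ hw)⟩

variable (R k) in
/-- The functions that agree with `c₀` near the wall dual to `f`. -/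
def agreeSet (f : X.Edge) (c₀ : X.QWall K → ℕ) : Set (X.QWall K → Fin (k + 1)) :=
  {c | ∀ w ∈ nearby (X.wallGraph K R) (c₀ (X.qwall K f)) (X.qwall K f), toColouring c w = c₀ w}

variable (R k) in
/-- The functions that agree with a translate of `c₀` by an element that stabilises `f`. -/
def stabAgreeSet (f : X.Edge) (c₀ : X.QWall K → ℕ) : Set (X.QWall K → Fin (k + 1)) :=
  {c | ∃ s : G, s • f = f ∧ (fun w => c (s⁻¹ • w)) ∈ agreeSet R k f c₀}

variable (R) in
/-- The edges `e` that some `g` with `g x = y` carries to `f`, so that `g c` agrees with `c₀` near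
the wall dual to `f`. -/
def matchEdges (x y : V) (f : X.Edge) (c₀ : X.QWall K → ℕ) (c : X.QWall K → Fin (k + 1)) :
    Set X.Edge :=
  {e | ∃ g : G, g • e = f ∧ g • x = y ∧ (fun w => c (g⁻¹ • w)) ∈ agreeSet R k f c₀}

variable {x y : V} {f : X.Edge} {c₀ : X.QWall K → ℕ}

theorem matchEdges_subset (hy : y ∈ f.1) (c : X.QWall K → Fin (k + 1)) :
    matchEdges R x y f c₀ c ⊆ {e | x ∈ e.1} := by
  rintro e ⟨g, rfl, rfl, -⟩
  exact smul_mem_edge.1 hy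

/-- Translation by `g⁻¹` takes the relevant ball to one about the wall of an edge at `x`; its radius
is a colour, hence at most `k + 1`, and `F` contains it. -/
theorem agreeSet_congr {F : Finset (X.QWall K)}
    (hF : ∀ e : X.Edge, x ∈ e.1 → nearby (X.wallGraph K R) (k + 1) (X.qwall K e) ⊆ F)
    (hy : y ∈ f.1) (hc₀ : c₀ ∈ colourings (X.wallGraph K R) (k + 1)) {g : G} (hg : g • x = y)
    {c c' : X.QWall K → Fin (k + 1)} (h : ∀ w ∈ F, c w = c' w)
    (hc : (fun w => c (g⁻¹ • w)) ∈ agreeSet R k f c₀) :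
    (fun w => c' (g⁻¹ • w)) ∈ agreeSet R k f c₀ := by
  intro w hw
  rw [← hc w hw]
  simp only [toColouring]
  rw [h (g⁻¹ • w)]
  refine hF (g⁻¹ • f) ?_ ?_
  · rw [← hg] at hy
    rw [← smul_mem_edge (g := g), smul_inv_smul]
    exact hy
  · rw [← smul_qwall]
    exact smul_mem_nearby (wallGraph_adj_smul K) (nearby_mono (hc₀.1 _).2 _ hw) g⁻¹

theorem stabAgreeSet_congr {F : Finset (X.QWall K)}
    (hF : ∀ e : X.Edge, x ∈ e.1 → nearby (X.wallGraph K R) (k + 1) (X.qwall K e) ⊆ F)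
    (hy : y ∈ f.1) (hs : ∀ s : G, s • f = f → s • y = y)
    (hc₀ : c₀ ∈ colourings (X.wallGraph K R) (k + 1)) {g : G} (hg : g • x = y)
    {c c' : X.QWall K → Fin (k + 1)} (h : ∀ w ∈ F, c w = c' w)
    (hc : (fun w => c (g⁻¹ • w)) ∈ stabAgreeSet R k f c₀) :
    (fun w => c' (g⁻¹ • w)) ∈ stabAgreeSet R k f c₀ := by
  obtain ⟨s, hsf, hc⟩ := hc
  refine ⟨s, hsf, ?_⟩
  have key := agreeSet_congr (g := s * g) hF hy hc₀ (by rw [mul_smul, hg, hs s hsf]) h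
  simp only [mul_inv_rev, mul_smul] at key
  exact key hc

theorem matchEdges_congr {F : Finset (X.QWall K)}
    (hF : ∀ e : X.Edge, x ∈ e.1 → nearby (X.wallGraph K R) (k + 1) (X.qwall K e) ⊆ F)
    (hy : y ∈ f.1) (hc₀ : c₀ ∈ colourings (X.wallGraph K R) (k + 1))
    {c c' : X.QWall K → Fin (k + 1)} (h : ∀ w ∈ F, c w = c' w) :
    matchEdges R x y f c₀ c = matchEdges R x y f c₀ c' := by
  ext e
  constructor
  · rintro ⟨g, h1, h2, h3⟩
    exact ⟨g, h1, h2, agreeSet_congr hF hy hc₀ h2 h h3⟩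
  · rintro ⟨g, h1, h2, h3⟩
    exact ⟨g, h1, h2, agreeSet_congr hF hy hc₀ h2 (fun w hw => (h w hw).symm) h3⟩

/-- Choose for each matching edge `e` an element `γ e` that carries it to `f`. Then `(e, s) ↦ s * γ
e` is a bijection onto the right-hand set, because the stabiliser of `f` fixes `y`. Counting group
elements instead of edges prepares the use of invariance. -/
theorem ncard_matchEdges_mul (hs : ∀ s : G, s • f = f → s • y = y)
    (c : X.QWall K → Fin (k + 1)) :
    (matchEdges R x y f c₀ c).ncard * {s : G | s • f = f}.ncard =
      {g : G | g • x = y ∧ (fun w => c (g⁻¹ • w)) ∈ stabAgreeSet R k f c₀}.ncard := by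
  rw [← Set.ncard_prod]
  choose! γ hγ using fun e (he : e ∈ matchEdges R x y f c₀ c) => he
  refine Set.ncard_congr (fun p _ => p.2 * γ p.1) ?_ ?_ ?_
  · rintro ⟨e, s⟩ ⟨he, hsf⟩
    obtain ⟨h1, h2, h3⟩ := hγ e he
    have hsf : s • f = f := hsf
    refine ⟨by rw [mul_smul, h2, hs s hsf], s⁻¹, by rw [inv_smul_eq_iff, hsf], ?_⟩
    simpa [mul_smul] using h3
  · rintro ⟨e, s⟩ ⟨e', s'⟩ ⟨he, hsf⟩ ⟨he', hsf'⟩ h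
    have h1 : (s * γ e) • e = f := by rw [mul_smul, (hγ e he).1]; exact hsf
    have h2 : (s' * γ e') • e' = f := by rw [mul_smul, (hγ e' he').1]; exact hsf'
    simp only at h
    rw [h] at h1
    obtain rfl : e = e' := MulAction.injective _ (h1.trans h2.symm)
    rw [mul_left_inj] at h
    rw [h]
  · rintro g ⟨hg, s, hsf, hc⟩
    have he : g⁻¹ • f ∈ matchEdges R x y f c₀ c := by
      refine ⟨s * g, by rw [mul_smul, smul_inv_smul, hsf], by rw [mul_smul, hg, hs s hsf], ?_⟩
      simpa [mul_smul] using hc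
    refine ⟨(g⁻¹ • f, g * (γ (g⁻¹ • f))⁻¹), ⟨he, ?_⟩, by simp⟩
    change (g * (γ (g⁻¹ • f))⁻¹) • f = f
    conv_lhs => rw [mul_smul]; arg 2; arg 2; rw [← (hγ _ he).1]
    rw [inv_smul_smul, smul_inv_smul]

open Classical in
/-- The extension by `0` of a function on a finite set. -/
noncomputable def extendZero {Q : Type*} {n : ℕ} [NeZero n] (F : Finset Q) (τ : F → Fin n) :
    Q → Fin n :=
  fun w => if h : w ∈ F then τ ⟨w, h⟩ else 0

theorem restrict_extendZero {Q : Type*} {n : ℕ} [NeZero n] (F : Finset Q) (τ : F → Fin n) :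
    F.restrict (extendZero F τ) = τ := by
  funext w
  simp [extendZero]

/-- The expected number of matching edges. -/
theorem sum_m_mul_ncard_matchEdges [DecidableEq (X.QWall K)]
    (M : Mean G (X.wallGraph K R) (k + 1)) {F F' : Finset (X.QWall K)}
    (hF : ∀ e : X.Edge, x ∈ e.1 → nearby (X.wallGraph K R) (k + 1) (X.qwall K e) ⊆ F)
    (hF' : ∀ e : X.Edge, y ∈ e.1 → nearby (X.wallGraph K R) (k + 1) (X.qwall K e) ⊆ F')
    (hy : y ∈ f.1) (hs : ∀ s : G, s • f = f → s • y = y)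
    (hc₀ : c₀ ∈ colourings (X.wallGraph K R) (k + 1)) (hfin : {g : G | g • x = y}.Finite) :
    (∑ τ : F → Fin (k + 1), M.m {c | F.restrict c = τ} *
      (matchEdges R x y f c₀ (extendZero F τ)).ncard) * {s : G | s • f = f}.ncard =
      {g : G | g • x = y}.ncard * M.m (stabAgreeSet R k f c₀) := by
  classical
  -- By invariance of the mean every `g` with `g • x = y` contributes the same amount.
  have h1 : ∀ g ∈ hfin.toFinset, ∑ τ : F → Fin (k + 1),
      (if (fun w => extendZero F τ (g⁻¹ • w)) ∈ stabAgreeSet R k f c₀ then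
        M.m {c | F.restrict c = τ} else 0) = M.m (stabAgreeSet R k f c₀) := by
    intro g hg
    have hg : g • x = y := by simpa using hg
    rw [← M.smul g⁻¹ (E := stabAgreeSet R k f c₀)]
    · refine (M.m_eq_sum F (E := {c | (fun w => c (g⁻¹ • w)) ∈ stabAgreeSet R k f c₀}) ?_
        (extendZero F) (restrict_extendZero F)).symm
      exact fun c c' h hc => stabAgreeSet_congr hF hy hs hc₀ hg h hc
    · refine ⟨F', fun c c' h hc => ?_⟩
      have := stabAgreeSet_congr (g := (1 : G)) hF' hy hs hc₀ (one_smul G y) h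
      simp only [inv_one, one_smul] at this
      exact this hc
  have h2 : ∀ τ : F → Fin (k + 1), ((matchEdges R x y f c₀ (extendZero F τ)).ncard : ℝ) *
      {s : G | s • f = f}.ncard = ∑ g ∈ hfin.toFinset,
        if (fun w => extendZero F τ (g⁻¹ • w)) ∈ stabAgreeSet R k f c₀ then 1 else 0 := by
    intro τ
    have h := ncard_matchEdges_mul (R := R) (x := x) (c₀ := c₀) hs (extendZero F τ)
    rw [← Nat.cast_mul, h, Finset.sum_boole, ← Set.ncard_coe_finset]
    congr 2
    ext g
    simp
  rw [Finset.sum_mul]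
  simp only [mul_assoc, h2, Finset.mul_sum, mul_ite, mul_one, mul_zero]
  rw [Finset.sum_comm, Finset.sum_congr rfl h1, Finset.sum_const, nsmul_eq_mul,
    Set.ncard_eq_toFinset_card _ hfin]

end Gluing


open RandomColouring

/-! ### The gluing equations for vertex stars -/

section VertexStars

variable {V : Type u} {X : CubeComplex V} {G : Type v} [Group G] [MulAction G V]
  [X.IsCubicalAction G] {K : Subgroup G} [K.Normal] {R : ℝ} {k : ℕ}

/-- An edge has exactly one endpoint on each side of the wall dual to it. -/
theorem SideLabelling.exists_ends (σ : X.SideLabelling G) (hX : X.IsCAT0) (f : X.Edge) :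
    ∃ a b, f.1 = {a, b} ∧ a ∈ σ.plus (X.wall f) ∧ b ∉ σ.plus (X.wall f) ∧
      b ∈ σ.minus (X.wall f) ∧ a ∉ σ.minus (X.wall f) := by
  obtain ⟨a, b, hf⟩ := f.exists_eq
  have hD : X.Dual (X.wall f) a b := ⟨f, hf, rfl⟩
  have hcar : ∀ x ∈ f.1, x ∈ X.carrier (X.wall f) := fun x hx =>
    ⟨f.1, ⟨f.2.1, f, subset_rfl, rfl⟩, hx⟩
  have ha := (σ.isSide_iff (X.wall f) _).1 ⟨a, hcar a (by rw [hf]; simp), rfl⟩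
  have hb := (σ.isSide_iff (X.wall f) _).1 ⟨b, hcar b (by rw [hf]; simp), rfl⟩
  have haa : a ∈ X.carrierSide (X.wall f) a := Relation.ReflTransGen.refl
  have hbb : b ∈ X.carrierSide (X.wall f) b := Relation.ReflTransGen.refl
  have hba : b ∉ X.carrierSide (X.wall f) a := fun h =>
    hX.notMem_sideOf hD (carrierSide_subset_sideOf _ _ h)
  have hab : a ∉ X.carrierSide (X.wall f) b := fun h =>
    hX.notMem_sideOf hD.symm (carrierSide_subset_sideOf _ _ h)
  rcases ha with ha | ha <;> rcases hb with hb | hb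
  · rw [ha, ← hb] at hba; exact absurd hbb hba
  · exact ⟨a, b, hf, ha ▸ haa, ha ▸ hba, hb ▸ hbb, hb ▸ hab⟩
  · exact ⟨b, a, hf.trans (Set.pair_comm _ _), hb ▸ hbb, hb ▸ hab, ha ▸ haa, ha ▸ hba⟩
  · rw [ha, ← hb] at hba; exact absurd hbb hba

/-- The equivariant side labelling excludes inversions: an element that stabilises `f` cannot
exchange its ends. -/
theorem smul_eq_of_smul_edge_eq {side : X.Wall → Set V}
    (hside : ∀ (g : G) (W : X.Wall), side (g • W) = g • side W) {f : X.Edge} {y y' : V}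
    (hf : f.1 = {y, y'}) (hy : y ∈ side (X.wall f)) (hy' : y' ∉ side (X.wall f)) {s : G}
    (hs : s • f = f) : s • y = y := by
  have h1 : s • y ∈ (s • f).1 := smul_mem_edge.2 (by rw [hf]; simp)
  have h2 : s • y ∈ side (X.wall f) := by
    have : s • X.wall f = X.wall f := congrArg X.wall hs
    rw [← this, hside]
    exact Set.smul_mem_smul_set hy
  rw [hs, hf] at h1
  rcases h1 with h1 | h1
  · exact h1
  · rw [Set.mem_singleton_iff.1 h1] at h2; exact absurd h2 hy'

variable (K) in
/-- The triple of a vertex and a colouring. -/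
def starTriple (x : V) (c : X.QWall K → Fin (k + 1)) : X.Triple K :=
  ⟨X.vertexStar x, ⊥, fun _ => toColouring c⟩

theorem starTriple_isValid (hX : X.IsCAT0) {x : V} (hfin : {C ∈ X.cubes | x ∈ C}.Finite)
    {c : X.QWall K → Fin (k + 1)} (hc : toColouring c ∈ colourings (X.wallGraph K R) (k + 1)) :
    (starTriple K x c).IsValid R (k + 1) where
  nonempty := ⟨_, vertexPt_mem_vertexStar x⟩
  isInter := ⟨_, fun _ hS => hS.1, rfl⟩
  free := by
    refine ⟨fun h hh => ?_, fun h hh _ _ _ => Subgroup.mem_bot.1 hh⟩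
    rw [Subgroup.mem_bot.1 hh, one_smul]
  cocompact := by
    refine ⟨fun h hh => ?_, _, hX.isCompact_vertexStar hfin, subset_rfl, fun p hp => ?_⟩
    · rw [Subgroup.mem_bot.1 hh, one_smul]
    · exact Set.mem_biUnion (Subgroup.mem_bot.2 rfl) (by rw [one_smul]; exact hp)
  colouring := fun _ _ => hc
  equivariant := by
    intro h hh x _
    obtain rfl := Subgroup.mem_bot.1 hh
    funext w
    simp [colouringSMul, starTriple]

theorem orbit_bot {α : Type*} [MulAction G α] (a : α) :
    MulAction.orbit (⊥ : Subgroup G) a = {a} := by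
  refine Set.eq_singleton_iff_unique_mem.2 ⟨MulAction.mem_orbit_self a, ?_⟩
  rintro _ ⟨⟨g, hg⟩, rfl⟩
  obtain rfl := Subgroup.mem_bot.1 hg
  exact one_smul G a

/-- The only vertex of a translated star is `g • x i`, so lying on the chosen side means `g • x i =
y`. Orbits of the trivial group are single edges, so the set is a disjoint union of sets of matching
edges. -/
theorem encard_gluingSet (hX : X.IsCAT0) {m : ℕ} {x : Fin m → V}
    (hfin : ∀ i, {e : X.Edge | x i ∈ e.1}.Finite) {c : Fin m → X.QWall K → Fin (k + 1)}
    (hc : ∀ i, toColouring (c i) ∈ colourings (X.wallGraph K R) (k + 1))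
    {side : X.Wall → Set V} {f : X.Edge} {y y' : V} (hf : f.1 = {y, y'})
    (hy : y ∈ side (X.wall f)) (hy' : y' ∉ side (X.wall f)) (c₀ : X.QWall K → ℕ) :
    (X.gluingSet K R (k + 1) (fun i => starTriple K (x i) (c i)) side f c₀).encard =
      ((∑ i, (matchEdges R (x i) y f c₀ (c i)).ncard : ℕ) : ℕ∞) := by
  have hyf : y ∈ f.1 := by rw [hf]; simp
  have hM : ∀ i, (matchEdges R (x i) y f c₀ (c i)).Finite := fun i =>
    (hfin i).subset (matchEdges_subset hyf _)
  let F : (Σ i, matchEdges R (x i) y f c₀ (c i)) → Fin m × Set X.Edge := fun s => (s.1, {s.2.1})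
  have hF : Function.Injective F := by
    rintro ⟨i, e, he⟩ ⟨j, e', he'⟩ h
    simp only [F, Prod.mk.injEq, Set.singleton_eq_singleton_iff] at h
    obtain ⟨rfl, rfl⟩ := h
    rfl
  have hrange : X.gluingSet K R (k + 1) (fun i => starTriple K (x i) (c i)) side f c₀ =
      Set.range F := by
    ext ⟨i, S⟩
    constructor
    · rintro ⟨e, z, hz, hzZ, hS, g, ⟨p, ⟨q, hq, hqp⟩, ⟨v, hv, hvp⟩⟩, hcl⟩
      obtain rfl : z = x i := hX.vertexPt_mem_vertexStar_iff.1 hzZ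
      obtain ⟨h1, h2⟩ := (edgeClass_eq_iff (colouringSMul_mem (hc i) g)).1 hcl
      have hgx : g • x i = v := by
        have h3 : q = X.vertexPt (g⁻¹ • v) := by
          rw [← smul_vertexPt, hvp, ← hqp]
          exact (inv_smul_smul g q).symm
        have h4 : g⁻¹ • v = x i := hX.vertexPt_mem_vertexStar_iff.1 (h3 ▸ hq)
        rw [← h4, smul_inv_smul]
      have hgy : g • x i = y := by
        have h5 : g • x i ∈ (g • e).1 := smul_mem_edge.2 hz
        rw [h1, hf] at h5
        rcases h5 with h5 | h5
        · exact h5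
        · rw [hgx] at h5
          exact absurd (Set.mem_singleton_iff.1 h5 ▸ hv) hy'
      refine ⟨⟨i, e, g, h1, hgy, h2⟩, Prod.ext rfl ?_⟩
      exact ((orbit_bot e).symm.trans hS.symm)
    · rintro ⟨⟨i, e, g, h1, h2, h3⟩, h⟩
      obtain ⟨rfl, rfl⟩ := Prod.mk.inj h
      refine ⟨e, x i, ?_, vertexPt_mem_vertexStar _, ?_, g, ?_, ?_⟩
      · rw [← smul_mem_edge (g := g), h1, h2]; exact hyf
      · exact (orbit_bot e).symm
      · refine ⟨X.vertexPt y, ⟨X.vertexPt (x i), vertexPt_mem_vertexStar _, ?_⟩, y, hy, rfl⟩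
        change g • X.vertexPt (x i) = _
        rw [smul_vertexPt, h2]
      · exact (edgeClass_eq_iff (colouringSMul_mem (hc i) g)).2 ⟨h1, h3⟩
  have : ∀ i, Finite (matchEdges R (x i) y f c₀ (c i)) := hM
  have hfinr : (Set.range F).Finite := Set.finite_range F
  rw [hrange, ← hfinr.cast_ncard_eq, ← Set.image_univ, Set.ncard_image_of_injective _ hF,
    Set.ncard_univ, Nat.card_sigma]
  rfl

/-- The transporters from the chosen representative of the orbit of `y` form a coset of its
stabiliser. -/
theorem sum_ncard_transporter [Fintype (MulAction.orbitRel.Quotient G V)]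
    (hproper : X.IsProperAction G) (y : V) :
    ∑ j : MulAction.orbitRel.Quotient G V, ({g : G | g • j.out = y}.ncard : ℝ) /
      {g : G | g • j.out = j.out}.ncard = 1 := by
  let j₀ : MulAction.orbitRel.Quotient G V := Quotient.mk (MulAction.orbitRel G V) y
  have hj : ∀ j : MulAction.orbitRel.Quotient G V, ∀ g : G, g • j.out = y → j = j₀ := by
    intro j g hg
    rw [← Quotient.out_eq j]
    exact (Quotient.sound (s := MulAction.orbitRel G V) ⟨g, hg⟩).symm
  rw [Finset.sum_eq_single j₀]
  · obtain ⟨g₀, hg₀⟩ : ∃ g : G, g • j₀.out = y := by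
      obtain ⟨g, hg⟩ := Quotient.exact (s := MulAction.orbitRel G V) (Quotient.out_eq j₀)
      exact ⟨g⁻¹, by rw [inv_smul_eq_iff]; exact hg.symm⟩
    have h1 : {g : G | g • j₀.out = y} = (g₀ * ·) '' {g : G | g • j₀.out = j₀.out} := by
      ext g
      constructor
      · intro hg
        refine ⟨g₀⁻¹ * g, ?_, by simp⟩
        change (g₀⁻¹ * g) • j₀.out = j₀.out
        rw [mul_smul, show g • j₀.out = y from hg, ← hg₀, inv_smul_smul]
      · rintro ⟨s, hs, rfl⟩
        change (g₀ * s) • j₀.out = y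
        rw [mul_smul, show s • j₀.out = j₀.out from hs, hg₀]
    rw [h1, Set.ncard_image_of_injective _ (mul_right_injective g₀), div_self]
    rw [Nat.cast_ne_zero]
    exact (Set.ncard_pos (finite_transporter hproper _ _)).2 ⟨1, one_smul G _⟩ |>.ne'
  · intro j _ hne
    rw [show {g : G | g • j.out = y} = ∅ from
      Set.eq_empty_iff_forall_notMem.2 fun g hg => hne (hj j g hg)]
    simp
  · simp

/-- A cylinder on which some edge within `F` is monochromatic lies in a null set, so `τ` is proper
on `F` and extends. -/
theorem Mean.exists_extension (M : Mean G (X.wallGraph K R) (k + 1))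
    (hk : ∀ w, ((X.wallGraph K R).neighborSet w).encard ≤ k) (F : Finset (X.QWall K))
    (τ : F → Fin (k + 1)) (hτ : M.m {c | F.restrict c = τ} ≠ 0) :
    ∃ c : X.QWall K → Fin (k + 1), toColouring c ∈ colourings (X.wallGraph K R) (k + 1) ∧
      ∀ w ∈ F, extendZero F τ w = c w := by
  have hext := restrict_extendZero F τ
  obtain ⟨c, hc, hc'⟩ := RandomColouring.exists_extension hk (F : Set (X.QWall K))
    (extendZero F τ) (by
      intro w hw w' hw' hadj he
      refine hτ (le_antisymm ?_ (M.nonneg _))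
      rw [← M.adj hadj]
      have hF : ∀ {d d' : X.QWall K → Fin (k + 1)}, (∀ w ∈ F, d w = d' w) →
          F.restrict d = F.restrict d' := fun h => funext fun w => h w.1 w.2
      refine M.m_mono ⟨F, fun d d' h hd => (hF h).symm.trans hd⟩ ⟨F, fun d d' h hd => ?_⟩ ?_
      · refine ⟨?_, fun h' => hd.2 ((hF h).trans h')⟩
        change d' w = d' w'
        rw [← h w hw, ← h w' hw']
        exact hd.1
      · intro d hd
        have hd : F.restrict d = F.restrict (extendZero F τ) := Eq.trans hd hext.symm
        have h1 := congrFun hd ⟨w, hw⟩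
        have h2 := congrFun hd ⟨w', hw'⟩
        exact h1.trans (he.trans h2.symm))
  exact ⟨c, toColouring_mem hc', fun w hw => (hc w hw).symm⟩

end VertexStars

end CubeComplex

/-! ### Assembly of the collection. -/

open CubeComplex RandomColouring in
theorem lemma7p1 {V : Type*} (X : CubeComplex V) (hX : X.IsCAT0)
    {G : Type*} [Group G] [MulAction G V] [X.IsCubicalAction G]
    (hG : IsHyperbolicGroup G) (hproper : X.IsProperAction G)
    (hcocompact : X.ActsCocompactlyOn (⊤ : Subgroup G) Set.univ)
    (σ : X.SideLabelling G)
    (K : Subgroup G) [K.Normal] (hK : X.ActsFreelyOn K Set.univ)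
    (R : ℝ) (hR : 1 < R)
    (k : ℕ) (hk : ∀ w, ((X.wallGraph K R).neighborSet w).encard ≤ k) :
    ∃ (m : ℕ) (T : Fin m → X.Triple K),
      X.IsGluingCollection K σ R (k + 1) (k + 1) T ∧
      ∀ i, ∃ x : V, (T i).Z = X.vertexStar x ∧ (T i).H = ⊥ := by
  classical
  have hcubes := finite_cubes_at hX hproper hcocompact
  have hedges := finite_edges_at hX hproper hcocompact
  have : Finite (MulAction.orbitRel.Quotient G V) := finite_vertex_orbits hX hcocompact
  have : Fintype (MulAction.orbitRel.Quotient G V) := Fintype.ofFinite _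
  obtain ⟨M⟩ := nonempty_mean (G := G) (fun g {_ _} h => wallGraph_adj_smul K (R := R) g h) hk
  have hloc : ∀ x : V, ∃ F : Finset (X.QWall K), ∀ e : X.Edge, x ∈ e.1 →
      nearby (X.wallGraph K R) (k + 1) (X.qwall K e) ⊆ F := by
    intro x
    have hfin := (hedges x).biUnion fun e _ => finite_nearby (Γ := X.wallGraph K R)
      (fun w => Set.finite_of_encard_le_coe (hk w)) (k + 1) (X.qwall K e)
    refine ⟨hfin.toFinset, fun e he w hw => ?_⟩
    rw [Set.Finite.coe_toFinset]
    exact Set.mem_biUnion he hw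
  choose F hF using hloc
  choose a b hab ha hb' hb ha' using σ.exists_ends hX
  let J := MulAction.orbitRel.Quotient G V
  let s : J → ℕ := fun j => {g : G | g • j.out = j.out}.ncard
  have hs : ∀ j, (s j : ℝ) ≠ 0 := fun j => by
    rw [Nat.cast_ne_zero]
    exact (Set.ncard_pos (finite_transporter hproper _ _)).2 ⟨1, one_smul G _⟩ |>.ne'
  let I := Σ j : J, (F j.out → Fin (k + 1))
  -- Dividing by the order of the stabiliser makes the transporter counts sum to one over the
  -- orbits.
  let α : I → ℝ := fun i => M.m {c | (F i.1.out).restrict c = i.2} / s i.1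
  let ν : (X.Edge → V) → X.Edge → (X.QWall K → ℕ) → I → ℕ := fun y f c₀ i =>
    (matchEdges R i.1.out (y f) f c₀ (extendZero _ i.2)).ncard
  have hmean : ∀ (y : X.Edge → V), (∀ f, y f ∈ f.1) → (∀ f (g : G), g • f = f → g • y f = y f) →
      ∀ f, ∀ c₀ ∈ colourings (X.wallGraph K R) (k + 1),
        (∑ i, α i * ν y f c₀ i) * {g : G | g • f = f}.ncard = M.m (stabAgreeSet R k f c₀) := by
    intro y hy hstab f c₀ hc₀
    have h1 := fun j : J => sum_m_mul_ncard_matchEdges M (hF j.out) (hF (y f)) (hy f) (hstab f) hc₀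
      (finite_transporter hproper j.out (y f))
    rw [Fintype.sum_sigma, Finset.sum_mul, ← one_mul (M.m _),
      ← sum_ncard_transporter hproper (y f), Finset.sum_mul]
    refine Finset.sum_congr rfl fun j _ => ?_
    rw [div_mul_eq_mul_div, ← h1 j, ← div_mul_eq_mul_div, Finset.sum_div]
    congr 1
    refine Finset.sum_congr rfl fun τ _ => ?_
    simp only [α, ν, s]
    ring
  have hplus : ∀ f (g : G), g • f = f → g • a f = a f := fun f g hg =>
    smul_eq_of_smul_edge_eq σ.smul_plus (hab f) (ha f) (hb' f) hg
  have hminus : ∀ f (g : G), g • f = f → g • b f = b f := fun f g hg =>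
    smul_eq_of_smul_edge_eq σ.smul_minus ((hab f).trans (Set.pair_comm _ _)) (hb f) (ha' f) hg
  have haf : ∀ f, a f ∈ f.1 := fun f => by rw [hab f]; simp
  have hbf : ∀ f, b f ∈ f.1 := fun f => by rw [hab f]; simp
  obtain ⟨N, hN, hNeq⟩ := exists_nat_solution α
    (fun i => div_nonneg (M.nonneg _) (Nat.cast_nonneg _))
    (fun (l : X.Edge × colourings (X.wallGraph K R) (k + 1)) i =>
      (ν a l.1 l.2 i : ℤ) - (ν b l.1 l.2 i : ℤ)) (by
    rintro ⟨f, c₀, hc₀⟩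
    have h1 := hmean a haf hplus f c₀ hc₀
    rw [← hmean b hbf hminus f c₀ hc₀] at h1
    have h2 : ({g : G | g • f = f}.ncard : ℝ) ≠ 0 := by
      rw [Nat.cast_ne_zero]
      refine ((Set.ncard_pos (s := {g : G | g • f = f}) ?_).2 ⟨1, one_smul G f⟩).ne'
      exact (finite_transporter hproper (a f) (a f)).subset fun g hg => hplus f g hg
    have h3 := mul_right_cancel₀ h2 h1
    push_cast
    simp only [mul_sub, Finset.sum_sub_distrib]
    linarith)
  -- Equality of supports gives each type that occurs positive mass, hence a proper extension. Types
  -- with `N i = 0` receive a dummy value.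
  have hext : ∀ i : I, ∃ c : X.QWall K → Fin (k + 1), N i ≠ 0 →
      toColouring c ∈ colourings (X.wallGraph K R) (k + 1) ∧
        ∀ w ∈ F i.1.out, extendZero _ i.2 w = c w := by
    intro i
    by_cases hi : N i = 0
    · exact ⟨fun _ => 0, fun h => absurd hi h⟩
    · have h1 : M.m {c | (F i.1.out).restrict c = i.2} ≠ 0 := fun h =>
        (hN i).1 hi (by simp only [α, h, zero_div])
      obtain ⟨c, hc⟩ := CubeComplex.Mean.exists_extension M hk _ _ h1
      exact ⟨c, fun _ => hc⟩
  choose c hc using hext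
  let E := Fintype.equivFin (Σ i : I, Fin (N i))
  let ix : Fin (Fintype.card (Σ i : I, Fin (N i))) → I := fun p => (E.symm p).1
  have hix : ∀ p, N (ix p) ≠ 0 := fun p h => by
    have := (E.symm p).2
    rw [show N (E.symm p).1 = 0 from h] at this
    exact this.elim0
  have hsum : ∀ u : I → ℕ, ∑ p, u (ix p) = ∑ i, N i * u i := by
    intro u
    rw [Equiv.sum_comp E.symm fun q => u q.1, Fintype.sum_sigma]
    simp
  have hvert : ∀ p (x : V), X.vertexPt x ∈ (starTriple K (ix p).1.out (c (ix p))).Z →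
      x = (ix p).1.out := fun p x hx => hX.vertexPt_mem_vertexStar_iff.1 hx
  refine ⟨_, fun p => starTriple K (ix p).1.out (c (ix p)), ?_, fun p => ⟨_, rfl, rfl⟩⟩
  constructor
  · rw [Fintype.card_pos_iff]
    obtain ⟨v⟩ := hX.connected.nonempty
    let j : J := Quotient.mk (MulAction.orbitRel G V) v
    -- The cylinders over `F j.out` have total mass one, so one of them has nonzero mass and hence
    -- nonzero multiplicity.
    have h1 := M.m_eq_sum (F j.out) (E := Set.univ) (fun _ _ _ _ => trivial)
      (extendZero _) (restrict_extendZero _)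
    rw [M.univ] at h1
    simp only [Set.mem_univ, if_true] at h1
    obtain ⟨τ, -, hτ⟩ := Finset.exists_ne_zero_of_sum_ne_zero (h1 ▸ one_ne_zero)
    exact ⟨⟨j, τ⟩, 0, Nat.pos_of_ne_zero ((hN ⟨j, τ⟩).2 (div_ne_zero hτ (hs j)))⟩
  · exact fun p => starTriple_isValid hX (hcubes _) (hc _ (hix p)).1
  · intro p e x y he hx hy
    exact absurd ((hvert p x hx).trans (hvert p y hy).symm) (Edge.adj he).1
  · intro p e x y he hx
    refine iff_of_false (fun hy => ?_) (not_lt.2 ((hc _ (hix p)).1.1 _).2)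
    exact (Edge.adj he).1 ((hvert p x hx).trans (hvert p y hy).symm)
  · intro f c₀ hc₀
    rw [encard_gluingSet hX (fun p => hedges _) (fun p => (hc _ (hix p)).1) (hab f) (ha f) (hb' f),
      encard_gluingSet hX (fun p => hedges _) (fun p => (hc _ (hix p)).1)
        ((hab f).trans (Set.pair_comm _ _)) (hb f) (ha' f)]
    have h1 : ∀ y : X.Edge → V, (∀ f, y f ∈ f.1) → ∑ p, (matchEdges R (ix p).1.out (y f) f c₀
        (c (ix p))).ncard = ∑ i, N i * ν y f c₀ i := by
      intro y hy
      rw [← hsum]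
      refine Finset.sum_congr rfl fun p _ => ?_
      -- The extension by zero need not be proper, but it agrees on `F` with the colouring used in
      -- the triple, and only `F` matters for the count.
      rw [matchEdges_congr (hF _) (hy f) hc₀ fun w hw => ((hc _ (hix p)).2 w hw).symm]
    rw [h1 a haf, h1 b hbf]
    have h2 := hNeq (f, ⟨c₀, hc₀⟩)
    simp only [mul_sub, Finset.sum_sub_distrib] at h2
    have h3 : ∑ i, N i * ν a f c₀ i = ∑ i, N i * ν b f c₀ i := by
      zify
      linarith
    rw [h3]
  · exact fun p => QVH.trivial _ (inferInstanceAs (Subsingleton (⊥ : Subgroup G)))
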